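/- **Problem.** Let $f_i,g_i:\mathbb R^{p}\times\mathbb R^{q}\to\mathbb R$ ($i\in[m]$), $f=\frac1m\sum_i f_i$, $g=\frac1m\sum_i g_i$, $y^*(x)=\arg\min_y g(x,y)$ and $\Phi(x)=f(x,y^*(x))$. Write $z=(x,y)$. Assume for all $i\in[m]$ and all $x,z$: 1. $f_i$ is differentiable and $g_i$ twice differentiable; $f_i,\nabla f_i,\nabla g_i,\nabla^2 g_i$ are Lipschitz with constants $\ell_{f,0}\ge 0$, $\ell_{f,1}>0$, $\ell_{g,1}>0$, $\ell_{g,2}\ge 0$; 2. $g_i(x,\cdot)$ is $\mu_g$-strongly convex, $\mu_g>0$; 3. the stochastic oracles $\nabla f_i(z;\xi)$, $\nabla g_i(z;\zeta)$, $\nabla^2g_i(z;\zeta)$, with $\xi,\zeta$ drawn from distributions of client $i$, are unbiased for $\nabla f_i(z),\nabla g_i(z),\nabla^2 g_i(z)$; 4. their variances are at most $\sigma_f^2$, $\sigma_{g,1}^2$, $\sigma_{g,2}^2$; 5. $\|\nabla g_i(z)-\nabla g(z)\|^2\le\sigma_g^2$. Matrices carry the spectral norm. Assume that $\Phi(x^0)-\inf\Phi\le\Delta_\Phi$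 and $\|y^0-y^*(x^0)\|^2\le\Delta_y$ for the deterministic initial point $(x^0,y^0)$. **Algorithm (FedMBO)**, with $1\le n\le m$ and $S,T,N,K\ge1$. For $k=0,\dots,K-1$: put $y^{k,0}=y^k$. For $t=0,\dots,T-1$ draw $n$ distinct clients $c^{k,t}_1,\dots,c^{k,t}_n$ uniformly without replacement, let each of them draw $S$ samples, and put $y^{k,t+1}=y^{k,t}-\beta_{k,t}\frac1{nS}\sum_{i=1}^n\sum_{j=1}^{S}\nabla_yg_{c^{k,t}_i}(x^k,y^{k,t};\xi^{k,t}_{i,j})$. Put $y^{k+1}=y^{k,T}$ and $x^{k+1}=x^k-\alpha_k\frac1n\sum_{i=1}^n\mathcal H_i$. Here, at $z=(x^k,y^{k+1})$, with clients $c_i^l$ drawn uniformly with replacement, $N_i$ uniform on $\{0,\dots,N-1\}$ and fresh data $\theta^i,\phi^i,\zeta^{i,l},\omega^i$ of the clients where they are used, $p_{i,0}=\frac N{\ell_{g,1}}\nabla_yf_{c_i^0}(z;\theta^i)$, $p_{i,l}=(I-\frac1{\ell_{g,1}}\nabla^2_{yy}g_{c_i^l}(z;\zeta^{i,l}))p_{i,l-1}$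 if $l\le N_i$, $p_{i,l}=p_{i,l-1}$ if $l>N_i$, and $\mathcal H_i=\nabla_xf_{c_i^0}(z;\phi^i)-\nabla^2_{xy}g_{c_i^{L+1}}(z;\omega^i)\,p_{i,L}$, $L=\max_jN_j$. All random choices are independent. **Constants.** $\kappa_g=L_y=\ell_{g,1}/\mu_g$, $M_f=\ell_{f,1}+\frac{\ell_{g,1}\ell_{f,1}}{\mu_g}+\frac{\ell_{f,0}}{\mu_g}\big(\ell_{g,2}+\frac{\ell_{g,1}\ell_{g,2}}{\mu_g}\big)$, $L_f=\ell_{f,1}+\frac{\ell_{g,1}(\ell_{f,1}+M_f)}{\mu_g}+\frac{\ell_{f,0}}{\mu_g}\big(\ell_{g,2}+\frac{\ell_{g,1}\ell_{g,2}}{\mu_g}\big)$, $L_{yx}=\frac{\ell_{g,2}+\ell_{g,2}L_y}{\mu_g}+\frac{\ell_{g,1}}{\mu_g^2}(\ell_{g,2}+\ell_{g,2}L_y)$, $\tilde\sigma_f^2=\sigma_f^2+\frac3{\mu_g^2}\big[(\sigma_f^2+\ell_{f,0}^2)(\sigma_{g,2}^2+2\ell_{g,1}^2)+\sigma_f^2\ell_{g,1}^2\big]$,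 $\tilde D_f^2=\big(\ell_{f,0}+\frac{\ell_{f,0}\ell_{g,1}}{\mu_g}+\frac{\ell_{f,1}\ell_{g,1}}{\mu_g}\big)^2+\tilde\sigma_f^2$. For $\eta>0$ and $r\in\{1,n\}$ put $$\hat\alpha_1=\frac1{2L_f+4M_fL_y+\frac{2M_fL_{yx}}{L_y\eta}},\qquad \bar\beta_r=\frac{5M_fL_y}{\mu_g}+\frac{\eta L_{yx}\tilde D_f^2\hat\alpha_1}{2r\mu_g},\qquad \hat\alpha_2=\frac{T}{2\ell_{g,1}\bar\beta_1},$$ $$b=\kappa_g\ell_{f,1}\Big(\frac{\kappa_g-1}{\kappa_g}\Big)^N,\qquad \nu_N=1+N\sum_{j=0}^{N-1}\Big(\big(1-\tfrac{\mu_g}{\ell_{g,1}}\big)^2+\tfrac{\sigma_{g,2}^2}{\ell_{g,1}^2}\Big)^j .$$ **Theorem.** There is a constant $C$, depending only on $\ell_{f,0},\ell_{f,1},\ell_{g,1},\ell_{g,2},\mu_g,\sigma_f,\sigma_{g,1},\sigma_{g,2},\sigma_g,\eta,\Delta_\Phi,\Delta_y$ (so not on $n,m,K,N,S,T,\hat\alpha_3$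 or the dimensions), such that for every $\hat\alpha_3>0$, $r\in\{1,n\}$ and the step sizes $$\alpha_k=\min\Big\{\hat\alpha_1,\hat\alpha_2,\sqrt{\tfrac nK}\,\hat\alpha_3\Big\},\qquad \beta_{k,t}=\bar\beta_r\,\frac{\alpha_k}{T},$$ the function $\Phi$ is differentiable, every $\mathbb E\|\nabla\Phi(x^k)\|^2$ is finite, and $$\frac1K\sum_{k=0}^{K-1}\mathbb E\|\nabla\Phi(x^k)\|^2\le C\Big(\frac{\nu_N\hat\alpha_3+\hat\alpha_3^{-1}}{\sqrt{nK}}+\frac1{\min(\hat\alpha_1,\hat\alpha_2)K}+b^2\Big).$$ In particular, for each fixed $N$ the average is $\mathcal O\big(\frac{\hat\alpha_3+\hat\alpha_3^{-1}}{\sqrt{nK}}+\frac1{\min(\hat\alpha_1,\hat\alpha_2)K}+b^2\big)$, where the factor of $b^2$ does not depend on $N$, and the leading term shows linear speedup in $n$. -/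

import Mathlib

open MeasureTheory ProbabilityTheory

universe u v

namespace FedMBO

/-! ### Numerical constants -/

/-- The constants of the assumptions: Lipschitz constants `lf0, lf1, lg1, lg2`, strong convexity
modulus `mu`, standard deviation bounds `sf, sg1, sg2` of the oracles, heterogeneity bound `sg`. -/
structure Consts where
  lf0 : ℝ
  lf1 : ℝ
  lg1 : ℝ
  lg2 : ℝ
  mu : ℝ
  sf : ℝ
  sg1 : ℝ
  sg2 : ℝ
  sg : ℝ

namespace Consts

variable (c : Consts)

/-- Sign conventions for the constants. -/
structure Valid : Prop where
  lf0_nonneg : 0 ≤ c.lf0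
  lf1_pos : 0 < c.lf1
  lg1_pos : 0 < c.lg1
  lg2_nonneg : 0 ≤ c.lg2
  mu_pos : 0 < c.mu

/-- Condition number `κ_g = ℓ_{g,1} / μ_g`. -/
noncomputable def kappa : ℝ := c.lg1 / c.mu

/-- `M_f`. -/
noncomputable def Mf : ℝ :=
  c.lf1 + c.lg1 * c.lf1 / c.mu + c.lf0 / c.mu * (c.lg2 + c.lg1 * c.lg2 / c.mu)

/-- `L_f`. -/
noncomputable def Lf : ℝ :=
  c.lf1 + c.lg1 * (c.lf1 + c.Mf) / c.mu + c.lf0 / c.mu * (c.lg2 + c.lg1 * c.lg2 / c.mu)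

/-- `L_y`. -/
noncomputable def Ly : ℝ := c.lg1 / c.mu

/-- `L_{yx}`. -/
noncomputable def Lyx : ℝ :=
  (c.lg2 + c.lg2 * c.Ly) / c.mu + c.lg1 / c.mu ^ 2 * (c.lg2 + c.lg2 * c.Ly)

/-- The constant `σ̃_f²`. -/
noncomputable def sigmaTildeSq : ℝ :=
  c.sf ^ 2 + 3 / c.mu ^ 2 *
    ((c.sf ^ 2 + c.lf0 ^ 2) * (c.sg2 ^ 2 + 2 * c.lg1 ^ 2) + c.sf ^ 2 * c.lg1 ^ 2)

/-- The constant `D̃_f²`. -/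
noncomputable def DTildeSq : ℝ :=
  (c.lf0 + c.lf0 * c.lg1 / c.mu + c.lf1 * c.lg1 / c.mu) ^ 2 + c.sigmaTildeSq

/-- `α̂₁`, for the free parameter `η > 0`. -/
noncomputable def alphaHat1 (η : ℝ) : ℝ :=
  1 / (2 * c.Lf + 4 * c.Mf * c.Ly + 2 * c.Mf * c.Lyx / (c.Ly * η))

/-- The proportionality constant in `β = betaBar * α / T`, with a divisor `r` of its second
summand. -/
noncomputable def betaBar (η r : ℝ) : ℝ :=
  5 * c.Mf * c.Ly / c.mu + η * c.Lyx * c.DTildeSq * c.alphaHat1 η / (2 * r * c.mu)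

/-- `α̂₂`, for `T` inner steps. -/
noncomputable def alphaHat2 (η : ℝ) (T : ℕ) : ℝ := T / (2 * c.lg1 * c.betaBar η 1)

/-- The bias `b` of the truncated Neumann series of length `N`. -/
noncomputable def bias (N : ℕ) : ℝ :=
  c.kappa * c.lf1 * ((c.kappa - 1) / c.kappa) ^ N

/-- `ν_N = 1 + N ∑_{j<N} ((1 - μ_g/ℓ_{g,1})² + σ_{g,2}²/ℓ_{g,1}²)^j`: up to a factor that does not depend on `N`, a
bound for the second moment of the randomly truncated Neumann product of the algorithm. -/
noncomputable def neumannFactor (N : ℕ) : ℝ :=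
  1 + N * ∑ j ∈ Finset.range N, ((1 - c.mu / c.lg1) ^ 2 + (c.sg2 / c.lg1) ^ 2) ^ j

end Consts

/-! ### The federated bilevel problem -/

section ProblemSec

/-- The space `ℝ^p × ℝ^q` of pairs `z = (x, y)` with the Euclidean norm of `ℝ^{p+q}`, for Euclidean
spaces `X = ℝ^p` and `Y = ℝ^q`. -/
abbrev Pt (X Y : Type*) := WithLp 2 (X × Y)

variable {X Y : Type*} [NormedAddCommGroup X] [InnerProductSpace ℝ X] [FiniteDimensional ℝ X]
  [NormedAddCommGroup Y] [InnerProductSpace ℝ Y] [FiniteDimensional ℝ Y]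

/-- The pair `(x, y)`. -/
def pt (x : X) (y : Y) : Pt X Y := WithLp.toLp 2 (x, y)

/-- Square matrices, as operators on a Euclidean space, with the spectral norm. -/
abbrev Op (E : Type*) [NormedAddCommGroup E] [InnerProductSpace ℝ E] := E →L[ℝ] E

/-- The block `∇²_{yy}` of a Hessian. -/
noncomputable def blockYY (H : Op (Pt X Y)) (v : Y) : Y := (H (pt 0 v)).snd

/-- The block `∇²_{xy}` of a Hessian, the matrix `(∂²/∂x_i∂y_j)` with `p` rows and `q` columns. -/
noncomputable def blockXY (H : Op (Pt X Y)) (v : Y) : X := (H (pt 0 v)).fst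

/-- The Hessian of a function on `ℝ^{p+q}`, as the derivative of its gradient. -/
noncomputable def hessian (h : Pt X Y → ℝ) (z : Pt X Y) : Op (Pt X Y) :=
  fderiv ℝ (gradient h) z

/-- A federated bilevel problem with `m` clients: client losses `f i`, `g i`, the data
distributions `Df i`, `Dg i` of client `i`, and the stochastic oracles `∇f_i(z; ξ)`, `∇g_i(z; ζ)`,
`∇²g_i(z; ζ)`. -/
structure Problem (m : ℕ) (X Y : Type*) [NormedAddCommGroup X] [InnerProductSpace ℝ X]
    [NormedAddCommGroup Y] [InnerProductSpace ℝ Y] (Zf Zg : Type*) [MeasurableSpace Zf]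
    [MeasurableSpace Zg] where
  f : Fin m → Pt X Y → ℝ
  g : Fin m → Pt X Y → ℝ
  Df : Fin m → Measure Zf
  Dg : Fin m → Measure Zg
  gradF : Fin m → Pt X Y → Zf → Pt X Y
  gradG : Fin m → Pt X Y → Zg → Pt X Y
  hessG : Fin m → Pt X Y → Zg → Op (Pt X Y)

/-- `h` is Lipschitz continuous with constant `L`. -/
def LipConst {E F : Type*} [NormedAddCommGroup E] [NormedAddCommGroup F] (L : ℝ) (h : E → F) :
    Prop :=
  ∀ z w, ‖h z - h w‖ ≤ L * ‖z - w‖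

/-- The random element `X` has mean `a` and variance at most `s²`. -/
structure UnbiasedVar {Z E : Type*} [MeasurableSpace Z] [NormedAddCommGroup E] [NormedSpace ℝ E]
    (D : Measure Z) (X : Z → E) (a : E) (s : ℝ) : Prop where
  integrable : Integrable X D
  mean : ∫ ζ, X ζ ∂D = a
  sq_integrable : Integrable (fun ζ => ‖X ζ - a‖ ^ 2) D
  variance : ∫ ζ, ‖X ζ - a‖ ^ 2 ∂D ≤ s ^ 2

variable {m : ℕ} {Zf Zg : Type*} [MeasurableSpace Zf] [MeasurableSpace Zg]

namespace Problem

variable (B : Problem m X Y Zf Zg)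

/-- The global upper-level loss `f = (1/m) ∑ f_i`. -/
noncomputable def fbar (z : Pt X Y) : ℝ := (1 / (m : ℝ)) * ∑ i, B.f i z

/-- The global lower-level loss `g = (1/m) ∑ g_i`. -/
noncomputable def gbar (z : Pt X Y) : ℝ := (1 / (m : ℝ)) * ∑ i, B.g i z

/-- `ystar x` minimizes the global lower-level loss at `x`, for every `x`. -/
def IsLowerSolution (ystar : X → Y) : Prop :=
  ∀ x y, B.gbar (pt x (ystar x)) ≤ B.gbar (pt x y)

/-- The bilevel objective `Φ(x) = f(x, y*(x))`. -/
noncomputable def Phi (ystar : X → Y) (x : X) : ℝ := B.fbar (pt x (ystar x))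

/-- The standing assumptions on the problem. -/
structure Assumptions [MeasurableSpace X] [BorelSpace X] [MeasurableSpace Y] [BorelSpace Y]
    (c : Consts) : Prop where
  /-- Lipschitz properties; `f_i` is differentiable and `g_i` twice differentiable. -/
  diff_f : ∀ i, Differentiable ℝ (B.f i)
  diff_g : ∀ i, Differentiable ℝ (B.g i)
  diff_grad_g : ∀ i, Differentiable ℝ (gradient (B.g i))
  lip_f : ∀ i, LipConst c.lf0 (B.f i)
  lip_grad_f : ∀ i, LipConst c.lf1 (gradient (B.f i))
  lip_grad_g : ∀ i, LipConst c.lg1 (gradient (B.g i))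
  lip_hess_g : ∀ i, LipConst c.lg2 (hessian (B.g i))
  /-- Strong convexity in `y`. -/
  strong_convex : ∀ i x, StrongConvexOn Set.univ c.mu (fun y => B.g i (pt x y))
  /-- The data distributions are probability measures and the oracles are measurable. -/
  prob_f : ∀ i, IsProbabilityMeasure (B.Df i)
  prob_g : ∀ i, IsProbabilityMeasure (B.Dg i)
  meas_gradF : ∀ i, Measurable (fun u : Pt X Y × Zf => B.gradF i u.1 u.2)
  meas_gradG : ∀ i, Measurable (fun u : Pt X Y × Zg => B.gradG i u.1 u.2)
  meas_hessG : ∀ i, Measurable (fun u : Pt X Y × Zg => B.hessG i u.1 u.2)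
  /-- Unbiased oracles of bounded variance. -/
  oracle_gradF : ∀ i z, UnbiasedVar (B.Df i) (B.gradF i z) (gradient (B.f i) z) c.sf
  oracle_gradG : ∀ i z, UnbiasedVar (B.Dg i) (B.gradG i z) (gradient (B.g i) z) c.sg1
  oracle_hessG : ∀ i z, UnbiasedVar (B.Dg i) (B.hessG i z) (hessian (B.g i) z) c.sg2
  /-- Bounded client heterogeneity. -/
  heterogeneity : ∀ i z, ‖gradient (B.g i) z - gradient B.gbar z‖ ^ 2 ≤ c.sg ^ 2

end Problem

end ProblemSec

/-! ### The randomness of the algorithm -/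

/-- The random choices of the algorithm in outer round `k`. A data slot carries one candidate
datum for every client `c`; the algorithm reads the one of the client that occupies the slot, so
the datum it uses is a fresh sample of the distribution of that client. -/
inductive Source (m n S : ℕ) : Type
  /-- the `n` distinct clients of inner step `t` -/
  | innerClients (k t : ℕ)
  /-- datum `j` of the batch in slot `i` of inner step `t` -/
  | innerData (k t : ℕ) (i : Fin n) (j : Fin S) (c : Fin m)
  /-- the truncation level `N_i` -/
  | trunc (k : ℕ) (i : Fin n)
  /-- the client `c_i^l` of the hypergradient estimator -/
  | client (k l : ℕ) (i : Fin n)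
  /-- the datum `θ^i` -/
  | theta (k : ℕ) (i : Fin n) (c : Fin m)
  /-- the datum `φ^i` -/
  | phi (k : ℕ) (i : Fin n) (c : Fin m)
  /-- the datum `ζ^{i,l}` -/
  | zeta (k : ℕ) (i : Fin n) (l : ℕ) (c : Fin m)
  /-- the datum `ω^i` -/
  | omega (k : ℕ) (i : Fin n) (c : Fin m)

/-- The space in which a random choice takes its values. -/
def Source.Val {m n S : ℕ} (Zf Zg : Type u) (N : ℕ) : Source m n S → Type u
  | .innerClients _ _ => ULift (Fin n ↪ Fin m)
  | .innerData _ _ _ _ _ => Zg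
  | .trunc _ _ => ULift (Fin N)
  | .client _ _ _ => ULift (Fin m)
  | .theta _ _ _ => Zf
  | .phi _ _ _ => Zf
  | .zeta _ _ _ _ => Zg
  | .omega _ _ _ => Zg

instance Source.instMeasurableSpaceVal {m n S : ℕ} (Zf Zg : Type u) [MeasurableSpace Zf]
    [MeasurableSpace Zg] (N : ℕ) : ∀ s : Source m n S, MeasurableSpace (s.Val Zf Zg N)
  | .innerClients _ _ => ⊤
  | .innerData _ _ _ _ _ => inferInstanceAs (MeasurableSpace Zg)
  | .trunc _ _ => ⊤
  | .client _ _ _ => ⊤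
  | .theta _ _ _ => inferInstanceAs (MeasurableSpace Zf)
  | .phi _ _ _ => inferInstanceAs (MeasurableSpace Zf)
  | .zeta _ _ _ _ => inferInstanceAs (MeasurableSpace Zg)
  | .omega _ _ _ => inferInstanceAs (MeasurableSpace Zg)

/-- The law of a random choice: in the inner loop the `n` clients are drawn uniformly without
replacement, in the hypergradient estimator every client is drawn uniformly (with replacement),
truncation levels are uniform on `{0, …, N-1}`, and data follow the distribution of their client. -/
noncomputable def Source.law {m n S : ℕ} {X Y : Type*} [NormedAddCommGroup X]
    [InnerProductSpace ℝ X] [NormedAddCommGroup Y] [InnerProductSpace ℝ Y] {Zf Zg : Type u} [MeasurableSpace Zf]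
    [MeasurableSpace Zg] (B : Problem m X Y Zf Zg) (N : ℕ) :
    ∀ s : Source m n S, Measure (s.Val Zf Zg N)
  | .innerClients _ _ => @uniformOn (ULift (Fin n ↪ Fin m)) ⊤ Set.univ
  | .innerData _ _ _ _ c => B.Dg c
  | .trunc _ _ => @uniformOn (ULift (Fin N)) ⊤ Set.univ
  | .client _ _ _ => @uniformOn (ULift (Fin m)) ⊤ Set.univ
  | .theta _ _ c => B.Df c
  | .phi _ _ c => B.Df c
  | .zeta _ _ _ c => B.Dg c
  | .omega _ _ c => B.Dg c

/-- A full record of all random choices. -/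
abbrev Draws (m n S N : ℕ) (Zf Zg : Type u) := ∀ s : Source m n S, s.Val Zf Zg N

/-- The random choices `d` on the probability space `(Ω, P)` are independent and have the
prescribed laws. -/
structure IsSampling {m n S : ℕ} {X Y : Type*} [NormedAddCommGroup X]
    [InnerProductSpace ℝ X] [NormedAddCommGroup Y] [InnerProductSpace ℝ Y] {Zf Zg : Type u} [MeasurableSpace Zf] [MeasurableSpace Zg]
    (B : Problem m X Y Zf Zg) (N : ℕ) {Ω : Type v} [MeasurableSpace Ω] (P : Measure Ω)
    (d : Ω → Draws m n S N Zf Zg) : Prop where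
  measurable : ∀ s, Measurable (fun ω => d ω s)
  law_eq : ∀ s, P.map (fun ω => d ω s) = s.law B N
  indep : iIndepFun (fun s ω => d ω s) P

/-! ### The algorithm -/

section Algorithm

variable {m n S N : ℕ} {X Y : Type*} [NormedAddCommGroup X] [InnerProductSpace ℝ X]
  [NormedAddCommGroup Y] [InnerProductSpace ℝ Y] {Zf Zg : Type u} [MeasurableSpace Zf] [MeasurableSpace Zg]

namespace Draws

variable (d : Draws m n S N Zf Zg)

/-- The client `c_i^{k,t}` in slot `i` of inner step `t` of round `k`. -/
def innerClient (k t : ℕ) (i : Fin n) : Fin m := (d (.innerClients k t)).down i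

/-- The datum `ξ_{i,j}^{k,t}`, a sample of client `c_i^{k,t}`. -/
def xi (k t : ℕ) (i : Fin n) (j : Fin S) : Zg := d (.innerData k t i j (d.innerClient k t i))

/-- The truncation level `N_i`. -/
def trunc (k : ℕ) (i : Fin n) : ℕ := (d (.trunc k i)).down

/-- `max_i N_i`. -/
def maxTrunc (k : ℕ) : ℕ := Finset.univ.sup (d.trunc k)

/-- The client `c_i^l` of the hypergradient estimator in round `k`. -/
def client (k l : ℕ) (i : Fin n) : Fin m := (d (.client k l i)).down

/-- The datum `θ^i`, a sample of client `c_i^0`. -/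
def theta (k : ℕ) (i : Fin n) : Zf := d (.theta k i (d.client k 0 i))

/-- The datum `φ^i`, a sample of client `c_i^0`. -/
def phi (k : ℕ) (i : Fin n) : Zf := d (.phi k i (d.client k 0 i))

/-- The datum `ζ^{i,l}`, a sample of client `c_i^l`. -/
def zeta (k l : ℕ) (i : Fin n) : Zg := d (.zeta k i l (d.client k l i))

/-- The datum `ω^i`, a sample of client `c_i^{max N + 1}`. -/
def omega (k : ℕ) (i : Fin n) : Zg := d (.omega k i (d.client k (d.maxTrunc k + 1) i))

end Draws

variable (B : Problem m X Y Zf Zg) (lg1 : ℝ) (d : Draws m n S N Zf Zg)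

/-- The vectors `p_{i,l}` of the parallel hypergradient estimator at `z`. -/
noncomputable def pheVec (k : ℕ) (z : Pt X Y) (i : Fin n) : ℕ → Y
  | 0 => ((N : ℝ) / lg1) • (B.gradF (d.client k 0 i) z (d.theta k i)).snd
  | l + 1 =>
    if l + 1 ≤ d.trunc k i then
      pheVec k z i l - (1 / lg1) •
        blockYY (B.hessG (d.client k (l + 1) i) z (d.zeta k (l + 1) i)) (pheVec k z i l)
    else pheVec k z i l

/-- The output `H_i` of the parallel hypergradient estimator at `z` in round `k`. -/
noncomputable def phe (k : ℕ) (z : Pt X Y) (i : Fin n) : X :=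
  (B.gradF (d.client k 0 i) z (d.phi k i)).fst -
    blockXY (B.hessG (d.client k (d.maxTrunc k + 1) i) z (d.omega k i))
      (pheVec B lg1 d k z i (d.maxTrunc k))

/-- The averaged minibatch gradient `G^{k,t}` at `(x, y)`. -/
noncomputable def innerGrad (k t : ℕ) (x : X) (y : Y) : Y :=
  (1 / (n : ℝ)) • ∑ i : Fin n, (1 / (S : ℝ)) • ∑ j : Fin S,
    (B.gradG (d.innerClient k t i) (pt x y) (d.xi k t i j)).snd

/-- The inner iterates `y^{k,t}` started at `y`, with step sizes `β t`. -/
noncomputable def innerIter (β : ℕ → ℝ) (k : ℕ) (x : X) (y : Y) : ℕ → Y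
  | 0 => y
  | t + 1 => innerIter β k x y t - β t • innerGrad B d k t x (innerIter β k x y t)

/-- The iterates `(x^k, y^k)` of FedMBO with `T` inner steps and step sizes `α k`, `β k t`. -/
noncomputable def iter (T : ℕ) (α : ℕ → ℝ) (β : ℕ → ℕ → ℝ) (x₀ : X) (y₀ : Y) :
    ℕ → X × Y
  | 0 => (x₀, y₀)
  | k + 1 =>
    let x := (iter T α β x₀ y₀ k).1
    let y' := innerIter B d (β k) k x (iter T α β x₀ y₀ k).2 T
    (x - α k • ((1 / (n : ℝ)) • ∑ i : Fin n, phe B lg1 d k (pt x y') i), y')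

end Algorithm

end FedMBO

set_option linter.unusedSectionVars false

/-! The argument is a Lyapunov descent for V(x,y) = Φ(x) - Φlow + A‖y - y*(x)‖² with A = Mf/Ly and
Φlow = Φ(x⁰) - ΔΦ. Differentiating ∇_y g(x, y*(x)) = 0 identifies ∇Φ with the hypergradient at (x,
y*(x)) (`hasGradientAt_bilevel`). It is bounded and Lf-Lipschitz, and replacing y*(x) by y changes
it by at most Mf‖y - y*(x)‖.

Noise: given the past, the averaged estimator H has the Neumann-truncated hypergradient h as its
mean, which is within `truncBias` of the exact one, and its variance s is of order ν_N/n, because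
the n slots are independent once the truncation levels are fixed (`meanVar_average_phe`). An inner
step contracts toward y*(x) and adds variance of order β²/n, because draws without replacement are
nonpositively correlated (`meanVar_innerGrad`).

Outer step: the noise of x must not enter the drift of y* at first order in α. The map y* has a
second-order Taylor bound, and it is expanded at the deterministic point x - αh. The term linear in
H - h then has mean zero, and only α²‖H - h‖² remains (`norm_sub_target_sq_le`,
`lintegral_descent_le`). This inflates the inner error by at most 1 + 10 Mf Ly α. Since Tβ = β̄α
with β̄ ≥ 5 Mf Ly/μ, the T inner steps shrink its square by exp(-10 Mf Ly α) or more, which cancels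
the inflation (`Valid.contraction_le`). Telescoping bounds the average of E‖∇Φ‖² by a multiple of
1/(αK) + b² + αν_N/n, and `step_size_rate` inserts the step size.

Absorbing the curvature of y* requires that αν_N/n be below a constant, which the step sizes, chosen
without regard to N, do not guarantee. If it fails, αν_N/n is itself bounded below and the uniform
bound on ‖∇Φ‖ suffices.

Conditioning on the past is replaced by resampling coordinates of a product measure
(`lintegral_fresh`), and the recursion runs in [0,∞], so that no moment of the iterates has to be
known in advance. -/

namespace FedMBO

/-! ### Resampling coordinates of a product measure -/

section Product

variable {ι : Type*} {V : ι → Type*} [∀ i, MeasurableSpace (V i)] (ν : ∀ i, Measure (V i))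
  [∀ i, IsProbabilityMeasure (ν i)]

open scoped Classical in
theorem measurable_piecewise_pair (S : Set ι) :
    Measurable (fun p : (∀ i, V i) × (∀ i, V i) => S.piecewise p.1 p.2) := by
  refine measurable_pi_lambda _ fun i => ?_
  by_cases h : i ∈ S
  · simp only [Set.piecewise, h, if_true]
    exact (measurable_pi_apply i).comp measurable_fst
  · simp only [Set.piecewise, h, if_false]
    exact (measurable_pi_apply i).comp measurable_snd

open scoped Classical in
/-- Resampling the coordinates outside `S` does not change a product measure. -/
theorem map_piecewise_pair (S : Set ι) :
    ((Measure.infinitePi ν).prod (Measure.infinitePi ν)).map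
      (fun p : (∀ i, V i) × (∀ i, V i) => S.piecewise p.1 p.2) = Measure.infinitePi ν := by
  refine Measure.eq_infinitePi ν fun s t ht => ?_
  rw [Measure.map_apply (measurable_piecewise_pair S)
    (MeasurableSet.pi s.countable_toSet fun i _ => ht i)]
  have : (fun p : (∀ i, V i) × (∀ i, V i) => S.piecewise p.1 p.2) ⁻¹' (Set.pi (s : Set ι) t) =
      (Set.pi (s.filter (· ∈ S) : Finset ι) t) ×ˢ (Set.pi (s.filter (· ∉ S) : Finset ι) t) := by
    ext p
    simp only [Set.mem_preimage, Set.mem_pi, Set.mem_prod, Finset.coe_filter, Set.mem_ofPred_eq,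
      Finset.mem_coe]
    constructor
    · intro h
      refine ⟨fun i hi => ?_, fun i hi => ?_⟩
      · have := h i hi.1; rwa [Set.piecewise_eq_of_mem _ _ _ hi.2] at this
      · have := h i hi.1; rwa [Set.piecewise_eq_of_notMem _ _ _ hi.2] at this
    · rintro ⟨h1, h2⟩ i hi
      by_cases hS : i ∈ S
      · rw [Set.piecewise_eq_of_mem _ _ _ hS]; exact h1 i ⟨hi, hS⟩
      · rw [Set.piecewise_eq_of_notMem _ _ _ hS]; exact h2 i ⟨hi, hS⟩
  rw [this, Measure.prod_prod, Measure.infinitePi_pi _ fun i _ => ht i,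
    Measure.infinitePi_pi _ fun i _ => ht i, Finset.prod_filter_mul_prod_filter_not]

variable {ν}
variable {β : Type*} [MeasurableSpace β] {S S' : Set ι} {W : (∀ i, V i) → β}

/-- Fubini for disjoint blocks of coordinates: the past value `W δ` is kept while everything that
`Ψ` reads is redrawn. This plays the role of conditioning on the past and needs no integrability. -/
theorem lintegral_fresh (hW : Measurable W) (hWS : DependsOn W S)
    {Ψ : β → (∀ i, V i) → ENNReal} (hΨ : Measurable (Function.uncurry Ψ))
    (hΨS : ∀ w, DependsOn (Ψ w) S') (hS : Disjoint S S') :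
    ∫⁻ δ, Ψ (W δ) δ ∂Measure.infinitePi ν
      = ∫⁻ δ, ∫⁻ δ', Ψ (W δ) δ' ∂Measure.infinitePi ν ∂Measure.infinitePi ν := by
  classical
  have hm : Measurable fun δ => Ψ (W δ) δ := hΨ.comp (hW.prodMk measurable_id)
  -- Redraw the coordinates outside `S`: then `W` sees only `δ`, and `Ψ w` only `δ'`, because `S'`
  -- lies outside `S`.
  conv_lhs => rw [← map_piecewise_pair ν S]
  rw [lintegral_map hm (measurable_piecewise_pair S)]
  refine (lintegral_prod _ (hm.comp (measurable_piecewise_pair S)).aemeasurable).trans ?_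
  refine lintegral_congr fun δ => lintegral_congr fun δ' => ?_
  dsimp only [Function.comp_apply]
  rw [hWS (y := δ) fun i hi => Set.piecewise_eq_of_mem _ _ _ hi]
  exact hΨS _ fun i hi => Set.piecewise_eq_of_notMem _ _ _ fun h => hS.notMem_of_mem_left h hi

theorem integral_fresh {E : Type*} [NormedAddCommGroup E] [NormedSpace ℝ E] [MeasurableSpace E]
    [BorelSpace E] [SecondCountableTopology E] (hWS : DependsOn W S)
    {Ψ : β → (∀ i, V i) → E}
    (hΨS : ∀ w, DependsOn (Ψ w) S') (hS : Disjoint S S')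
    (hI : Integrable (fun δ => Ψ (W δ) δ) (Measure.infinitePi ν)) :
    ∫ δ, Ψ (W δ) δ ∂Measure.infinitePi ν
      = ∫ δ, ∫ δ', Ψ (W δ) δ' ∂Measure.infinitePi ν ∂Measure.infinitePi ν := by
  classical
  have hm := (measurable_piecewise_pair (V := V) S)
  rw [← map_piecewise_pair ν S] at hI
  conv_lhs => rw [← map_piecewise_pair ν S]
  rw [integral_map hm.aemeasurable hI.1]
  refine (integral_prod _ (hI.comp_measurable hm)).trans ?_
  refine integral_congr_ae (.of_forall fun δ => integral_congr_ae (.of_forall fun δ' => ?_))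
  dsimp only [Function.comp_apply]
  rw [hWS (y := δ) fun i hi => Set.piecewise_eq_of_mem _ _ _ hi]
  exact hΨS _ fun i hi => Set.piecewise_eq_of_notMem _ _ _ fun h => hS.notMem_of_mem_left h hi

end Product

/-! ### Mean and variance of random vectors -/

section MeanVar

variable {Ω : Type*} [MeasurableSpace Ω] {E F : Type*} [NormedAddCommGroup E]
  [InnerProductSpace ℝ E] [CompleteSpace E] [NormedAddCommGroup F] [InnerProductSpace ℝ F]
  [CompleteSpace F]

/-- `X` is square integrable with mean `a` and variance at most `v`. -/
structure MeanVar (μ : Measure Ω) (X : Ω → E) (a : E) (v : ℝ) : Prop where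
  memLp : MemLp X 2 μ
  mean : ∫ ω, X ω ∂μ = a
  var : ∫ ω, ‖X ω - a‖ ^ 2 ∂μ ≤ v

variable {μ : Measure Ω} [IsProbabilityMeasure μ] {X : Ω → E} {a : E} {v : ℝ}

theorem _root_.MeasureTheory.MemLp.integrable_sq_norm_sub (h : MemLp X 2 μ) (b : E) :
    Integrable (fun ω => ‖X ω - b‖ ^ 2) μ :=
  (h.sub (memLp_const b)).integrable_norm_pow (by norm_num)

theorem _root_.MeasureTheory.MemLp.integral_sq_norm_sub (h : MemLp X 2 μ) (b : E) :
    ∫ ω, ‖X ω - b‖ ^ 2 ∂μ = ∫ ω, ‖X ω - ∫ ω, X ω ∂μ‖ ^ 2 ∂μ + ‖∫ ω, X ω ∂μ - b‖ ^ 2 := by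
  set a := ∫ ω, X ω ∂μ with ha
  have hX : Integrable X μ := h.integrable (by norm_num)
  have e : ∀ ω, ‖X ω - b‖ ^ 2 = ‖X ω - a‖ ^ 2 + 2 * inner ℝ (a - b) (X ω - a) + ‖a - b‖ ^ 2 := by
    intro ω
    rw [show X ω - b = (X ω - a) + (a - b) by abel, norm_add_sq_real, real_inner_comm]
  have hd : Integrable (fun ω => X ω - a) μ := hX.sub (integrable_const a)
  have hi : Integrable (fun ω => inner ℝ (a - b) (X ω - a)) μ := hd.const_inner (a - b)
  simp_rw [e]
  have h1 : Integrable (fun ω => ‖X ω - a‖ ^ 2 + 2 * inner ℝ (a - b) (X ω - a)) μ :=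
    (h.integrable_sq_norm_sub a).add (hi.const_mul 2)
  rw [integral_add h1 (integrable_const _), integral_add (h.integrable_sq_norm_sub a) (hi.const_mul 2), integral_const_mul,
    integral_inner hd, integral_sub hX (integrable_const a)]
  simp [← ha]

theorem _root_.MeasureTheory.MemLp.integral_sq_norm (h : MemLp X 2 μ) :
    ∫ ω, ‖X ω‖ ^ 2 ∂μ = ∫ ω, ‖X ω - ∫ ω, X ω ∂μ‖ ^ 2 ∂μ + ‖∫ ω, X ω ∂μ‖ ^ 2 := by
  simpa using h.integral_sq_norm_sub 0

theorem _root_.MeasureTheory.MemLp.sq_norm_integral_le (h : MemLp X 2 μ) :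
    ‖∫ ω, X ω ∂μ‖ ^ 2 ≤ ∫ ω, ‖X ω‖ ^ 2 ∂μ := by
  rw [h.integral_sq_norm]
  have : 0 ≤ ∫ ω, ‖X ω - ∫ ω, X ω ∂μ‖ ^ 2 ∂μ := integral_nonneg fun _ => by positivity
  linarith

namespace MeanVar

theorem integral_sq_norm_sub_le (h : MeanVar μ X a v) (b : E) :
    ∫ ω, ‖X ω - b‖ ^ 2 ∂μ ≤ v + ‖a - b‖ ^ 2 := by
  rw [h.memLp.integral_sq_norm_sub, h.mean]; linarith [h.var]

theorem integral_sq_norm_le (h : MeanVar μ X a v) : ∫ ω, ‖X ω‖ ^ 2 ∂μ ≤ v + ‖a‖ ^ 2 := by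
  simpa using h.integral_sq_norm_sub_le 0

theorem integrable (h : MeanVar μ X a v) : Integrable X μ := h.memLp.integrable (by norm_num)

theorem of_sq_norm_le (h : MemLp X 2 μ) (ha : ∫ ω, X ω ∂μ = a) (hv : ∫ ω, ‖X ω‖ ^ 2 ∂μ ≤ v) :
    MeanVar μ X a v := by
  refine ⟨h, ha, ?_⟩
  have := h.integral_sq_norm
  rw [ha] at this
  nlinarith [sq_nonneg ‖a‖]

theorem smul (h : MeanVar μ X a v) (c : ℝ) : MeanVar μ (fun ω => c • X ω) (c • a) (c ^ 2 * v) := by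
  refine ⟨h.memLp.const_smul c, by rw [integral_smul, h.mean], ?_⟩
  simp_rw [← smul_sub, norm_smul, mul_pow, integral_const_mul]
  simpa using mul_le_mul_of_nonneg_left h.var (sq_nonneg c)

theorem clm (h : MeanVar μ X a v) (f : E →L[ℝ] F) (hf : ‖f‖ ≤ 1) :
    MeanVar μ (fun ω => f (X ω)) (f a) v := by
  refine ⟨f.comp_memLp' h.memLp, by rw [f.integral_comp_comm h.integrable, h.mean], ?_⟩
  refine le_trans (integral_mono_of_nonneg (.of_forall fun _ => by positivity)
    (h.memLp.integrable_sq_norm_sub a) (.of_forall fun ω => ?_)) h.var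
  dsimp only
  rw [← map_sub]
  gcongr
  exact (f.le_of_opNorm_le hf _).trans_eq (one_mul _)

theorem mono {w : ℝ} (h : MeanVar μ X a v) (hvw : v ≤ w) : MeanVar μ X a w :=
  ⟨h.memLp, h.mean, h.var.trans hvw⟩

end MeanVar

theorem UnbiasedVar.meanVar {s : ℝ} (h : UnbiasedVar μ X a s) : MeanVar μ X a (s ^ 2) := by
  refine ⟨?_, h.mean, h.variance⟩
  have h1 : MemLp (fun ω => X ω - a) 2 μ :=
    (memLp_two_iff_integrable_sq_norm
      (h.integrable.1.sub aestronglyMeasurable_const)).2 h.sq_integrable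
  have h2 : X = (fun ω => X ω - a) + fun _ => a := by ext; simp
  rw [h2]
  exact h1.add (memLp_const a)

end MeanVar

/-! ### Independent sums, random selection, random operators -/

section Indep

variable {ι : Type*} {V : ι → Type*} [∀ i, MeasurableSpace (V i)] {ν : ∀ i, Measure (V i)}
  [∀ i, IsProbabilityMeasure (ν i)] {E F : Type*} [NormedAddCommGroup E] [InnerProductSpace ℝ E]
  [FiniteDimensional ℝ E] [MeasurableSpace E] [BorelSpace E] [NormedAddCommGroup F]
  [InnerProductSpace ℝ F] [FiniteDimensional ℝ F] [MeasurableSpace F] [BorelSpace F]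

theorem _root_.MeasureTheory.MemLp.integrable_inner_mul {Ω : Type*} [MeasurableSpace Ω]
    {μ : Measure Ω} {X Y : Ω → E} (hX : MemLp X 2 μ) (hY : MemLp Y 2 μ) :
    Integrable (fun ω => inner ℝ (X ω) (Y ω)) μ := by
  refine ((hX.integrable_norm_pow (p := 2) (by norm_num)).add
    (hY.integrable_norm_pow (p := 2) (by norm_num))).mono (hX.1.inner hY.1) (.of_forall fun ω => ?_)
  have := norm_inner_le_norm (𝕜 := ℝ) (X ω) (Y ω)
  refine this.trans (le_trans ?_ (le_abs_self _))
  simp only [Pi.add_apply]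
  nlinarith [sq_nonneg (‖X ω‖ - ‖Y ω‖), sq_nonneg (‖X ω‖ + ‖Y ω‖)]

theorem integral_inner_fresh {S S' : Set ι} {X Y : (∀ i, V i) → E} (hX : DependsOn X S)
    (hY : DependsOn Y S') (hS : Disjoint S S') (hXp : MemLp X 2 (Measure.infinitePi ν))
    (hYp : MemLp Y 2 (Measure.infinitePi ν)) :
    ∫ δ, inner ℝ (X δ) (Y δ) ∂Measure.infinitePi ν
      = inner ℝ (∫ δ, X δ ∂Measure.infinitePi ν) (∫ δ, Y δ ∂Measure.infinitePi ν) := by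
  rw [integral_fresh (W := X) (Ψ := fun w δ => inner ℝ w (Y δ)) hX
    (fun w δ δ' h => by dsimp only; rw [hY h]) hS]
  · simp_rw [integral_inner (hYp.integrable (by norm_num))]
    simp_rw [real_inner_comm (∫ δ, Y δ ∂Measure.infinitePi ν)]
    rw [integral_inner (hXp.integrable (by norm_num)), real_inner_comm]
  · exact hXp.integrable_inner_mul hYp

/-- Means and variances of a sum of independent random vectors add up. -/
theorem MeanVar.sum {κ : Type*} [Fintype κ] {S : κ → Set ι} {X : κ → (∀ i, V i) → E} {a : κ → E}
    {v : κ → ℝ} (hX : ∀ j, DependsOn (X j) (S j)) (hS : Pairwise fun i j => Disjoint (S i) (S j))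
    (h : ∀ j, MeanVar (Measure.infinitePi ν) (X j) (a j) (v j)) :
    MeanVar (Measure.infinitePi ν) (fun δ => ∑ j, X j δ) (∑ j, a j) (∑ j, v j) := by
  classical
  refine ⟨memLp_finsetSum _ fun j _ => (h j).memLp, ?_, ?_⟩
  · rw [integral_finsetSum _ fun j _ => (h j).integrable]
    simp [(h _).mean]
  have hc : ∀ j, MemLp (fun δ => X j δ - a j) 2 (Measure.infinitePi ν) := fun j =>
    (h j).memLp.sub (memLp_const _)
  have e : ∀ δ, ‖∑ j, X j δ - ∑ j, a j‖ ^ 2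
      = ∑ i, ∑ j, inner ℝ (X i δ - a i) (X j δ - a j) := by
    intro δ
    rw [← Finset.sum_sub_distrib, ← real_inner_self_eq_norm_sq, sum_inner]
    simp_rw [inner_sum]
  have hint : ∀ i j, Integrable (fun δ => inner ℝ (X i δ - a i) (X j δ - a j))
      (Measure.infinitePi ν) := fun i j => (hc i).integrable_inner_mul (hc j)
  simp_rw [e]
  rw [integral_finsetSum _ fun i _ => integrable_finsetSum _ fun j _ => hint i j]
  refine Finset.sum_le_sum fun i _ => ?_
  rw [integral_finsetSum _ fun j _ => hint i j, Finset.sum_eq_single i]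
  · simp_rw [real_inner_self_eq_norm_sq]
    exact (h i).var
  · intro j _ hj
    rw [integral_inner_fresh (S := S i) (S' := S j)
      (fun δ δ' hδ => by rw [hX i hδ]) (fun δ δ' hδ => by rw [hX j hδ])
      (hS hj.symm) (hc i) (hc j)]
    rw [integral_sub (h i).integrable (integrable_const _), (h i).mean]
    simp
  · simp

/-- A random vector selected by an independent finite random variable. -/
theorem memLp_select {κ : Type*} [Fintype κ] [MeasurableSpace κ] [MeasurableSingletonClass κ]
    {Ω : Type*} [MeasurableSpace Ω] {μ : Measure Ω} {W : Ω → κ}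
    (hW : Measurable W) {X : κ → Ω → E} (h : ∀ w, MemLp (X w) 2 μ) :
    MemLp (fun δ => X (W δ) δ) 2 μ := by
  classical
  have : (fun δ => X (W δ) δ) = fun δ => ∑ w, (W ⁻¹' {w}).indicator (X w) δ := by
    ext δ
    simp only [Set.indicator, Set.mem_preimage, Set.mem_singleton_iff]
    simp
  rw [this]
  exact memLp_finsetSum _ fun w _ => (h w).indicator (hW (measurableSet_singleton w))

/-- Law of total variance: the conditional variance averaged over `W`, plus the variance of the
conditional mean. -/
theorem MeanVar.select {κ : Type*} [Fintype κ] [MeasurableSpace κ] [MeasurableSingletonClass κ]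
    {S S' : Set ι} {W : (∀ i, V i) → κ} (hW : Measurable W) (hWS : DependsOn W S)
    {X : κ → (∀ i, V i) → E} (hX : ∀ w, DependsOn (X w) S') (hS : Disjoint S S')
    {a : κ → E} {v : κ → ℝ} {b : E} {w : ℝ}
    (h : ∀ w, MeanVar (Measure.infinitePi ν) (X w) (a w) (v w))
    (ha : MeanVar (Measure.infinitePi ν) (fun δ => a (W δ)) b w) :
    MeanVar (Measure.infinitePi ν) (fun δ => X (W δ) δ) b
      ((∫ δ, v (W δ) ∂Measure.infinitePi ν) + w) := by
  have hm := memLp_select hW fun w => (h w).memLp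
  have hb : ∀ φ : κ → ℝ, Integrable (fun δ => φ (W δ)) (Measure.infinitePi ν) := fun φ =>
    Integrable.of_bound ((measurable_of_finite φ).comp hW).aestronglyMeasurable (∑ k, ‖φ k‖)
      (.of_forall fun δ => Finset.single_le_sum (f := fun k => ‖φ k‖)
        (fun _ _ => norm_nonneg _) (Finset.mem_univ _))
  refine ⟨hm, ?_, ?_⟩
  · rw [integral_fresh hWS hX hS (hm.integrable (by norm_num)), ← ha.mean]
    simp [(h _).mean]
  · rw [integral_fresh (Ψ := fun k δ => ‖X k δ - b‖ ^ 2) hWS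
      (fun k δ δ' hδ => by dsimp only; rw [hX k hδ]) hS (hm.integrable_sq_norm_sub b)]
    calc _ ≤ ∫ δ, (v (W δ) + ‖a (W δ) - b‖ ^ 2) ∂Measure.infinitePi ν :=
          integral_mono_of_nonneg (.of_forall fun _ => integral_nonneg fun _ => by positivity)
            (hb fun k => v k + ‖a k - b‖ ^ 2) (.of_forall fun δ => (h _).integral_sq_norm_sub_le b)
      _ = _ + ∫ δ, ‖a (W δ) - b‖ ^ 2 ∂Measure.infinitePi ν :=
          integral_add (hb v) (hb fun k => ‖a k - b‖ ^ 2)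
      _ ≤ _ := by gcongr; exact ha.var

/-- A random operator applied to an independent random vector. -/
theorem memLp_apply_fresh {S S' : Set ι} {q : (∀ i, V i) → E} (hq : Measurable q)
    (hqS : DependsOn q S) {M : (∀ i, V i) → E →L[ℝ] F} (hM : Measurable M)
    (hMS : DependsOn M S') (hS : Disjoint S S') {R : E →L[ℝ] F} {ρ : ℝ} (hρ : 0 ≤ ρ)
    (hmem : ∀ v, MemLp (fun δ => M δ v) 2 (Measure.infinitePi ν))
    (hmean : ∀ v, ∫ δ, M δ v ∂Measure.infinitePi ν = R v)
    (hsq : ∀ v, ∫ δ, ‖M δ v‖ ^ 2 ∂Measure.infinitePi ν ≤ ρ * ‖v‖ ^ 2)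
    (hqp : MemLp q 2 (Measure.infinitePi ν)) :
    MemLp (fun δ => M δ (q δ)) 2 (Measure.infinitePi ν) ∧
    ∫ δ, M δ (q δ) ∂Measure.infinitePi ν = R (∫ δ, q δ ∂Measure.infinitePi ν) ∧
    ∫ δ, ‖M δ (q δ)‖ ^ 2 ∂Measure.infinitePi ν ≤ ρ * ∫ δ, ‖q δ‖ ^ 2 ∂Measure.infinitePi ν := by
  set μ := Measure.infinitePi ν
  have hjm : Measurable fun p : E × (∀ i, V i) => M p.2 p.1 := by
    have : Continuous fun p : (E →L[ℝ] F) × E => p.1 p.2 := isBoundedBilinearMap_apply.continuous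
    exact this.measurable.comp ((hM.comp measurable_snd).prodMk measurable_fst)
  have hmeas : Measurable fun δ => M δ (q δ) := hjm.comp (hq.prodMk measurable_id)
  have hint : Integrable (fun δ => ‖q δ‖ ^ 2) μ := hqp.integrable_norm_pow (by norm_num)
  -- The bound is proved in [0,∞], since square integrability of the product is a consequence of it.
  have key : ∫⁻ δ, ENNReal.ofReal (‖M δ (q δ)‖ ^ 2) ∂μ
      ≤ ENNReal.ofReal (ρ * ∫ δ, ‖q δ‖ ^ 2 ∂μ) := by
    rw [lintegral_fresh (Ψ := fun w δ => ENNReal.ofReal (‖M δ w‖ ^ 2)) hq hqS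
      (by exact (hjm.norm.pow_const 2).ennreal_ofReal)
      (fun w δ δ' h => by dsimp only; rw [hMS h]) hS]
    calc _ ≤ ∫⁻ δ, ENNReal.ofReal (ρ * ‖q δ‖ ^ 2) ∂μ := by
          refine lintegral_mono fun δ => ?_
          rw [← ofReal_integral_eq_lintegral_ofReal ((hmem _).integrable_norm_pow (by norm_num))
            (.of_forall fun _ => by positivity)]
          exact ENNReal.ofReal_le_ofReal (hsq _)
      _ = _ := by
          rw [← ofReal_integral_eq_lintegral_ofReal (hint.const_mul ρ)
            (.of_forall fun _ => by positivity), integral_const_mul]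
  have hmem' : MemLp (fun δ => M δ (q δ)) 2 μ := by
    rw [memLp_two_iff_integrable_sq_norm hmeas.aestronglyMeasurable]
    refine ⟨(hmeas.norm.pow_const 2).aestronglyMeasurable, ?_⟩
    rw [hasFiniteIntegral_iff_ofReal (.of_forall fun _ => by positivity)]
    exact key.trans_lt ENNReal.ofReal_lt_top
  refine ⟨hmem', ?_, ?_⟩
  · rw [integral_fresh (Ψ := fun w δ => M δ w) hqS
      (fun w δ δ' h => by dsimp only; rw [hMS h]) hS (hmem'.integrable (by norm_num))]
    refine (integral_congr_ae (.of_forall fun δ => hmean (q δ))).trans ?_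
    exact R.integral_comp_comm (hqp.integrable (by norm_num))
  · rw [integral_eq_lintegral_of_nonneg_ae (.of_forall fun _ => by positivity)
      (hmeas.norm.pow_const 2).aestronglyMeasurable]
    refine (ENNReal.toReal_mono ENNReal.ofReal_ne_top key).trans_eq (ENNReal.toReal_ofReal ?_)
    exact mul_nonneg hρ (integral_nonneg fun _ => by positivity)

end Indep

end FedMBO

namespace FedMBO

/-! ### Quadratic upper and lower models -/

section Calculus

variable {E : Type*} [NormedAddCommGroup E] [InnerProductSpace ℝ E] [CompleteSpace E]

/-- A function with `L`-Lipschitz gradient lies below its quadratic upper model. -/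
theorem le_quadratic_of_lipConst_gradient {f : E → ℝ} {G : E → E} {L : ℝ}
    (hf : ∀ x, HasGradientAt f (G x) x) (hG : LipConst L G) (x y : E) :
    f y ≤ f x + inner ℝ (G x) (y - x) + L / 2 * ‖y - x‖ ^ 2 := by
  set v := y - x with hv
  have hline : ∀ t : ℝ, HasDerivAt (fun t : ℝ => x + t • v) v t := fun t => by
    simpa using ((hasDerivAt_id t).smul_const v).const_add x
  have hd : ∀ t : ℝ, HasDerivAt
      (fun t : ℝ => f (x + t • v) - t * inner ℝ (G x) v - L / 2 * ‖v‖ ^ 2 * t ^ 2)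
      (inner ℝ (G (x + t • v)) v - inner ℝ (G x) v - L * ‖v‖ ^ 2 * t) t := fun t => by
    have h1 := (hf (x + t • v)).hasFDerivAt.comp_hasDerivAt t (hline t)
    have h2 := (hasDerivAt_id t).mul_const (inner ℝ (G x) v)
    have h3 := ((hasDerivAt_id t).pow 2).const_mul (L / 2 * ‖v‖ ^ 2)
    refine ((h1.sub h2).sub h3).congr_deriv ?_
    simp [InnerProductSpace.toDual_apply_apply]
    ring
  -- The Lipschitz bound makes the derivative along the segment nonpositive; the claim compares t =
  -- 0 with t = 1.
  have hanti : AntitoneOn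
      (fun t : ℝ => f (x + t • v) - t * inner ℝ (G x) v - L / 2 * ‖v‖ ^ 2 * t ^ 2) (Set.Icc 0 1) := by
    refine antitoneOn_of_deriv_nonpos (convex_Icc 0 1)
      (fun t _ => (hd t).continuousAt.continuousWithinAt)
      (fun t _ => (hd t).differentiableAt.differentiableWithinAt) fun t ht => ?_
    rw [interior_Icc] at ht
    rw [(hd t).deriv, ← inner_sub_left]
    have h1 := real_inner_le_norm (G (x + t • v) - G x) v
    have h2 := hG (x + t • v) x
    rw [add_sub_cancel_left, norm_smul, Real.norm_of_nonneg ht.1.le] at h2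
    nlinarith [mul_le_mul_of_nonneg_right h2 (norm_nonneg v)]
  have := hanti (Set.left_mem_Icc.2 zero_le_one) (Set.right_mem_Icc.2 zero_le_one) zero_le_one
  simp only [one_smul, zero_smul, add_zero] at this
  rw [hv, add_sub_cancel] at this
  rw [hv]
  linarith

/-- A strongly convex function lies above its quadratic lower model. -/
theorem quadratic_le_of_strongConvexOn {f : E → ℝ} {f' : E →L[ℝ] ℝ} {m : ℝ}
    (hf : StrongConvexOn Set.univ m f) {x : E} (hx : HasFDerivAt f f' x) (y : E) :
    f' (y - x) + m / 2 * ‖y - x‖ ^ 2 ≤ f y - f x := by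
  set v := y - x with hv
  have hline : HasDerivAt (fun t : ℝ => x + t • v) v 0 := by
    simpa using ((hasDerivAt_id (0 : ℝ)).smul_const v).const_add x
  have hx' : HasFDerivAt f f' (x + (0 : ℝ) • v) := by simpa using hx
  -- Strong convexity bounds each right difference quotient by f y - f x - (1 - t)(m/2)‖v‖²; let t
  -- tend to 0.
  have h := (hx'.comp_hasDerivAt (0 : ℝ) hline).tendsto_slope_zero_right
  have h2 : Filter.Tendsto (fun t : ℝ => f y - f x - (1 - t) * (m / 2 * ‖v‖ ^ 2))
      (nhdsWithin 0 (Set.Ioi 0)) (nhds (f y - f x - (1 - 0) * (m / 2 * ‖v‖ ^ 2))) :=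
    ((by fun_prop : Continuous fun t : ℝ => f y - f x - (1 - t) * (m / 2 * ‖v‖ ^ 2)).tendsto
      0).mono_left nhdsWithin_le_nhds
  have hle := le_of_tendsto_of_tendsto h h2 (by
    have : Set.Ioo (0 : ℝ) 1 ∈ nhdsWithin (0 : ℝ) (Set.Ioi 0) := Ioo_mem_nhdsGT one_pos
    filter_upwards [this] with t ht
    have := hf.2 (Set.mem_univ x) (Set.mem_univ y) (sub_nonneg.2 ht.2.le) ht.1.le (by ring)
    rw [show (1 - t) • x + t • y = x + t • v by rw [hv]; module, norm_sub_rev x y, ← hv] at this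
    simp only [Function.comp_apply, zero_add, zero_smul, add_zero, smul_eq_mul] at this ⊢
    rw [inv_mul_le_iff₀ ht.1]
    nlinarith)
  linarith

end Calculus

/-! ### Norm of a symmetric operator from its quadratic form -/

section SymmetricOp

variable {E : Type*} [NormedAddCommGroup E] [InnerProductSpace ℝ E]

/-- A symmetric operator whose quadratic form lies between `0` and `θ‖·‖²` has norm at most `θ`. -/
theorem norm_apply_le_of_quadratic_form {S : E →L[ℝ] E} {θ : ℝ}
    (hs : ∀ v w, inner ℝ (S v) w = inner ℝ v (S w)) (h0 : ∀ v, 0 ≤ inner ℝ (S v) v)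
    (h1 : ∀ v, inner ℝ (S v) v ≤ θ * ‖v‖ ^ 2) (v : E) : ‖S v‖ ≤ θ * ‖v‖ := by
  rcases eq_or_ne (S v) 0 with hS | hS
  · have h := (h0 v).trans (h1 v)
    rcases eq_or_ne v 0 with hv | hv
    · simp [hv]
    · rw [hS, norm_zero]
      have : 0 ≤ θ := nonneg_of_mul_nonneg_left h (by positivity)
      positivity
  have hS' : 0 < ‖S v‖ := norm_pos_iff.2 hS
  -- `S v` is rescaled to the length of `v`, so that the parallelogram law gives ‖v+w‖² + ‖v-w‖² =
  -- 4‖v‖². Polarization of ⟪S v, w⟫ then needs only the two bounds on the form.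
  set w := (‖v‖ / ‖S v‖) • S v with hw
  have hnw : ‖w‖ = ‖v‖ := by
    rw [hw, norm_smul, norm_div, norm_norm, norm_norm]; field_simp
  have key : inner ℝ (S v) w = ‖v‖ * ‖S v‖ := by
    rw [hw, real_inner_smul_right, real_inner_self_eq_norm_sq]; field_simp
  have hv0 : 0 < ‖v‖ := norm_pos_iff.2 fun h => hS (by simp [h])
  have e : 4 * inner ℝ (S v) w = inner ℝ (S (v + w)) (v + w) - inner ℝ (S (v - w)) (v - w) := by
    simp only [map_add, map_sub, inner_add_left, inner_add_right, inner_sub_left, inner_sub_right]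
    have : inner ℝ (S w) v = inner ℝ (S v) w := (hs w v).trans (real_inner_comm _ _)
    linarith
  have h2 := h1 (v + w)
  have h3 := h1 (v - w)
  have h4 := h0 (v + w)
  have h5 := h0 (v - w)
  have par := parallelogram_law_with_norm ℝ v w
  have hh : 4 * (‖v‖ * ‖S v‖) ≤ θ * (4 * ‖v‖ ^ 2) := by
    rw [← key, e]
    have : θ * (4 * ‖v‖ ^ 2) = θ * ‖v + w‖ ^ 2 + θ * ‖v - w‖ ^ 2 := by
      rw [← mul_add]; congr 1; rw [hnw] at par; nlinarith
    linarith
  nlinarith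

end SymmetricOp

/-! ### Block decomposition of operators on ℝ^p × ℝ^q -/

section Blocks

variable {X Y : Type*} [NormedAddCommGroup X] [InnerProductSpace ℝ X] [FiniteDimensional ℝ X]
  [NormedAddCommGroup Y] [InnerProductSpace ℝ Y] [FiniteDimensional ℝ Y]

variable (X Y) in
/-- The embedding `y ↦ (0, y)`. -/
noncomputable def inY : Y →L[ℝ] Pt X Y :=
  ((WithLp.prodContinuousLinearEquiv 2 ℝ X Y).symm : X × Y →L[ℝ] Pt X Y) ∘L
    ContinuousLinearMap.inr ℝ X Y

variable (X Y) in
/-- The embedding `x ↦ (x, 0)`. -/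
noncomputable def inX : X →L[ℝ] Pt X Y :=
  ((WithLp.prodContinuousLinearEquiv 2 ℝ X Y).symm : X × Y →L[ℝ] Pt X Y) ∘L
    ContinuousLinearMap.inl ℝ X Y

variable (X Y) in
noncomputable def projX : Pt X Y →L[ℝ] X := WithLp.fstL 2 ℝ X Y

variable (X Y) in
noncomputable def projY : Pt X Y →L[ℝ] Y := WithLp.sndL 2 ℝ X Y

@[simp] theorem projX_apply (z : Pt X Y) : projX X Y z = z.fst := rfl
@[simp] theorem projY_apply (z : Pt X Y) : projY X Y z = z.snd := rfl
theorem inY_apply (v : Y) : inY X Y v = pt 0 v := rfl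
theorem inX_apply (v : X) : inX X Y v = pt v 0 := rfl

theorem norm_sq_pt (x : X) (y : Y) : ‖pt x y‖ ^ 2 = ‖x‖ ^ 2 + ‖y‖ ^ 2 :=
  WithLp.prod_norm_sq_eq_of_L2 _

theorem norm_fst_le (z : Pt X Y) : ‖z.fst‖ ≤ ‖z‖ := by
  have := WithLp.prod_norm_sq_eq_of_L2 z
  exact le_of_sq_le_sq (by nlinarith [sq_nonneg ‖z.snd‖]) (norm_nonneg _)

theorem norm_snd_le (z : Pt X Y) : ‖z.snd‖ ≤ ‖z‖ := by
  have := WithLp.prod_norm_sq_eq_of_L2 z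
  exact le_of_sq_le_sq (by nlinarith [sq_nonneg ‖z.fst‖]) (norm_nonneg _)

theorem norm_pt_zero_left (v : Y) : ‖(pt 0 v : Pt X Y)‖ = ‖v‖ := by
  have := norm_sq_pt (0 : X) v
  rw [norm_zero] at this
  exact (sq_eq_sq₀ (norm_nonneg _) (norm_nonneg _)).1 (by linarith)

theorem norm_pt_zero_right (v : X) : ‖(pt v 0 : Pt X Y)‖ = ‖v‖ := by
  have := norm_sq_pt v (0 : Y)
  rw [norm_zero] at this
  exact (sq_eq_sq₀ (norm_nonneg _) (norm_nonneg _)).1 (by linarith)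

theorem norm_pt_le (x : X) (y : Y) : ‖pt x y‖ ≤ ‖x‖ + ‖y‖ := by
  refine le_of_sq_le_sq ?_ (by positivity)
  rw [norm_sq_pt]; nlinarith [norm_nonneg x, norm_nonneg y]

theorem pt_sub (x x' : X) (y y' : Y) : pt x y - pt x' y' = pt (x - x') (y - y') := rfl

theorem pt_eq_add (x : X) (y : Y) : pt x y = inX X Y x + inY X Y y := by
  rw [inX_apply, inY_apply]
  exact congrArg (WithLp.toLp 2) (by simp [pt])

theorem inner_pt (x : X) (y : Y) (w : Pt X Y) :
    inner ℝ w (pt x y) = inner ℝ w.fst x + inner ℝ w.snd y := WithLp.prod_inner_apply _ _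

theorem norm_projX_le : ‖projX X Y‖ ≤ 1 :=
  ContinuousLinearMap.opNorm_le_bound _ zero_le_one fun z => by simpa using norm_fst_le z

theorem norm_projY_le : ‖projY X Y‖ ≤ 1 :=
  ContinuousLinearMap.opNorm_le_bound _ zero_le_one fun z => by simpa using norm_snd_le z

/-- The block `∇²_{yy}` as an operator. -/
noncomputable def opYY (H : Op (Pt X Y)) : Y →L[ℝ] Y := projY X Y ∘L H ∘L inY X Y

/-- The block `∇²_{xy}` as an operator. -/
noncomputable def opXY (H : Op (Pt X Y)) : Y →L[ℝ] X := projX X Y ∘L H ∘L inY X Y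

/-- The block `∇²_{yx}` as an operator. -/
noncomputable def opYX (H : Op (Pt X Y)) : X →L[ℝ] Y := projY X Y ∘L H ∘L inX X Y

theorem opYY_apply (H : Op (Pt X Y)) (v : Y) : opYY H v = (H (pt 0 v)).snd := rfl
theorem opXY_apply (H : Op (Pt X Y)) (v : Y) : opXY H v = (H (pt 0 v)).fst := rfl
theorem opYX_apply (H : Op (Pt X Y)) (v : X) : opYX H v = (H (pt v 0)).snd := rfl
theorem blockYY_eq (H : Op (Pt X Y)) (v : Y) : blockYY H v = opYY H v := rfl

theorem norm_opYY_apply_le (H : Op (Pt X Y)) (v : Y) : ‖opYY H v‖ ≤ ‖H‖ * ‖v‖ := by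
  rw [opYY_apply, ← norm_pt_zero_left (X := X) v]
  exact (norm_snd_le _).trans (H.le_opNorm _)

theorem norm_opXY_apply_le (H : Op (Pt X Y)) (v : Y) : ‖opXY H v‖ ≤ ‖H‖ * ‖v‖ := by
  rw [opXY_apply, ← norm_pt_zero_left (X := X) v]
  exact (norm_fst_le _).trans (H.le_opNorm _)

theorem opYY_sub (H K : Op (Pt X Y)) : opYY (H - K) = opYY H - opYY K := by ext; rfl
theorem opXY_sub (H K : Op (Pt X Y)) : opXY (H - K) = opXY H - opXY K := by ext; rfl

end Blocks

end FedMBO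

namespace FedMBO

/-! ### Regularity of the losses and of the hypergradient -/

section Regular

variable {X Y : Type*} [NormedAddCommGroup X] [InnerProductSpace ℝ X] [FiniteDimensional ℝ X]
  [NormedAddCommGroup Y] [InnerProductSpace ℝ Y] [FiniteDimensional ℝ Y]

/-- Lower-level losses: Lipschitz gradient and Hessian, gradient strongly monotone in `y`. -/
structure LowerRegular (g : Pt X Y → ℝ) (L L₂ m : ℝ) : Prop where
  diff : Differentiable ℝ g
  diff_grad : Differentiable ℝ (gradient g)
  lip_grad : LipConst L (gradient g)
  lip_hess : LipConst L₂ (hessian g)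
  mono : ∀ x y y', m * ‖y - y'‖ ^ 2 ≤
    inner ℝ ((gradient g (pt x y)).snd - (gradient g (pt x y')).snd) (y - y')

/-- Upper-level losses: Lipschitz continuous with Lipschitz gradient. -/
structure UpperRegular (f : Pt X Y → ℝ) (L₀ L₁ : ℝ) : Prop where
  diff : Differentiable ℝ f
  lip_grad : LipConst L₁ (gradient f)
  norm_grad_le : ∀ z, ‖gradient f z‖ ≤ L₀

theorem hasFDerivAt_pt_right (x : X) (y : Y) : HasFDerivAt (fun y => pt x y) (inY X Y) y := by
  have h : (fun y : Y => pt x y) = fun y => inX X Y x + inY X Y y := funext fun y => pt_eq_add x y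
  rw [h]
  exact (inY X Y).hasFDerivAt.const_add _

/-- Strong convexity in `y` makes the partial gradient strongly monotone. -/
theorem inner_gradient_sub_ge {g : Pt X Y → ℝ} {m : ℝ} (hg : Differentiable ℝ g)
    (hs : ∀ x, StrongConvexOn Set.univ m (fun y => g (pt x y))) (x : X) (y y' : Y) :
    m * ‖y - y'‖ ^ 2 ≤
      inner ℝ ((gradient g (pt x y)).snd - (gradient g (pt x y')).snd) (y - y') := by
  have hd : ∀ y, HasFDerivAt (fun y => g (pt x y)) (fderiv ℝ g (pt x y) ∘L inY X Y) y := fun y =>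
    HasFDerivAt.comp y (hg _).hasFDerivAt (hasFDerivAt_pt_right x y)
  have e : ∀ y v, (fderiv ℝ g (pt x y) ∘L inY X Y) v = inner ℝ (gradient g (pt x y)).snd v := by
    intro y v
    rw [ContinuousLinearMap.comp_apply, ← inner_gradient_left, inY_apply, inner_pt]
    simp
  have h1 := quadratic_le_of_strongConvexOn (hs x) (hd y) y'
  have h2 := quadratic_le_of_strongConvexOn (hs x) (hd y') y
  rw [e] at h1 h2
  rw [norm_sub_rev] at h1
  rw [inner_sub_left]
  rw [← neg_sub y y', inner_neg_right] at h1
  linarith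

namespace LowerRegular

variable {g : Pt X Y → ℝ} {L L₂ m : ℝ} (h : LowerRegular g L L₂ m)

include h

theorem hasFDerivAt_gradient (z : Pt X Y) : HasFDerivAt (gradient g) (hessian g z) z :=
  (h.diff_grad z).hasFDerivAt

theorem norm_hessian_le (hL : 0 ≤ L) (z : Pt X Y) : ‖hessian g z‖ ≤ L :=
  norm_fderiv_le_of_lip' ℝ hL (.of_forall fun w => h.lip_grad w z)

theorem hessian_symm (z v w : Pt X Y) :
    inner ℝ (hessian g z v) w = inner ℝ v (hessian g z w) := by
  -- The Riesz map as a plain ℝ-linear map, so that `D` composed with the Hessian is a second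
  -- derivative of `g` to which the symmetry theorem applies.
  obtain ⟨D, hD⟩ : ∃ D : Pt X Y →L[ℝ] StrongDual ℝ (Pt X Y), ∀ v, D v = innerSL ℝ v :=
    ⟨{ toFun := fun v => innerSL ℝ v
       map_add' := fun v w => map_add _ v w
       map_smul' := fun c v => by ext; simp
       cont := (innerSL ℝ).continuous }, fun _ => rfl⟩
  have h1 : ∀ y, HasFDerivAt g (D (gradient g y)) y := fun y => by
    rw [hD]
    exact (h.diff y).hasGradientAt.hasFDerivAt
  have h2 : HasFDerivAt (fun y => D (gradient g y)) (D ∘L hessian g z) z :=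
    HasFDerivAt.comp (G := StrongDual ℝ (Pt X Y)) z D.hasFDerivAt (h.hasFDerivAt_gradient z)
  have := second_derivative_symmetric h1 h2 v w
  simp only [ContinuousLinearMap.comp_apply, hD] at this
  rw [real_inner_comm (hessian g z w)]
  exact this

theorem opYY_symm (z : Pt X Y) (v w : Y) :
    inner ℝ (opYY (hessian g z) v) w = inner ℝ v (opYY (hessian g z) w) := by
  have := h.hessian_symm z (pt 0 v) (pt 0 w)
  rw [inner_pt, real_inner_comm _ (pt _ _), inner_pt] at this
  simpa [opYY_apply, real_inner_comm] using this

theorem inner_opYX (z : Pt X Y) (v : X) (w : Y) :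
    inner ℝ w (opYX (hessian g z) v) = inner ℝ (opXY (hessian g z) w) v := by
  have := h.hessian_symm z (pt v 0) (pt 0 w)
  rw [inner_pt, real_inner_comm _ (pt _ _), inner_pt] at this
  simpa [opYX_apply, opXY_apply, real_inner_comm] using this

/-- Strong monotonicity makes t ↦ ⟪∇_y g(x, y + tv), v⟫ - t m‖v‖² monotone, so its derivative at 0
is nonnegative. -/
theorem inner_opYY_ge (z : Pt X Y) (v : Y) : m * ‖v‖ ^ 2 ≤ inner ℝ (opYY (hessian g z) v) v := by
  have hz : z = pt z.fst z.snd := rfl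
  have hline : ∀ t : ℝ, HasDerivAt (fun t : ℝ => z.snd + t • v) v t := fun t => by
    simpa using ((hasDerivAt_id t).smul_const v).const_add z.snd
  have hG : HasFDerivAt (fun y => (gradient g (pt z.fst y)).snd) (opYY (hessian g z)) z.snd :=
    ((projY X Y).hasFDerivAt.comp _ (h.hasFDerivAt_gradient (pt z.fst z.snd))).comp _
      (hasFDerivAt_pt_right z.fst z.snd)
  have hd : HasDerivAt (fun t : ℝ => inner ℝ (gradient g (pt z.fst (z.snd + t • v))).snd v
      - t * (m * ‖v‖ ^ 2)) (inner ℝ (opYY (hessian g z) v) v - m * ‖v‖ ^ 2) 0 := by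
    have hG' : HasFDerivAt (fun y => (gradient g (pt z.fst y)).snd) (opYY (hessian g z))
      (z.snd + (0 : ℝ) • v) := by simpa using hG
    have h1 := (hG'.comp_hasDerivAt (0 : ℝ) (hline 0)).inner ℝ (hasDerivAt_const (0 : ℝ) v)
    have h2 := (hasDerivAt_id (0 : ℝ)).mul_const (m * ‖v‖ ^ 2)
    refine (h1.sub h2).congr_deriv ?_
    simp
  have hmono : Monotone (fun t : ℝ => inner ℝ (gradient g (pt z.fst (z.snd + t • v))).snd v
      - t * (m * ‖v‖ ^ 2)) := by
    intro s t hst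
    rcases hst.eq_or_lt with rfl | hst
    · rfl
    have := h.mono z.fst (z.snd + t • v) (z.snd + s • v)
    rw [show z.snd + t • v - (z.snd + s • v) = (t - s) • v by module, norm_smul,
      real_inner_smul_right, Real.norm_of_nonneg (sub_nonneg.2 hst.le), inner_sub_left] at this
    have hp : 0 < t - s := sub_pos.2 hst
    have : (t - s) * (m * ‖v‖ ^ 2) ≤ inner ℝ (gradient g (pt z.fst (z.snd + t • v))).snd v -
        inner ℝ (gradient g (pt z.fst (z.snd + s • v))).snd v := by
      refine le_of_mul_le_mul_left ?_ hp
      nlinarith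
    dsimp only
    linarith
  have := hmono.deriv_nonneg (x := 0)
  rw [hd.deriv] at this
  linarith

/-- A gradient step operator contracts. -/
theorem norm_sub_smul_opYY_le (hL : 0 < L) {t : ℝ} (ht0 : 0 ≤ t) (ht : t * L ≤ 1) (z : Pt X Y)
    (v : Y) : ‖v - t • opYY (hessian g z) v‖ ≤ max 0 (1 - t * m) * ‖v‖ := by
  have e : v - t • opYY (hessian g z) v
      = (ContinuousLinearMap.id ℝ Y - t • opYY (hessian g z)) v := by simp
  rw [e]
  -- The `max 0` matters only for trivial `Y`: otherwise m ≤ L, hence 1 - t m ≥ 0.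
  refine norm_apply_le_of_quadratic_form ?_ ?_ ?_ v
  · intro v w
    simp only [_root_.sub_apply, ContinuousLinearMap.id_apply,
      _root_.smul_apply, inner_sub_left, inner_sub_right, real_inner_smul_left,
      real_inner_smul_right, h.opYY_symm]
  · intro v
    simp only [_root_.sub_apply, ContinuousLinearMap.id_apply,
      _root_.smul_apply, inner_sub_left, real_inner_smul_left,
      real_inner_self_eq_norm_sq]
    have h1 := real_inner_le_norm (opYY (hessian g z) v) v
    have h2 := (norm_opYY_apply_le (hessian g z) v).trans
      (mul_le_mul_of_nonneg_right (h.norm_hessian_le hL.le z) (norm_nonneg v))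
    have h3 : inner ℝ (opYY (hessian g z) v) v ≤ L * ‖v‖ ^ 2 := by nlinarith [norm_nonneg v]
    nlinarith [mul_le_mul_of_nonneg_left h3 ht0, mul_le_mul_of_nonneg_right ht (sq_nonneg ‖v‖)]
  · intro v
    simp only [_root_.sub_apply, ContinuousLinearMap.id_apply,
      _root_.smul_apply, inner_sub_left, real_inner_smul_left,
      real_inner_self_eq_norm_sq]
    have h1 := mul_le_mul_of_nonneg_left (h.inner_opYY_ge z v) ht0
    have h2 := mul_le_mul_of_nonneg_right (le_max_right 0 (1 - t * m)) (sq_nonneg ‖v‖)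
    linarith

/-- Mean value inequality: the derivative of the step in y is I - t∇²_yy g, whose norm
`norm_sub_smul_opYY_le` controls. This drives the inner loop. -/
theorem norm_gradient_step_sub_le (hL : 0 < L) {t : ℝ} (ht0 : 0 ≤ t) (ht : t * L ≤ 1) (x : X)
    (y y' : Y) :
    ‖(y - t • (gradient g (pt x y)).snd) - (y' - t • (gradient g (pt x y')).snd)‖
      ≤ max 0 (1 - t * m) * ‖y - y'‖ := by
  have hd : ∀ y, HasFDerivAt (fun y => y - t • (gradient g (pt x y)).snd)
      (ContinuousLinearMap.id ℝ Y - t • opYY (hessian g (pt x y))) y := fun y =>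
    (hasFDerivAt_id y).sub ((((projY X Y).hasFDerivAt.comp _
      (h.hasFDerivAt_gradient (pt x y))).comp _ (hasFDerivAt_pt_right x y)).const_smul t)
  refine convex_univ.norm_image_sub_le_of_norm_hasFDerivWithin_le
    (fun y _ => (hd y).hasFDerivWithinAt) (fun y _ => ?_) (Set.mem_univ _) (Set.mem_univ _)
  refine ContinuousLinearMap.opNorm_le_bound _ (le_max_left _ _) fun v => ?_
  simpa using h.norm_sub_smul_opYY_le hL ht0 ht (pt x y) v

/-- Mean value inequality on the segment. It loses a factor 2 against the sharp L₂/2, which is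
harmless: only the order of the remainder matters later. -/
theorem norm_gradient_sub_taylor_le (hL₂ : 0 ≤ L₂) (z z' : Pt X Y) :
    ‖gradient g z' - gradient g z - hessian g z (z' - z)‖ ≤ L₂ * ‖z' - z‖ * ‖z' - z‖ := by
  refine (convex_segment z z').norm_image_sub_le_of_norm_hasFDerivWithin_le'
    (fun w _ => (h.hasFDerivAt_gradient w).hasFDerivWithinAt) (fun w hw => ?_)
    (left_mem_segment ℝ z z') (right_mem_segment ℝ z z')
  refine (h.lip_hess w z).trans (mul_le_mul_of_nonneg_left ?_ hL₂)
  exact norm_sub_le_of_mem_segment hw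

/-- The `yy` block of the Hessian is invertible. -/
theorem isUnit_opYY (hm : 0 < m) (z : Pt X Y) : IsUnit (opYY (hessian g z)) := by
  have hinj : Function.Injective (opYY (hessian g z)).toLinearMap := by
    rw [← LinearMap.ker_eq_bot, LinearMap.ker_eq_bot']
    intro v hv
    have := h.inner_opYY_ge z v
    rw [show opYY (hessian g z) v = 0 from hv, inner_zero_left] at this
    have h0 : ‖v‖ ^ 2 ≤ 0 := by nlinarith
    exact norm_eq_zero.1 (pow_eq_zero_iff two_ne_zero |>.1 (le_antisymm h0 (sq_nonneg _)))
  exact ContinuousLinearMap.isUnit_iff_bijective.2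
    ⟨hinj, LinearMap.injective_iff_surjective.1 hinj⟩

end LowerRegular

/-- The inverse of the `yy` block of the Hessian of `g`. -/
noncomputable def invYY (g : Pt X Y → ℝ) (z : Pt X Y) : Y →L[ℝ] Y :=
  Ring.inverse (opYY (hessian g z))

/-- The hypergradient `∇_x f - ∇²_{xy} g [∇²_{yy} g]⁻¹ ∇_y f`. -/
noncomputable def hyperGrad (f g : Pt X Y → ℝ) (z : Pt X Y) : X :=
  (gradient f z).fst - opXY (hessian g z) (invYY g z (gradient f z).snd)

namespace LowerRegular

variable {g : Pt X Y → ℝ} {L L₂ m : ℝ} (h : LowerRegular g L L₂ m)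

include h

theorem opYY_invYY (hm : 0 < m) (z : Pt X Y) (v : Y) : opYY (hessian g z) (invYY g z v) = v :=
  DFunLike.congr_fun (Ring.mul_inverse_cancel _ (h.isUnit_opYY hm z)) v

theorem invYY_opYY (hm : 0 < m) (z : Pt X Y) (v : Y) : invYY g z (opYY (hessian g z) v) = v :=
  DFunLike.congr_fun (Ring.inverse_mul_cancel _ (h.isUnit_opYY hm z)) v

theorem norm_invYY_le (hm : 0 < m) (z : Pt X Y) (v : Y) : ‖invYY g z v‖ ≤ ‖v‖ / m := by
  rw [le_div_iff₀ hm]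
  have h1 := h.inner_opYY_ge z (invYY g z v)
  rw [h.opYY_invYY hm] at h1
  have h2 := real_inner_le_norm v (invYY g z v)
  rcases (norm_nonneg (invYY g z v)).eq_or_lt with h0 | h0
  · rw [← h0]; simp
  · refine le_of_mul_le_mul_right ?_ h0
    nlinarith

theorem inner_invYY (hm : 0 < m) (z : Pt X Y) (v w : Y) :
    inner ℝ v (invYY g z w) = inner ℝ (invYY g z v) w := by
  conv_lhs => rw [← h.opYY_invYY hm z v]
  rw [h.opYY_symm, h.opYY_invYY hm]

theorem norm_opXY_le (hL : 0 ≤ L) (z : Pt X Y) (v : Y) : ‖opXY (hessian g z) v‖ ≤ L * ‖v‖ :=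
  (norm_opXY_apply_le _ _).trans
    (mul_le_mul_of_nonneg_right (h.norm_hessian_le hL z) (norm_nonneg _))

variable {f : Pt X Y → ℝ} {L₀ L₁ : ℝ} (hf : UpperRegular f L₀ L₁)

include hf

theorem norm_hyperGrad_le (hL : 0 ≤ L) (hm : 0 < m) (z : Pt X Y) :
    ‖hyperGrad f g z‖ ≤ L₀ + L * (L₀ / m) := by
  refine (norm_sub_le _ _).trans (add_le_add ((norm_fst_le _).trans (hf.norm_grad_le z)) ?_)
  refine (h.norm_opXY_le hL z _).trans (mul_le_mul_of_nonneg_left ?_ hL)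
  refine (h.norm_invYY_le hm z _).trans (div_le_div_of_nonneg_right ?_ hm.le)
  exact (norm_snd_le _).trans (hf.norm_grad_le z)

/-- The constant is `Consts.Mf`. The product of cross block, inverse block and gradient is
telescoped factor by factor; the inverses are compared by the resolvent identity P' - P = -P'(H' -
H)P. -/
theorem norm_hyperGrad_sub_le (hL : 0 ≤ L) (hL₂ : 0 ≤ L₂) (hm : 0 < m) (z z' : Pt X Y) :
    ‖hyperGrad f g z' - hyperGrad f g z‖
      ≤ (L₁ + L * L₁ / m + L₀ / m * (L₂ + L * L₂ / m)) * ‖z' - z‖ := by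
  set D := ‖z' - z‖
  have hD : 0 ≤ D := norm_nonneg _
  set w := (gradient f z).snd
  set w' := (gradient f z').snd
  have hw : ‖w' - w‖ ≤ L₁ * D := (norm_snd_le (gradient f z' - gradient f z)).trans (hf.lip_grad _ _)
  have hx : ‖(gradient f z').fst - (gradient f z).fst‖ ≤ L₁ * D :=
    (norm_fst_le (gradient f z' - gradient f z)).trans (hf.lip_grad _ _)
  have hw0 : ‖w‖ ≤ L₀ := (norm_snd_le _).trans (hf.norm_grad_le z)
  have hL₀ : 0 ≤ L₀ := (norm_nonneg _).trans hw0
  have hP : ‖invYY g z w‖ ≤ L₀ / m :=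
    (h.norm_invYY_le hm z w).trans (div_le_div_of_nonneg_right hw0 hm.le)
  have hH : ‖hessian g z' - hessian g z‖ ≤ L₂ * D := h.lip_hess _ _
  have e1 : invYY g z' w - invYY g z w
      = - invYY g z' (opYY (hessian g z' - hessian g z) (invYY g z w)) := by
    rw [opYY_sub, _root_.sub_apply, h.opYY_invYY hm z, map_sub, h.invYY_opYY hm z']
    abel
  have n1 : ‖invYY g z' w - invYY g z w‖ ≤ L₂ * D * (L₀ / m) / m := by
    rw [e1, norm_neg]
    refine (h.norm_invYY_le hm z' _).trans (div_le_div_of_nonneg_right ?_ hm.le)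
    exact (norm_opYY_apply_le _ _).trans (mul_le_mul hH hP (norm_nonneg _) (by positivity))
  have n2 : ‖invYY g z' (w' - w)‖ ≤ L₁ * D / m :=
    (h.norm_invYY_le hm z' _).trans (div_le_div_of_nonneg_right hw hm.le)
  have e : hyperGrad f g z' - hyperGrad f g z = ((gradient f z').fst - (gradient f z).fst)
      - opXY (hessian g z') (invYY g z' (w' - w))
      - opXY (hessian g z') (invYY g z' w - invYY g z w)
      - opXY (hessian g z' - hessian g z) (invYY g z w) := by
    simp only [hyperGrad, map_sub, opXY_sub, _root_.sub_apply, w, w']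
    abel
  rw [e]
  have n3 := (h.norm_opXY_le hL z' _).trans (mul_le_mul_of_nonneg_left n2 hL)
  have n4 := (h.norm_opXY_le hL z' _).trans (mul_le_mul_of_nonneg_left n1 hL)
  have n5 : ‖opXY (hessian g z' - hessian g z) (invYY g z w)‖ ≤ L₂ * D * (L₀ / m) :=
    (norm_opXY_apply_le _ _).trans (mul_le_mul hH hP (norm_nonneg _) (by positivity))
  refine ((norm_sub_le _ _).trans (add_le_add ((norm_sub_le _ _).trans (add_le_add
    ((norm_sub_le _ _).trans (add_le_add hx n3)) n4)) n5)).trans (le_of_eq ?_)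
  ring

end LowerRegular

end Regular

end FedMBO

namespace FedMBO

/-! ### Regularity passes to the average over clients -/

section Average

variable {X Y : Type*} [NormedAddCommGroup X] [InnerProductSpace ℝ X] [FiniteDimensional ℝ X]
  [NormedAddCommGroup Y] [InnerProductSpace ℝ Y] [FiniteDimensional ℝ Y]

theorem norm_average_le {κ E : Type*} [Fintype κ] [Nonempty κ] [NormedAddCommGroup E]
    [NormedSpace ℝ E] {v : κ → E} {b : ℝ} (h : ∀ i, ‖v i‖ ≤ b) :
    ‖(1 / (Fintype.card κ : ℝ)) • ∑ i, v i‖ ≤ b := by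
  have hc : (0 : ℝ) < Fintype.card κ := by exact_mod_cast Fintype.card_pos
  rw [norm_smul, Real.norm_of_nonneg (by positivity), one_div, inv_mul_le_iff₀ hc]
  calc ‖∑ i, v i‖ ≤ ∑ i, ‖v i‖ := norm_sum_le _ _
    _ ≤ ∑ _i : κ, b := Finset.sum_le_sum fun i _ => h i
    _ = _ := by simp

theorem gradient_average {m : ℕ} {h : Fin m → Pt X Y → ℝ} (hd : ∀ i, Differentiable ℝ (h i)) :
    gradient (fun z => (1 / (m : ℝ)) * ∑ i, h i z)
      = fun z => (1 / (m : ℝ)) • ∑ i, gradient (h i) z := by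
  funext z
  refine HasGradientAt.gradient ?_
  rw [hasGradientAt_iff_hasFDerivAt, map_smul, map_sum]
  exact (HasFDerivAt.fun_sum fun i _ => ((hd i) z).hasGradientAt.hasFDerivAt).const_mul _

theorem hessian_average {m : ℕ} {h : Fin m → Pt X Y → ℝ} (hd : ∀ i, Differentiable ℝ (h i))
    (hd2 : ∀ i, Differentiable ℝ (gradient (h i))) (z : Pt X Y) :
    hessian (fun z => (1 / (m : ℝ)) * ∑ i, h i z) z
      = (1 / (m : ℝ)) • ∑ i, hessian (h i) z := by
  rw [hessian, gradient_average hd]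
  exact ((HasFDerivAt.fun_sum fun i _ => ((hd2 i) z).hasFDerivAt).const_smul (1 / (m : ℝ))).fderiv

theorem LowerRegular.average {m : ℕ} [NeZero m] {g : Fin m → Pt X Y → ℝ} {L L₂ μ : ℝ}
    (h : ∀ i, LowerRegular (g i) L L₂ μ) :
    LowerRegular (fun z => (1 / (m : ℝ)) * ∑ i, g i z) L L₂ μ := by
  have hm : (0 : ℝ) < m := by exact_mod_cast Nat.pos_of_neZero m
  have hg := gradient_average fun i => (h i).diff
  have hh := hessian_average (fun i => (h i).diff) fun i => (h i).diff_grad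
  refine ⟨?_, ?_, ?_, ?_, ?_⟩
  · exact (Differentiable.fun_sum fun i _ => (h i).diff).const_mul _
  · rw [hg]
    exact (Differentiable.fun_sum fun i _ => (h i).diff_grad).const_smul (1 / (m : ℝ))
  · intro z w
    rw [hg]
    simp only [← smul_sub, ← Finset.sum_sub_distrib]
    simpa using norm_average_le fun i => (h i).lip_grad z w
  · intro z w
    rw [hh, hh, ← smul_sub, ← Finset.sum_sub_distrib]
    simpa using norm_average_le fun i => (h i).lip_hess z w
  · intro x y y'
    rw [hg]
    have e : ((1 / (m : ℝ)) • ∑ i, gradient (g i) (pt x y)).snd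
        - ((1 / (m : ℝ)) • ∑ i, gradient (g i) (pt x y')).snd
        = (1 / (m : ℝ)) • ∑ i, ((gradient (g i) (pt x y)).snd - (gradient (g i) (pt x y')).snd) := by
      rw [← projY_apply, ← projY_apply, map_smul, map_smul, map_sum, map_sum, ← smul_sub,
        ← Finset.sum_sub_distrib]
      rfl
    rw [e, real_inner_smul_left, sum_inner, one_div, le_inv_mul_iff₀ hm]
    calc (m : ℝ) * (μ * ‖y - y'‖ ^ 2) = ∑ _i : Fin m, μ * ‖y - y'‖ ^ 2 := by simp
      _ ≤ _ := Finset.sum_le_sum fun i _ => (h i).mono x y y'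

theorem UpperRegular.average {m : ℕ} [NeZero m] {f : Fin m → Pt X Y → ℝ} {L₀ L₁ : ℝ}
    (h : ∀ i, UpperRegular (f i) L₀ L₁) :
    UpperRegular (fun z => (1 / (m : ℝ)) * ∑ i, f i z) L₀ L₁ := by
  have hg := gradient_average fun i => (h i).diff
  refine ⟨(Differentiable.fun_sum fun i _ => (h i).diff).const_mul _, ?_, ?_⟩
  · intro z w
    rw [hg]
    simp only [← smul_sub, ← Finset.sum_sub_distrib]
    simpa using norm_average_le fun i => (h i).lip_grad z w
  · intro z
    rw [hg]
    simpa using norm_average_le fun i => (h i).norm_grad_le z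

end Average

/-! ### The lower-level solution map and the gradient of Φ -/

section LowerSolution

variable {X Y : Type*} [NormedAddCommGroup X] [InnerProductSpace ℝ X] [FiniteDimensional ℝ X]
  [NormedAddCommGroup Y] [InnerProductSpace ℝ Y] [FiniteDimensional ℝ Y]

namespace LowerRegular

variable {g : Pt X Y → ℝ} {L L₂ m : ℝ} (h : LowerRegular g L L₂ m) {ystar : X → Y}
  (hy : ∀ x y, g (pt x (ystar x)) ≤ g (pt x y))

include h hy

theorem gradient_snd_lowerSolution (x : X) : (gradient g (pt x (ystar x))).snd = 0 := by
  have hd : HasFDerivAt (fun y => g (pt x y)) (fderiv ℝ g (pt x (ystar x)) ∘L inY X Y) (ystar x) :=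
    HasFDerivAt.comp _ (h.diff _).hasFDerivAt (hasFDerivAt_pt_right x _)
  have h0 : fderiv ℝ g (pt x (ystar x)) ∘L inY X Y = 0 := by
    rw [← hd.fderiv]
    exact IsLocalMin.fderiv_eq_zero (.of_forall fun y => hy x y)
  refine ext_inner_right ℝ fun v => ?_
  have := DFunLike.congr_fun h0 v
  rw [ContinuousLinearMap.comp_apply, ← inner_gradient_left, inY_apply, inner_pt] at this
  simpa using this

/-- Strong monotonicity at x' between y*(x') and y*(x). The partial gradient vanishes at the former;
at the latter it is at most L‖x' - x‖, because it vanishes at (x, y*(x)). -/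
theorem norm_lowerSolution_sub_le (hm : 0 < m) (x x' : X) :
    ‖ystar x' - ystar x‖ ≤ L / m * ‖x' - x‖ := by
  have h1 := h.mono x' (ystar x') (ystar x)
  rw [h.gradient_snd_lowerSolution hy, zero_sub, inner_neg_left] at h1
  have h2 : ‖(gradient g (pt x' (ystar x))).snd‖ ≤ L * ‖x' - x‖ := by
    have e : (gradient g (pt x' (ystar x))).snd
        = (gradient g (pt x' (ystar x)) - gradient g (pt x (ystar x))).snd := by
      have := h.gradient_snd_lowerSolution hy x
      rw [← projY_apply] at this
      rw [← projY_apply, ← projY_apply, map_sub, this, sub_zero]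
    rw [e]
    refine ((norm_snd_le _).trans (h.lip_grad _ _)).trans_eq ?_
    rw [pt_sub, sub_self, norm_pt_zero_right]
  have h3 := (neg_le_abs _).trans (abs_real_inner_le_norm (gradient g (pt x' (ystar x))).snd
    (ystar x' - ystar x))
  rw [div_mul_eq_mul_div, le_div_iff₀ hm]
  rcases (norm_nonneg (ystar x' - ystar x)).eq_or_lt with h0 | h0
  · rw [← h0, zero_mul]; exact (norm_nonneg _).trans h2
  · refine le_of_mul_le_mul_right ?_ h0
    nlinarith [mul_le_mul_of_nonneg_right h2 h0.le]

theorem continuous_lowerSolution (hL : 0 ≤ L) (hm : 0 < m) : Continuous ystar := by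
  have : LipschitzWith (Real.toNNReal (L / m)) ystar := LipschitzWith.of_dist_le_mul fun x y => by
    rw [dist_eq_norm, dist_eq_norm, Real.coe_toNNReal _ (by positivity)]
    exact h.norm_lowerSolution_sub_le hy hm y x
  exact this.continuous

/-- The lower-level solution is approximated to second order by its linearization. -/
theorem norm_lowerSolution_sub_taylor_le (hL₂ : 0 ≤ L₂) (hm : 0 < m) (x x' : X) :
    ‖ystar x' - ystar x
        + invYY g (pt x (ystar x)) (opYX (hessian g (pt x (ystar x))) (x' - x))‖
      ≤ L₂ * (1 + L / m) ^ 2 / m * ‖x' - x‖ ^ 2 := by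
  set z := pt x (ystar x)
  set z' := pt x' (ystar x')
  have hz : ‖z' - z‖ ≤ (1 + L / m) * ‖x' - x‖ := by
    rw [pt_sub]
    refine (norm_pt_le _ _).trans ?_
    have := h.norm_lowerSolution_sub_le hy hm x x'
    linarith
  -- As ∇_y g vanishes at both `z` and `z'`, its Taylor remainder is minus the linear part, and the
  -- inverse block turns this into the remainder of y*.
  have e : ystar x' - ystar x + invYY g z (opYX (hessian g z) (x' - x))
      = - invYY g z ((gradient g z' - gradient g z - hessian g z (z' - z)).snd) := by
    have h1 : (gradient g z' - gradient g z - hessian g z (z' - z)).snd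
        = - (opYX (hessian g z) (x' - x) + opYY (hessian g z) (ystar x' - ystar x)) := by
      rw [pt_sub, pt_eq_add, map_add, ← projY_apply, map_sub, map_sub, projY_apply, projY_apply,
        h.gradient_snd_lowerSolution hy, h.gradient_snd_lowerSolution hy, map_add]
      simp [opYX_apply, opYY_apply, inX_apply, inY_apply]
    rw [h1, map_neg, neg_neg, map_add, h.invYY_opYY hm]
    abel
  rw [e, norm_neg]
  refine (h.norm_invYY_le hm z _).trans ?_
  rw [div_mul_eq_mul_div]
  refine div_le_div_of_nonneg_right ((norm_snd_le _).trans
    ((h.norm_gradient_sub_taylor_le hL₂ z z').trans ?_)) hm.le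
  have := mul_self_le_mul_self (norm_nonneg _) hz
  nlinarith [mul_le_mul_of_nonneg_left this hL₂]

/-- The quadratic remainder bound already yields differentiability, so no implicit function theorem
enters. -/
theorem hasFDerivAt_lowerSolution (hL₂ : 0 ≤ L₂) (hm : 0 < m) (x : X) :
    HasFDerivAt ystar
      (-(invYY g (pt x (ystar x)) ∘L opYX (hessian g (pt x (ystar x))))) x := by
  refine HasFDerivAt.of_isLittleO ?_
  have h1 : (fun x' => ystar x' - ystar x
      - (-(invYY g (pt x (ystar x)) ∘L opYX (hessian g (pt x (ystar x))))) (x' - x))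
      =O[nhds x] fun x' => ‖x' - x‖ ^ 2 := by
    refine Asymptotics.IsBigO.of_bound (L₂ * (1 + L / m) ^ 2 / m) (.of_forall fun x' => ?_)
    rw [norm_pow, norm_norm, neg_apply, sub_neg_eq_add]
    exact h.norm_lowerSolution_sub_taylor_le hy hL₂ hm x x'
  refine h1.trans_isLittleO ?_
  have h2 : (fun x' : X => ‖x' - x‖ ^ 2) =o[nhds x] fun x' => ‖x' - x‖ := by
    have := (Asymptotics.isLittleO_pow_id (𝕜 := ℝ) one_lt_two).comp_tendsto
      (show Filter.Tendsto (fun x' : X => ‖x' - x‖) (nhds x) (nhds 0) by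
        have : Continuous fun x' : X => ‖x' - x‖ := by fun_prop
        simpa using this.tendsto x)
    exact this
  exact h2.of_norm_right

variable {f : Pt X Y → ℝ} {L₀ L₁ : ℝ} (hf : UpperRegular f L₀ L₁)

include hf

/-- The gradient of the bilevel objective is the hypergradient at the lower-level solution. -/
theorem hasGradientAt_bilevel (hL₂ : 0 ≤ L₂) (hm : 0 < m) (x : X) :
    HasGradientAt (fun x => f (pt x (ystar x))) (hyperGrad f g (pt x (ystar x))) x := by
  rw [hasGradientAt_iff_hasFDerivAt]
  have hc : HasFDerivAt (fun x => pt x (ystar x)) (inX X Y + inY X Y ∘L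
      (-(invYY g (pt x (ystar x)) ∘L opYX (hessian g (pt x (ystar x)))))) x := by
    have e : (fun x => pt x (ystar x)) = fun x => inX X Y x + inY X Y (ystar x) :=
      funext fun x => pt_eq_add _ _
    rw [e]
    exact (inX X Y).hasFDerivAt.add ((inY X Y).hasFDerivAt.comp x
      (h.hasFDerivAt_lowerSolution hy hL₂ hm x))
  refine (HasFDerivAt.comp x (hf.diff _).hasGradientAt.hasFDerivAt hc).congr_fderiv ?_
  ext v
  set z := pt x (ystar x)
  have hpt : (inX X Y + inY X Y ∘L (-(invYY g z ∘L opYX (hessian g z)))) v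
      = pt v (-(invYY g z (opYX (hessian g z) v))) := by
    rw [pt_eq_add]; rfl
  -- Symmetry of the inverse block and of the mixed blocks moves the derivative of y* onto ∇_y f,
  -- which produces the second term of the hypergradient.
  rw [ContinuousLinearMap.comp_apply, hpt, InnerProductSpace.toDual_apply_apply,
    InnerProductSpace.toDual_apply_apply, inner_pt, inner_neg_right, h.inner_invYY hm,
    h.inner_opYX, hyperGrad, inner_sub_left]
  ring

/-- The second factor is a Lipschitz constant of x ↦ (x, y*(x)); the product of both is `Consts.Lf`,
see `Valid.Lf_eq`. -/
theorem norm_hyperGrad_lowerSolution_sub_le (hL : 0 ≤ L) (hL₂ : 0 ≤ L₂) (hm : 0 < m)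
    (x x' : X) :
    ‖hyperGrad f g (pt x' (ystar x')) - hyperGrad f g (pt x (ystar x))‖
      ≤ (L₁ + L * L₁ / m + L₀ / m * (L₂ + L * L₂ / m)) * (1 + L / m) * ‖x' - x‖ := by
  -- No sign of L₁ is assumed; the sign of the whole constant is read off from the estimate it
  -- appears in.
  have hL₁ : 0 ≤ (L₁ + L * L₁ / m + L₀ / m * (L₂ + L * L₂ / m)) * ‖x' - x‖ := by
    have := h.norm_hyperGrad_sub_le hf hL hL₂ hm (pt x 0) (pt x' 0)
    rw [pt_sub, sub_zero, norm_pt_zero_right] at this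
    exact (norm_nonneg _).trans this
  rcases eq_or_ne x' x with rfl | hx
  · simp
  have hpos : 0 < ‖x' - x‖ := norm_pos_iff.2 (sub_ne_zero.2 hx)
  have hM := nonneg_of_mul_nonneg_left hL₁ hpos
  refine (h.norm_hyperGrad_sub_le hf hL hL₂ hm _ _).trans ?_
  rw [mul_assoc _ (1 + L / m)]
  refine mul_le_mul_of_nonneg_left ?_ hM
  rw [pt_sub]
  refine (norm_pt_le _ _).trans ?_
  have := h.norm_lowerSolution_sub_le hy hm x x'
  linarith

end LowerRegular

end LowerSolution

/-! ### Bias of the truncated Neumann series -/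

section Neumann

variable {X Y : Type*} [NormedAddCommGroup X] [InnerProductSpace ℝ X] [FiniteDimensional ℝ X]
  [NormedAddCommGroup Y] [InnerProductSpace ℝ Y] [FiniteDimensional ℝ Y]

/-- The iteration matrix `I - ∇²_{yy} g / L` of the Neumann series. -/
noncomputable def neumannOp (g : Pt X Y → ℝ) (L : ℝ) (z : Pt X Y) : Y →L[ℝ] Y :=
  1 - (1 / L) • opYY (hessian g z)

/-- The hypergradient with the Neumann series truncated after `N` terms. -/
noncomputable def truncHyperGrad (f g : Pt X Y → ℝ) (L : ℝ) (N : ℕ) (z : Pt X Y) : X :=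
  (gradient f z).fst - opXY (hessian g z)
    ((1 / L) • ∑ j ∈ Finset.range N, (neumannOp g L z ^ j) (gradient f z).snd)

namespace LowerRegular

variable {g : Pt X Y → ℝ} {L L₂ m : ℝ} (h : LowerRegular g L L₂ m)

include h

theorem norm_neumannOp_le (hL : 0 < L) (z : Pt X Y) (v : Y) :
    ‖neumannOp g L z v‖ ≤ max 0 (1 - m / L) * ‖v‖ := by
  have := h.norm_sub_smul_opYY_le hL (t := 1 / L) (by positivity) (by field_simp; rfl) z v
  rwa [one_div_mul_eq_div] at this

theorem norm_neumannOp_pow_le (hL : 0 < L) (z : Pt X Y) (N : ℕ) (v : Y) :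
    ‖(neumannOp g L z ^ N) v‖ ≤ max 0 (1 - m / L) ^ N * ‖v‖ := by
  induction N with
  | zero => simp
  | succ N ih =>
    rw [pow_succ', mul_apply_eq_comp, pow_succ', mul_assoc]
    exact (h.norm_neumannOp_le hL z _).trans (mul_le_mul_of_nonneg_left ih (le_max_left _ _))

/-- With M = I - ∇²_yy g/L, the geometric sum gives (1/L)∇²_yy g ∑_{j<N} M^j = I - M^N. The
truncation error is therefore the cross block applied to the inverse block of M^N ∇_y f. -/
theorem norm_truncHyperGrad_sub_le {f : Pt X Y → ℝ} {L₀ L₁ : ℝ} (hf : UpperRegular f L₀ L₁)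
    (hL : 0 < L) (hm : 0 < m) (N : ℕ) (z : Pt X Y) :
    ‖hyperGrad f g z - truncHyperGrad f g L N z‖ ≤ L * (max 0 (1 - m / L) ^ N * L₀ / m) := by
  set w := (gradient f z).snd
  have hw : ‖w‖ ≤ L₀ := (norm_snd_le _).trans (hf.norm_grad_le z)
  have e1 : opYY (hessian g z) ((1 / L) • ∑ j ∈ Finset.range N, (neumannOp g L z ^ j) w)
      = w - (neumannOp g L z ^ N) w := by
    have h1 := DFunLike.congr_fun (mul_neg_geom_sum (neumannOp g L z) N) w
    have h2 : 1 - neumannOp g L z = (1 / L) • opYY (hessian g z) := by rw [neumannOp]; abel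
    rw [h2] at h1
    simpa [_root_.sum_apply] using h1
  have e2 : (1 / L) • ∑ j ∈ Finset.range N, (neumannOp g L z ^ j) w
      = invYY g z w - invYY g z ((neumannOp g L z ^ N) w) := by
    rw [← map_sub, ← e1, h.invYY_opYY hm]
  have e : hyperGrad f g z - truncHyperGrad f g L N z
      = - opXY (hessian g z) (invYY g z ((neumannOp g L z ^ N) w)) := by
    rw [hyperGrad, truncHyperGrad, e2, map_sub]
    abel
  rw [e, norm_neg]
  refine (h.norm_opXY_le hL.le z _).trans (mul_le_mul_of_nonneg_left ?_ hL.le)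
  refine (h.norm_invYY_le hm z _).trans (div_le_div_of_nonneg_right ?_ hm.le)
  exact (h.norm_neumannOp_pow_le hL z N w).trans
    (mul_le_mul_of_nonneg_left hw (pow_nonneg (le_max_left _ _) _))

end LowerRegular

end Neumann

end FedMBO

namespace FedMBO

/-! ### Second moments of random vectors -/

section SecMom

variable {Ω : Type*} [MeasurableSpace Ω] {E F : Type*} [NormedAddCommGroup E]
  [InnerProductSpace ℝ E] [CompleteSpace E] [NormedAddCommGroup F] [InnerProductSpace ℝ F]
  [CompleteSpace F]

/-- `X` is square integrable with mean `a` and second moment at most `s`. -/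
structure SecMom (μ : Measure Ω) (X : Ω → E) (a : E) (s : ℝ) : Prop where
  memLp : MemLp X 2 μ
  mean : ∫ ω, X ω ∂μ = a
  sq : ∫ ω, ‖X ω‖ ^ 2 ∂μ ≤ s

variable {μ : Measure Ω} [IsProbabilityMeasure μ] {X X' : Ω → E} {a a' : E} {s s' : ℝ}

theorem SecMom.integrable (h : SecMom μ X a s) : Integrable X μ := h.memLp.integrable (by norm_num)

theorem SecMom.meanVar (h : SecMom μ X a s) : MeanVar μ X a s :=
  .of_sq_norm_le h.memLp h.mean h.sq

theorem SecMom.norm_sq_le (h : SecMom μ X a s) : ‖a‖ ^ 2 ≤ s := by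
  rw [← h.mean]; exact h.memLp.sq_norm_integral_le.trans h.sq

theorem SecMom.mono {w : ℝ} (h : SecMom μ X a s) (hsw : s ≤ w) : SecMom μ X a w :=
  ⟨h.memLp, h.mean, h.sq.trans hsw⟩

theorem SecMom.smul (h : SecMom μ X a s) (c : ℝ) :
    SecMom μ (fun ω => c • X ω) (c • a) (c ^ 2 * s) := by
  refine ⟨h.memLp.const_smul c, by rw [integral_smul, h.mean], ?_⟩
  simp_rw [norm_smul, mul_pow, integral_const_mul]
  simpa using mul_le_mul_of_nonneg_left h.sq (sq_nonneg c)

/-- Independence is not assumed, whence the factors 2: the two terms of the estimator share the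
client c_i^0. -/
theorem SecMom.sub (h : SecMom μ X a s) (h' : SecMom μ X' a' s') :
    SecMom μ (fun ω => X ω - X' ω) (a - a') (2 * s + 2 * s') := by
  refine ⟨h.memLp.sub h'.memLp, by rw [integral_sub h.integrable h'.integrable, h.mean, h'.mean], ?_⟩
  have i1 : Integrable (fun ω => ‖X ω‖ ^ 2) μ := h.memLp.integrable_norm_pow (by norm_num)
  have i2 : Integrable (fun ω => ‖X' ω‖ ^ 2) μ := h'.memLp.integrable_norm_pow (by norm_num)
  calc ∫ ω, ‖X ω - X' ω‖ ^ 2 ∂μ ≤ ∫ ω, (2 * ‖X ω‖ ^ 2 + 2 * ‖X' ω‖ ^ 2) ∂μ := by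
        refine integral_mono_of_nonneg (.of_forall fun _ => by positivity)
          ((i1.const_mul 2).add (i2.const_mul 2)) (.of_forall fun ω => ?_)
        have := norm_sub_le (X ω) (X' ω)
        have h0 := norm_nonneg (X ω - X' ω)
        dsimp only
        nlinarith [sq_nonneg (‖X ω‖ - ‖X' ω‖)]
    _ ≤ _ := by
        rw [integral_add (i1.const_mul 2) (i2.const_mul 2), integral_const_mul, integral_const_mul]
        linarith [h.sq, h'.sq]

theorem MeanVar.secMom {v : ℝ} (h : MeanVar μ X a v) : SecMom μ X a (v + ‖a‖ ^ 2) :=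
  ⟨h.memLp, h.mean, h.integral_sq_norm_le⟩

theorem MeanVar.const_sub {v : ℝ} (h : MeanVar μ X a v) (b : E) :
    MeanVar μ (fun ω => b - X ω) (b - a) v := by
  refine ⟨(memLp_const b).sub h.memLp, ?_, ?_⟩
  · rw [integral_sub (integrable_const b) h.integrable, h.mean]; simp
  · have : ∀ ω, ‖b - X ω - (b - a)‖ = ‖X ω - a‖ := fun ω => by
      rw [sub_sub_sub_cancel_left, norm_sub_rev]
    simp_rw [this]
    exact h.var

theorem MeanVar.comp_measurePreserving {Ω' : Type*} [MeasurableSpace Ω'] {μ' : Measure Ω'}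
    {φ : Ω' → Ω} (hφ : MeasurePreserving φ μ' μ) {v : ℝ} (h : MeanVar μ X a v) :
    MeanVar μ' (fun ω => X (φ ω)) a v := by
  obtain ⟨h1, h2, h3⟩ := h
  rw [← hφ.map_eq] at h1 h2 h3
  refine ⟨h1.comp_of_map hφ.measurable.aemeasurable, ?_, ?_⟩
  · rw [integral_map hφ.measurable.aemeasurable h1.1] at h2
    exact h2
  · have hm : AEStronglyMeasurable (fun ω => ‖X ω - a‖ ^ 2) (Measure.map φ μ') :=
      (h1.1.sub aestronglyMeasurable_const).norm.pow 2
    rw [integral_map hφ.measurable.aemeasurable hm] at h3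
    exact h3

/-- A bounded linear image of an unbiased oracle. -/
theorem UnbiasedVar.meanVar_clm {G : Type*} [NormedAddCommGroup G] [NormedSpace ℝ G]
    [CompleteSpace G]
    {X : Ω → G} {a : G} {s b : ℝ} (h : UnbiasedVar μ X a s) (T : G →L[ℝ] E)
    (hT : ∀ v, ‖T v‖ ≤ b * ‖v‖) : MeanVar μ (fun ω => T (X ω)) (T a) (b ^ 2 * s ^ 2) := by
  have hTi : Integrable (fun ω => T (X ω)) μ := T.integrable_comp h.integrable
  have hle : ∀ ω, ‖T (X ω) - T a‖ ^ 2 ≤ b ^ 2 * ‖X ω - a‖ ^ 2 := fun ω => by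
    rw [← map_sub, ← mul_pow]
    exact pow_le_pow_left₀ (norm_nonneg _) (hT _) 2
  have hsq : Integrable (fun ω => ‖T (X ω) - T a‖ ^ 2) μ :=
    (h.sq_integrable.const_mul (b ^ 2)).mono'
      ((hTi.1.sub aestronglyMeasurable_const).norm.pow 2)
      (.of_forall fun ω => by rw [Real.norm_of_nonneg (by positivity)]; exact hle ω)
  refine ⟨?_, by rw [T.integral_comp_comm h.integrable, h.mean], ?_⟩
  · have h1 : MemLp (fun ω => T (X ω) - T a) 2 μ :=
      (memLp_two_iff_integrable_sq_norm (hTi.1.sub aestronglyMeasurable_const)).2 hsq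
    have h2 : (fun ω => T (X ω)) = (fun ω => T (X ω) - T a) + fun _ => T a := by ext; simp
    rw [h2]
    exact h1.add (memLp_const _)
  · refine (integral_mono hsq (h.sq_integrable.const_mul (b ^ 2)) hle).trans ?_
    rw [integral_const_mul]
    exact mul_le_mul_of_nonneg_left h.variance (sq_nonneg b)

theorem integral_uniformOn_univ {κ : Type*} [Fintype κ] [Nonempty κ] [MeasurableSpace κ]
    [MeasurableSingletonClass κ] (φ : κ → E) :
    ∫ j, φ j ∂(uniformOn (Set.univ : Set κ)) = (1 / (Fintype.card κ : ℝ)) • ∑ j, φ j := by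
  have h : uniformOn (Set.univ : Set κ)
      = ((Fintype.card κ : ENNReal)⁻¹) • (Measure.count : Measure κ) := by
    ext s hs
    rw [uniformOn_univ, Measure.smul_apply, smul_eq_mul, ENNReal.div_eq_inv_mul]
  rw [h, integral_smul_measure, integral_count]
  simp

end SecMom

section Product

variable {ι : Type*} {V : ι → Type*} [∀ i, MeasurableSpace (V i)] {ν : ∀ i, Measure (V i)}
  [∀ i, IsProbabilityMeasure (ν i)] {E F : Type*} [NormedAddCommGroup E] [InnerProductSpace ℝ E]
  [FiniteDimensional ℝ E] [MeasurableSpace E] [BorelSpace E] [NormedAddCommGroup F]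
  [InnerProductSpace ℝ F] [FiniteDimensional ℝ F] [MeasurableSpace F] [BorelSpace F]

theorem SecMom.select {κ : Type*} [Fintype κ] [MeasurableSpace κ] [MeasurableSingletonClass κ]
    {S S' : Set ι} {W : (∀ i, V i) → κ} (hW : Measurable W) (hWS : DependsOn W S)
    {X : κ → (∀ i, V i) → E} (hX : ∀ w, DependsOn (X w) S') (hS : Disjoint S S')
    {a : κ → E} {s : ℝ} (h : ∀ w, SecMom (Measure.infinitePi ν) (X w) (a w) s) :
    SecMom (Measure.infinitePi ν) (fun δ => X (W δ) δ)
      (∫ δ, a (W δ) ∂Measure.infinitePi ν) s := by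
  have hm := memLp_select hW fun w => (h w).memLp
  refine ⟨hm, ?_, ?_⟩
  · rw [integral_fresh hWS hX hS (hm.integrable (by norm_num))]
    simp [(h _).mean]
  · rw [integral_fresh (Ψ := fun k δ => ‖X k δ‖ ^ 2) hWS
      (fun k δ δ' hδ => by dsimp only; rw [hX k hδ]) hS (hm.integrable_norm_pow (by norm_num))]
    refine (integral_mono_of_nonneg (.of_forall fun _ => integral_nonneg fun _ => by positivity)
      (integrable_const s) (.of_forall fun δ => (h _).sq)).trans (by simp)

/-- Each independent factor multiplies the second moment bound by ρ; iteration gives ρ^j for a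
product of j sampled matrices. -/
theorem SecMom.apply_fresh {S S' : Set ι} {q : (∀ i, V i) → E} (hq : Measurable q)
    (hqS : DependsOn q S) {M : (∀ i, V i) → E →L[ℝ] F} (hM : Measurable M)
    (hMS : DependsOn M S') (hS : Disjoint S S') {R : E →L[ℝ] F} {ρ s : ℝ} {a : E} (hρ : 0 ≤ ρ)
    (h : ∀ v, SecMom (Measure.infinitePi ν) (fun δ => M δ v) (R v) (ρ * ‖v‖ ^ 2))
    (hqm : SecMom (Measure.infinitePi ν) q a s) :
    SecMom (Measure.infinitePi ν) (fun δ => M δ (q δ)) (R a) (ρ * s) := by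
  obtain ⟨h1, h2, h3⟩ := memLp_apply_fresh hq hqS hM hMS hS hρ (fun v => (h v).memLp)
    (fun v => (h v).mean) (fun v => (h v).sq) hqm.memLp
  exact ⟨h1, by rw [h2, hqm.mean], h3.trans (mul_le_mul_of_nonneg_left hqm.sq hρ)⟩

end Product

theorem measurable_select {α κ γ : Type*} [MeasurableSpace α] [MeasurableSpace κ] [Countable κ]
    [MeasurableSingletonClass κ] [MeasurableSpace γ] {W : α → κ} (hW : Measurable W)
    {F : κ → α → γ} (hF : ∀ c, Measurable (F c)) : Measurable fun p => F (W p) p := by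
  have : Measurable fun q : α × κ => F q.2 q.1 := measurable_from_prod_countable_left hF
  exact this.comp (measurable_id.prodMk hW)

/-! ### The product law of all random choices -/

section Sampling

variable {m n S N : ℕ} {X Y : Type*} [NormedAddCommGroup X] [InnerProductSpace ℝ X]
  [FiniteDimensional ℝ X] [NormedAddCommGroup Y] [InnerProductSpace ℝ Y] [FiniteDimensional ℝ Y]
  [MeasurableSpace X] [BorelSpace X] [MeasurableSpace Y] [BorelSpace Y]
  {Zf Zg : Type u} [MeasurableSpace Zf] [MeasurableSpace Zg] {B : Problem m X Y Zf Zg} {c : Consts}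

theorem isProbabilityMeasure_law (hB : B.Assumptions c) (hn : 1 ≤ n) (hnm : n ≤ m) (hN : 1 ≤ N)
    (s : Source m n S) : IsProbabilityMeasure (s.law B N) := by
  have hm : Nonempty (Fin m) := ⟨⟨0, by omega⟩⟩
  have hN' : Nonempty (Fin N) := ⟨⟨0, by omega⟩⟩
  have he : Nonempty (Fin n ↪ Fin m) := ⟨Fin.castLEEmb hnm⟩
  have key : ∀ (κ : Type) [Fintype κ] [Nonempty κ],
      IsProbabilityMeasure (@uniformOn (ULift.{u} κ) ⊤ Set.univ) := by
    intro κ _ _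
    let _ : MeasurableSpace (ULift.{u} κ) := ⊤
    exact isProbabilityMeasure_uniformOn Set.finite_univ Set.univ_nonempty
  cases s with
  | innerClients k t => exact key _
  | innerData k t i j c => exact hB.prob_g c
  | trunc k i => exact key _
  | client k l i => exact key _
  | theta k i c => exact hB.prob_f c
  | phi k i c => exact hB.prob_f c
  | zeta k i l c => exact hB.prob_g c
  | omega k i c => exact hB.prob_g c

variable [∀ s : Source m n S, IsProbabilityMeasure (s.law B N)]

variable (B n S N) in
/-- The joint law of all random choices. -/
noncomputable abbrev drawsLaw : Measure (Draws m n S N Zf Zg) :=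
  Measure.infinitePi fun s => s.law B N

theorem integral_ulift_uniformOn {κ E : Type*} [Fintype κ] [Nonempty κ] [NormedAddCommGroup E]
    [InnerProductSpace ℝ E] [CompleteSpace E] (φ : κ → E) :
    ∫ j : ULift.{u} κ, φ j.down ∂(@uniformOn (ULift.{u} κ) ⊤ Set.univ)
      = (1 / (Fintype.card κ : ℝ)) • ∑ j, φ j := by
  let _ : MeasurableSpace (ULift.{u} κ) := ⊤
  rw [integral_uniformOn_univ, Fintype.card_ulift]
  congr 1
  exact Fintype.sum_equiv Equiv.ulift _ _ fun _ => rfl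

theorem integral_eval {E : Type*} [NormedAddCommGroup E] [NormedSpace ℝ E]
    (s : Source m n S) {φ : s.Val Zf Zg N → E} (hφ : AEStronglyMeasurable φ (s.law B N)) :
    ∫ δ, φ (δ s) ∂Measure.infinitePi (fun s : Source m n S => s.law B N)
      = ∫ v, φ v ∂s.law B N := by
  have h := measurePreserving_eval_infinitePi (fun s : Source m n S => s.law B N) s
  conv_rhs => rw [← h.map_eq]
  rw [integral_map h.measurable.aemeasurable (by rw [h.map_eq]; exact hφ)]

theorem integral_client [NeZero m] {E : Type*} [NormedAddCommGroup E] [InnerProductSpace ℝ E]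
    [FiniteDimensional ℝ E] [MeasurableSpace E] [BorelSpace E] (k l : ℕ) (i : Fin n)
    (φ : Fin m → E) :
    ∫ δ : Draws m n S N Zf Zg, φ (δ.client k l i)
        ∂Measure.infinitePi (fun s : Source m n S => s.law B N)
      = (1 / (m : ℝ)) • ∑ c, φ c := by
  have := integral_eval (B := B) (N := N) (.client k l i : Source m n S)
    (φ := fun v : ULift.{u} (Fin m) => φ v.down)
    (Measurable.aestronglyMeasurable (fun _ _ => trivial))
  refine this.trans ?_
  refine (integral_ulift_uniformOn.{u} φ).trans ?_
  rw [Fintype.card_fin]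

theorem integral_trunc [NeZero N] {E : Type*} [NormedAddCommGroup E] [InnerProductSpace ℝ E]
    [FiniteDimensional ℝ E] [MeasurableSpace E] [BorelSpace E] (k : ℕ) (i : Fin n)
    (φ : Fin N → E) :
    ∫ δ : Draws m n S N Zf Zg, φ (δ (.trunc k i)).down
        ∂Measure.infinitePi (fun s : Source m n S => s.law B N)
      = (1 / (N : ℝ)) • ∑ j, φ j := by
  have := integral_eval (B := B) (N := N) (.trunc k i : Source m n S)
    (φ := fun v : ULift.{u} (Fin N) => φ v.down)
    (Measurable.aestronglyMeasurable (fun _ _ => trivial))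
  refine this.trans ?_
  refine (integral_ulift_uniformOn.{u} φ).trans ?_
  rw [Fintype.card_fin]

theorem integral_innerClients [Nonempty (Fin n ↪ Fin m)] {E : Type*} [NormedAddCommGroup E]
    [InnerProductSpace ℝ E] [FiniteDimensional ℝ E] [MeasurableSpace E] [BorelSpace E] (k t : ℕ)
    (φ : (Fin n ↪ Fin m) → E) :
    ∫ δ : Draws m n S N Zf Zg, φ (δ (.innerClients k t)).down
        ∂Measure.infinitePi (fun s : Source m n S => s.law B N)
      = (1 / (Fintype.card (Fin n ↪ Fin m) : ℝ)) • ∑ e, φ e := by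
  have := integral_eval (B := B) (N := N) (.innerClients k t : Source m n S)
    (φ := fun v : ULift.{u} (Fin n ↪ Fin m) => φ v.down)
    (Measurable.aestronglyMeasurable (fun _ _ => trivial))
  refine this.trans ?_
  exact integral_ulift_uniformOn.{u} φ

end Sampling

end FedMBO

namespace FedMBO

section Assumptions

variable {m : ℕ} {X Y : Type*} [NormedAddCommGroup X] [InnerProductSpace ℝ X]
  [FiniteDimensional ℝ X] [NormedAddCommGroup Y] [InnerProductSpace ℝ Y] [FiniteDimensional ℝ Y]
  [MeasurableSpace X] [BorelSpace X] [MeasurableSpace Y] [BorelSpace Y]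
  {Zf Zg : Type u} [MeasurableSpace Zf] [MeasurableSpace Zg] {B : Problem m X Y Zf Zg} {c : Consts}

theorem Problem.Assumptions.lowerRegular (hB : B.Assumptions c) (i : Fin m) :
    LowerRegular (B.g i) c.lg1 c.lg2 c.mu :=
  ⟨hB.diff_g i, hB.diff_grad_g i, hB.lip_grad_g i, hB.lip_hess_g i,
    inner_gradient_sub_ge (hB.diff_g i) (hB.strong_convex i)⟩

theorem Problem.Assumptions.upperRegular (hB : B.Assumptions c) (hc : c.Valid) (i : Fin m) :
    UpperRegular (B.f i) c.lf0 c.lf1 := by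
  refine ⟨hB.diff_f i, hB.lip_grad_f i, fun z => ?_⟩
  have h := norm_fderiv_le_of_lip' ℝ hc.lf0_nonneg (x₀ := z) (.of_forall fun w => hB.lip_f i w z)
  rwa [← toDual_gradient, LinearIsometryEquiv.norm_map] at h

theorem Problem.Assumptions.lowerRegular_gbar [NeZero m] (hB : B.Assumptions c) :
    LowerRegular B.gbar c.lg1 c.lg2 c.mu := .average hB.lowerRegular

theorem Problem.Assumptions.upperRegular_fbar [NeZero m] (hB : B.Assumptions c) (hc : c.Valid) :
    UpperRegular B.fbar c.lf0 c.lf1 := .average (hB.upperRegular hc)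

theorem Problem.Assumptions.gradient_fbar (hB : B.Assumptions c) (z : Pt X Y) :
    gradient B.fbar z = (1 / (m : ℝ)) • ∑ i, gradient (B.f i) z :=
  congrFun (gradient_average hB.diff_f) z

theorem Problem.Assumptions.gradient_gbar (hB : B.Assumptions c) (z : Pt X Y) :
    gradient B.gbar z = (1 / (m : ℝ)) • ∑ i, gradient (B.g i) z :=
  congrFun (gradient_average hB.diff_g) z

theorem Problem.Assumptions.hessian_gbar (hB : B.Assumptions c) (z : Pt X Y) :
    hessian B.gbar z = (1 / (m : ℝ)) • ∑ i, hessian (B.g i) z :=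
  hessian_average hB.diff_g hB.diff_grad_g z

end Assumptions

section BlockEval

variable {X Y : Type*} [NormedAddCommGroup X] [InnerProductSpace ℝ X] [FiniteDimensional ℝ X]
  [NormedAddCommGroup Y] [InnerProductSpace ℝ Y] [FiniteDimensional ℝ Y]

variable (X) in
/-- Evaluation of the `yy` block at `v`, linear in the operator. -/
noncomputable def evalYY (v : Y) : Op (Pt X Y) →L[ℝ] Y :=
  projY X Y ∘L ContinuousLinearMap.apply ℝ (Pt X Y) (pt 0 v)

/-- Evaluation of the `xy` block at `v`, linear in the operator. -/
noncomputable def evalXY (v : Y) : Op (Pt X Y) →L[ℝ] X :=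
  projX X Y ∘L ContinuousLinearMap.apply ℝ (Pt X Y) (pt 0 v)

theorem evalYY_apply (H : Op (Pt X Y)) (v : Y) : evalYY X v H = opYY H v := rfl
theorem evalXY_apply (H : Op (Pt X Y)) (v : Y) : evalXY v H = opXY H v := rfl

theorem continuous_opYY : Continuous (opYY : Op (Pt X Y) → Y →L[ℝ] Y) :=
  continuous_const.clm_comp (continuous_id.clm_comp continuous_const)

theorem continuous_opXY : Continuous (opXY : Op (Pt X Y) → Y →L[ℝ] X) :=
  continuous_const.clm_comp (continuous_id.clm_comp continuous_const)

end BlockEval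

/-! ### The hypergradient estimator and the choices it reads -/

section Hyper

variable {m n S N : ℕ} {X Y : Type*} [NormedAddCommGroup X] [InnerProductSpace ℝ X]
  [FiniteDimensional ℝ X] [NormedAddCommGroup Y] [InnerProductSpace ℝ Y] [FiniteDimensional ℝ Y]
  {Zf Zg : Type u} [MeasurableSpace Zf] [MeasurableSpace Zg]

/-- The clients and Hessian data of slot `i` in round `k`, at the levels satisfying `Q`. -/
def levels (k : ℕ) (i : Fin n) (Q : ℕ → Prop) : Set (Source m n S) :=
  {s | ∃ l, Q l ∧ (s = .client k l i ∨ ∃ c, s = .zeta k i l c)}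

def thetas (k : ℕ) (i : Fin n) : Set (Source m n S) := {s | ∃ c, s = .theta k i c}
def phis (k : ℕ) (i : Fin n) : Set (Source m n S) := {s | ∃ c, s = .phi k i c}
def omegas (k : ℕ) (i : Fin n) : Set (Source m n S) := {s | ∃ c, s = .omega k i c}
def zetas (k : ℕ) (i : Fin n) (l : ℕ) : Set (Source m n S) := {s | ∃ c, s = .zeta k i l c}
def truncs (k : ℕ) : Set (Source m n S) := {s | ∃ i, s = .trunc k i}

/-- All random choices of slot `i` of the hypergradient estimator in round `k` except for the
truncation level. -/
def slots (k : ℕ) (i : Fin n) : Set (Source m n S) :=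
  levels k i (fun _ => True) ∪ thetas k i ∪ phis k i ∪ omegas k i

variable (B : Problem m X Y Zf Zg) (lg1 : ℝ) (d : Draws m n S N Zf Zg)

/-- The sampled iteration matrix of level `l`. -/
noncomputable def sampleOp (k : ℕ) (z : Pt X Y) (i : Fin n) (l : ℕ) : Y →L[ℝ] Y :=
  1 - (1 / lg1) • opYY (B.hessG (d.client k l i) z (d.zeta k l i))

/-- The products of the sampled iteration matrices, without truncation and normalization. -/
noncomputable def neumannVec (k : ℕ) (z : Pt X Y) (i : Fin n) : ℕ → Y
  | 0 => (B.gradF (d.client k 0 i) z (d.theta k i)).snd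
  | l + 1 => sampleOp B lg1 d k z i (l + 1) (neumannVec k z i l)

/-- The output of slot `i` with truncation level `j` and cross block of level `l + 1`. -/
noncomputable def pheAt (k : ℕ) (z : Pt X Y) (i : Fin n) (j l : ℕ) : X :=
  (B.gradF (d.client k 0 i) z (d.phi k i)).fst -
    opXY (B.hessG (d.client k (l + 1) i) z (d (.omega k i (d.client k (l + 1) i))))
      (((N : ℝ) / lg1) • neumannVec B lg1 d k z i j)

/-- The recursion is stationary after level N_i, and the factor N/ℓ_{g,1} passes through it by
linearity. -/
theorem pheVec_eq (k : ℕ) (z : Pt X Y) (i : Fin n) (l : ℕ) :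
    pheVec B lg1 d k z i l = ((N : ℝ) / lg1) • neumannVec B lg1 d k z i (min l (d.trunc k i)) := by
  induction l with
  | zero => simp [pheVec, neumannVec]
  | succ l ih =>
    rw [pheVec]
    split_ifs with h
    · rw [ih, min_eq_left h, min_eq_left (by omega), neumannVec, sampleOp, blockYY_eq]
      simp only [map_smul, _root_.sub_apply, _root_.one_apply_eq_self,
        _root_.smul_apply, smul_sub]
      rw [smul_comm]
    · rw [ih, min_eq_right (by omega), min_eq_right (by omega)]

/-- Slots interact only through the truncation levels: with those two numbers fixed, `pheAt` reads
nothing but the clients and data of slot i. -/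
theorem phe_eq (k : ℕ) (z : Pt X Y) (i : Fin n) :
    phe B lg1 d k z i = pheAt B lg1 d k z i (d.trunc k i) (d.maxTrunc k) := by
  have h : d.trunc k i ≤ d.maxTrunc k := Finset.le_sup (Finset.mem_univ i)
  rw [phe, pheVec_eq, min_eq_right h, pheAt]
  rfl

variable {d}

theorem dependsOn_client (k l : ℕ) (i : Fin n) :
    DependsOn (fun d : Draws m n S N Zf Zg => d.client k l i) {.client k l i} := fun (d d' : Draws m n S N Zf Zg) h => by
  simp only [Draws.client, h _ (Set.mem_singleton _)]

theorem dependsOn_sampleOp (k : ℕ) (z : Pt X Y) (i : Fin n) (l : ℕ) :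
    DependsOn (fun d : Draws m n S N Zf Zg => sampleOp B lg1 d k z i l)
      (levels k i (· = l)) := fun (d d' : Draws m n S N Zf Zg) h => by
  have h1 : d.client k l i = d'.client k l i :=
    dependsOn_client k l i fun s hs => h s ⟨l, rfl, .inl hs⟩
  have h2 : d.zeta k l i = d'.zeta k l i := by
    rw [Draws.zeta, Draws.zeta, h1]
    exact h _ ⟨l, rfl, .inr ⟨_, rfl⟩⟩
  simp only [sampleOp, h1, h2]

theorem dependsOn_neumannVec (k : ℕ) (z : Pt X Y) (i : Fin n) (l : ℕ) :
    DependsOn (fun d : Draws m n S N Zf Zg => neumannVec B lg1 d k z i l)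
      (levels k i (· ≤ l) ∪ thetas k i) := fun (d d' : Draws m n S N Zf Zg) h => by
  induction l with
  | zero =>
    have h1 : d.client k 0 i = d'.client k 0 i :=
      dependsOn_client k 0 i fun s hs => h s (.inl ⟨0, le_rfl, .inl hs⟩)
    have h2 : d.theta k i = d'.theta k i := by
      rw [Draws.theta, Draws.theta, h1]
      exact h _ (.inr ⟨_, rfl⟩)
    simp only [neumannVec, h1, h2]
  | succ l ih =>
    simp only [neumannVec]
    have h1 := dependsOn_sampleOp (N := N) B lg1 k z i (l + 1) (x := d) (y := d') fun s hs => h s (.inl (by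
      obtain ⟨l', rfl, h'⟩ := hs; exact ⟨_, le_rfl, h'⟩))
    have h2 := ih fun s hs => h s (by
      rcases hs with ⟨l', hl, h'⟩ | hs
      · exact .inl ⟨l', by dsimp only at hl ⊢; omega, h'⟩
      · exact .inr hs)
    dsimp only at h1 h2
    rw [h1, h2]

theorem dependsOn_pheAt (k : ℕ) (z : Pt X Y) (i : Fin n) (j l : ℕ) :
    DependsOn (fun d : Draws m n S N Zf Zg => pheAt B lg1 d k z i j l) (slots k i) :=
  fun (d d' : Draws m n S N Zf Zg) h => by
  have hc : ∀ l, d.client k l i = d'.client k l i := fun l =>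
    dependsOn_client k l i fun s hs => h s (.inl (.inl (.inl ⟨l, trivial, .inl hs⟩)))
  have h1 : d.phi k i = d'.phi k i := by
    rw [Draws.phi, Draws.phi, hc]; exact h _ (.inl (.inr ⟨_, rfl⟩))
  have h2 : neumannVec B lg1 d k z i j = neumannVec B lg1 d' k z i j :=
    dependsOn_neumannVec B lg1 k z i j fun s hs => h s (by
      rcases hs with ⟨l', hl, h'⟩ | hs
      · exact .inl (.inl (.inl ⟨l', trivial, h'⟩))
      · exact .inl (.inl (.inr hs)))
  have h3 : d (.omega k i (d.client k (l + 1) i)) = d' (.omega k i (d'.client k (l + 1) i)) := by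
    rw [hc]; exact h _ (.inr ⟨_, rfl⟩)
  simp only [pheAt, h1, h2, h3, hc]

end Hyper

/-! ### Joint measurability in the point and the draws, as the point will be a random iterate -/

section Measurability

variable {m n S N : ℕ} {X Y : Type*} [NormedAddCommGroup X] [InnerProductSpace ℝ X]
  [FiniteDimensional ℝ X] [NormedAddCommGroup Y] [InnerProductSpace ℝ Y] [FiniteDimensional ℝ Y]
  [MeasurableSpace X] [BorelSpace X] [MeasurableSpace Y] [BorelSpace Y]
  {Zf Zg : Type u} [MeasurableSpace Zf] [MeasurableSpace Zg] {B : Problem m X Y Zf Zg} {c : Consts}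

theorem measurable_client (k l : ℕ) (i : Fin n) :
    Measurable fun d : Draws m n S N Zf Zg => d.client k l i :=
  (show Measurable[⊤] (fun v : ULift.{u} (Fin m) => v.down) from fun _ _ => trivial).comp
    (measurable_pi_apply (Source.client k l i : Source m n S))

theorem measurable_trunc (k : ℕ) (i : Fin n) :
    Measurable fun d : Draws m n S N Zf Zg => (d (.trunc k i)).down :=
  (show Measurable[⊤] (fun v : ULift.{u} (Fin N) => v.down) from fun _ _ => trivial).comp
    (measurable_pi_apply (Source.trunc k i : Source m n S))

theorem measurable_pt : Measurable fun p : X × Y => pt p.1 p.2 :=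
  WithLp.measurable_toLp 2 (X × Y)

variable (hB : B.Assumptions c) (lg1 : ℝ)

include hB

theorem measurable_gradF_theta (k l : ℕ) (i : Fin n) :
    Measurable fun p : Pt X Y × Draws m n S N Zf Zg =>
      B.gradF (p.2.client k l i) p.1 (p.2 (.theta k i (p.2.client k l i))) :=
  measurable_select (F := fun c (p : Pt X Y × Draws m n S N Zf Zg) =>
    B.gradF c p.1 (p.2 (.theta k i c))) ((measurable_client k l i).comp measurable_snd) fun c =>
    (hB.meas_gradF c).comp (measurable_fst.prodMk
      ((measurable_pi_apply (Source.theta k i c : Source m n S)).comp measurable_snd))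

theorem measurable_gradF_phi (k l : ℕ) (i : Fin n) :
    Measurable fun p : Pt X Y × Draws m n S N Zf Zg =>
      B.gradF (p.2.client k l i) p.1 (p.2 (.phi k i (p.2.client k l i))) :=
  measurable_select (F := fun c (p : Pt X Y × Draws m n S N Zf Zg) =>
    B.gradF c p.1 (p.2 (.phi k i c))) ((measurable_client k l i).comp measurable_snd) fun c =>
    (hB.meas_gradF c).comp (measurable_fst.prodMk
      ((measurable_pi_apply (Source.phi k i c : Source m n S)).comp measurable_snd))

theorem measurable_hessG_zeta (k l : ℕ) (i : Fin n) :
    Measurable fun p : Pt X Y × Draws m n S N Zf Zg =>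
      B.hessG (p.2.client k l i) p.1 (p.2 (.zeta k i l (p.2.client k l i))) :=
  measurable_select (F := fun c (p : Pt X Y × Draws m n S N Zf Zg) =>
    B.hessG c p.1 (p.2 (.zeta k i l c))) ((measurable_client k l i).comp measurable_snd) fun c =>
    (hB.meas_hessG c).comp (measurable_fst.prodMk
      ((measurable_pi_apply (Source.zeta k i l c : Source m n S)).comp measurable_snd))

theorem measurable_hessG_omega (k l : ℕ) (i : Fin n) :
    Measurable fun p : Pt X Y × Draws m n S N Zf Zg =>
      B.hessG (p.2.client k l i) p.1 (p.2 (.omega k i (p.2.client k l i))) :=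
  measurable_select (F := fun c (p : Pt X Y × Draws m n S N Zf Zg) =>
    B.hessG c p.1 (p.2 (.omega k i c))) ((measurable_client k l i).comp measurable_snd) fun c =>
    (hB.meas_hessG c).comp (measurable_fst.prodMk
      ((measurable_pi_apply (Source.omega k i c : Source m n S)).comp measurable_snd))

theorem measurable_sampleOp (k : ℕ) (i : Fin n) (l : ℕ) :
    Measurable fun p : Pt X Y × Draws m n S N Zf Zg => sampleOp B lg1 p.2 k p.1 i l := by
  have : Continuous fun H : Op (Pt X Y) => (1 : Y →L[ℝ] Y) - (1 / lg1) • opYY H :=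
    continuous_const.sub (continuous_opYY.const_smul (1 / lg1))
  exact this.measurable.comp (measurable_hessG_zeta hB k l i)

theorem measurable_neumannVec (k : ℕ) (i : Fin n) (l : ℕ) :
    Measurable fun p : Pt X Y × Draws m n S N Zf Zg => neumannVec B lg1 p.2 k p.1 i l := by
  induction l with
  | zero => exact (projY X Y).continuous.measurable.comp (measurable_gradF_theta hB k 0 i)
  | succ l ih =>
    have : Continuous fun p : (Y →L[ℝ] Y) × Y => p.1 p.2 := isBoundedBilinearMap_apply.continuous
    exact this.measurable.comp ((measurable_sampleOp hB lg1 k i (l + 1)).prodMk ih)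

theorem measurable_pheAt (k : ℕ) (i : Fin n) (j l : ℕ) :
    Measurable fun p : Pt X Y × Draws m n S N Zf Zg => pheAt B lg1 p.2 k p.1 i j l := by
  have h : Continuous fun p : (Y →L[ℝ] X) × Y => p.1 p.2 := isBoundedBilinearMap_apply.continuous
  exact ((projX X Y).continuous.measurable.comp (measurable_gradF_phi hB k 0 i)).sub
    (h.measurable.comp ((continuous_opXY.measurable.comp
      (measurable_hessG_omega hB k (l + 1) i)).prodMk
      ((measurable_neumannVec hB lg1 k i j).const_smul _)))

theorem measurable_phe (k : ℕ) (i : Fin n) :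
    Measurable fun p : Pt X Y × Draws m n S N Zf Zg => phe B lg1 p.2 k p.1 i := by
  simp_rw [phe_eq]
  have hW : Measurable fun p : Pt X Y × Draws m n S N Zf Zg => (p.2.trunc k i, p.2.maxTrunc k) := by
    have ht : ∀ i, Measurable fun p : Pt X Y × Draws m n S N Zf Zg => p.2.trunc k i := fun i =>
      (measurable_of_finite (fun v : Fin N => (v : ℕ))).comp
        ((measurable_trunc k i).comp measurable_snd)
    refine (ht i).prodMk ?_
    have : Measurable fun p : Pt X Y × Draws m n S N Zf Zg => fun i => p.2.trunc k i :=
      measurable_pi_lambda _ ht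
    exact (Measurable.of_discrete (f := fun τ : Fin n → ℕ => Finset.univ.sup τ)).comp this
  exact measurable_select (F := fun (w : ℕ × ℕ) (p : Pt X Y × Draws m n S N Zf Zg) =>
    pheAt B lg1 p.2 k p.1 i w.1 w.2) hW fun w => measurable_pheAt hB lg1 k i w.1 w.2

end Measurability

end FedMBO

namespace FedMBO

namespace Consts

variable (c : Consts)

/-- Bound for the second moment of the oracle of `∇f_i`. -/
def gradSq : ℝ := c.sf ^ 2 + c.lf0 ^ 2

/-- Second moment of one factor of the sampled Neumann product. -/
noncomputable def rho : ℝ := (1 - c.mu / c.lg1) ^ 2 + (c.sg2 / c.lg1) ^ 2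

/-- Bound for the second moment of the estimator with truncation level `j`. -/
noncomputable def pheSq (N j : ℕ) : ℝ :=
  2 * c.gradSq + 2 * ((c.sg2 ^ 2 + c.lg1 ^ 2) * (((N : ℝ) / c.lg1) ^ 2 * (c.rho ^ j * c.gradSq)))

theorem rho_nonneg : 0 ≤ c.rho := by unfold rho; positivity

theorem gradSq_nonneg : 0 ≤ c.gradSq := by unfold gradSq; positivity

end Consts

/-! ### Mean and variance of the hypergradient estimator -/

section HyperMoments

variable {m n S N : ℕ} {X Y : Type*} [NormedAddCommGroup X] [InnerProductSpace ℝ X]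
  [FiniteDimensional ℝ X] [NormedAddCommGroup Y] [InnerProductSpace ℝ Y] [FiniteDimensional ℝ Y]
  [MeasurableSpace X] [BorelSpace X] [MeasurableSpace Y] [BorelSpace Y]
  {Zf Zg : Type u} [MeasurableSpace Zf] [MeasurableSpace Zg] {B : Problem m X Y Zf Zg} {c : Consts}
  [NeZero m] [∀ s : Source m n S, IsProbabilityMeasure (s.law B N)]

theorem SecMom.select_client {E : Type*} [NormedAddCommGroup E] [InnerProductSpace ℝ E]
    [FiniteDimensional ℝ E] [MeasurableSpace E] [BorelSpace E] (k l : ℕ) (i : Fin n)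
    {S' : Set (Source m n S)} {F : Fin m → Draws m n S N Zf Zg → E} {a : Fin m → E} {s : ℝ}
    (hF : ∀ j, DependsOn (F j) S') (hS : Source.client k l i ∉ S')
    (h : ∀ j, SecMom (drawsLaw n S N B) (F j) (a j) s) :
    SecMom (drawsLaw n S N B) (fun d => F (d.client k l i) d) ((1 / (m : ℝ)) • ∑ j, a j) s := by
  have := SecMom.select (measurable_client k l i) (dependsOn_client k l i) hF
    (Set.disjoint_singleton_left.2 hS) h
  rwa [integral_client k l i a] at this

theorem MeanVar.eval_source {E : Type*} [NormedAddCommGroup E] [InnerProductSpace ℝ E]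
    [CompleteSpace E] (s : Source m n S) {F : s.Val Zf Zg N → E} {a : E} {v : ℝ}
    (h : MeanVar (s.law B N) F a v) : MeanVar (drawsLaw n S N B) (fun d => F (d s)) a v :=
  h.comp_measurePreserving (measurePreserving_eval_infinitePi (fun s : Source m n S => s.law B N) s)

variable (hB : B.Assumptions c) (hc : c.Valid)

include hB hc

theorem secMom_gradF_theta (k : ℕ) (z : Pt X Y) (i : Fin n) :
    SecMom (drawsLaw n S N B)
      (fun d => (B.gradF (d.client k 0 i) z (d.theta k i)).snd) (gradient B.fbar z).snd
      c.gradSq := by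
  have e : (gradient B.fbar z).snd = (1 / (m : ℝ)) • ∑ j, (gradient (B.f j) z).snd := by
    rw [hB.gradient_fbar, ← projY_apply, map_smul, map_sum]; rfl
  rw [e]
  refine SecMom.select_client (F := fun j (d : Draws m n S N Zf Zg) =>
    (B.gradF j z (d (.theta k i j))).snd) k 0 i (S' := thetas k i) (fun j d d' h => ?_) ?_ fun j => ?_
  · dsimp only; rw [h _ ⟨j, rfl⟩]
  · rintro ⟨j, hj⟩; cases hj
  · have := hB.prob_f j
    have h1 : MeanVar (B.Df j) (fun ζ => (B.gradF j z ζ).snd) (gradient (B.f j) z).snd (c.sf ^ 2) :=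
      (hB.oracle_gradF j z).meanVar.clm (projY X Y) norm_projY_le
    have h2 : MeanVar (drawsLaw n S N B)
        (fun d => (B.gradF j z (d (.theta k i j))).snd) (gradient (B.f j) z).snd (c.sf ^ 2) :=
      MeanVar.eval_source (Source.theta k i j) h1
    refine h2.secMom.mono (add_le_add le_rfl (pow_le_pow_left₀ (norm_nonneg _) ?_ 2))
    exact (norm_snd_le _).trans ((hB.upperRegular hc j).norm_grad_le z)

theorem secMom_gradF_phi (k : ℕ) (z : Pt X Y) (i : Fin n) :
    SecMom (drawsLaw n S N B)
      (fun d => (B.gradF (d.client k 0 i) z (d.phi k i)).fst) (gradient B.fbar z).fst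
      c.gradSq := by
  have e : (gradient B.fbar z).fst = (1 / (m : ℝ)) • ∑ j, (gradient (B.f j) z).fst := by
    rw [hB.gradient_fbar, ← projX_apply, map_smul, map_sum]; rfl
  rw [e]
  refine SecMom.select_client (F := fun j (d : Draws m n S N Zf Zg) =>
    (B.gradF j z (d (.phi k i j))).fst) k 0 i (S' := phis k i) (fun j d d' h => ?_) ?_ fun j => ?_
  · dsimp only; rw [h _ ⟨j, rfl⟩]
  · rintro ⟨j, hj⟩; cases hj
  · have := hB.prob_f j
    have h1 : MeanVar (B.Df j) (fun ζ => (B.gradF j z ζ).fst) (gradient (B.f j) z).fst (c.sf ^ 2) :=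
      (hB.oracle_gradF j z).meanVar.clm (projX X Y) norm_projX_le
    have h2 : MeanVar (drawsLaw n S N B)
        (fun d => (B.gradF j z (d (.phi k i j))).fst) (gradient (B.f j) z).fst (c.sf ^ 2) :=
      MeanVar.eval_source (Source.phi k i j) h1
    refine h2.secMom.mono (add_le_add le_rfl (pow_le_pow_left₀ (norm_nonneg _) ?_ 2))
    exact (norm_fst_le _).trans ((hB.upperRegular hc j).norm_grad_le z)

/-- For each single client the mean matrix contracts and the oracle adds (σ_{g,2}/ℓ_{g,1})²‖v‖².
Second moments, unlike variances, are merely averaged by the choice of the client, so differences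
between the clients' Hessians cost nothing. -/
theorem secMom_sampleOp (k : ℕ) (z : Pt X Y) (i : Fin n) (l : ℕ) (v : Y) :
    SecMom (drawsLaw n S N B) (fun d => sampleOp B c.lg1 d k z i l v)
      (neumannOp B.gbar c.lg1 z v) (c.rho * ‖v‖ ^ 2) := by
  have hm : (m : ℝ) ≠ 0 := by exact_mod_cast NeZero.ne m
  have e : neumannOp B.gbar c.lg1 z v = (1 / (m : ℝ)) •
      ∑ j, (v - (1 / c.lg1) • evalYY X v (hessian (B.g j) z)) := by
    have h1 : opYY (hessian B.gbar z) v = (1 / (m : ℝ)) • ∑ j, evalYY X v (hessian (B.g j) z) := by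
      rw [← evalYY_apply, hB.hessian_gbar, map_smul, map_sum]
    rw [neumannOp, _root_.sub_apply, _root_.smul_apply, h1, Finset.sum_sub_distrib,
      ← Finset.smul_sum, smul_sub, smul_comm (1 / c.lg1)]
    congr 1
    rw [one_apply_eq_self, Finset.sum_const, Finset.card_univ, Fintype.card_fin,
      ← Nat.cast_smul_eq_nsmul ℝ, smul_smul, one_div_mul_cancel hm, one_smul]
  rw [e]
  refine SecMom.select_client (F := fun j (d : Draws m n S N Zf Zg) =>
    v - (1 / c.lg1) • evalYY X v (B.hessG j z (d (.zeta k i l j)))) k l i (S' := zetas k i l)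
    (fun j d d' h => ?_) ?_ fun j => ?_
  · dsimp only; rw [h _ ⟨j, rfl⟩]
  · rintro ⟨j, hj⟩; cases hj
  · have := hB.prob_g j
    -- The oracle is evaluated at `v` first: variances add up in the Hilbert space `Y`, not in the
    -- spectral norm.
    have h1 := ((hB.oracle_hessG j z).meanVar_clm (evalYY X v) (b := ‖v‖) fun H => by
      rw [evalYY_apply, mul_comm]; exact norm_opYY_apply_le H v)
    have h2 : MeanVar (drawsLaw n S N B)
        (fun d => evalYY X v (B.hessG j z (d (.zeta k i l j)))) _ _ :=
      MeanVar.eval_source (Source.zeta k i l j) h1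
    refine ((h2.smul (1 / c.lg1)).const_sub v).secMom.mono ?_
    have h3 := (hB.lowerRegular j).norm_neumannOp_le hc.lg1_pos z v
    have h4 : v - (1 / c.lg1) • evalYY X v (hessian (B.g j) z) = neumannOp (B.g j) c.lg1 z v := rfl
    have h5 : max 0 (1 - c.mu / c.lg1) ^ 2 ≤ (1 - c.mu / c.lg1) ^ 2 := by
      rcases max_choice 0 (1 - c.mu / c.lg1) with h | h <;> rw [h]
      rw [zero_pow two_ne_zero]; positivity
    rw [h4, Consts.rho]
    have h6 := pow_le_pow_left₀ (norm_nonneg _) h3 2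
    rw [mul_pow] at h6
    have h7 := mul_le_mul_of_nonneg_right h5 (sq_nonneg ‖v‖)
    have h8 : (1 / c.lg1) ^ 2 * (‖v‖ ^ 2 * c.sg2 ^ 2) = (c.sg2 / c.lg1) ^ 2 * ‖v‖ ^ 2 := by ring
    rw [h8]
    linarith

theorem secMom_neumannVec (k : ℕ) (z : Pt X Y) (i : Fin n) (l : ℕ) :
    SecMom (drawsLaw n S N B) (fun d => neumannVec B c.lg1 d k z i l)
      ((neumannOp B.gbar c.lg1 z ^ l) (gradient B.fbar z).snd) (c.rho ^ l * c.gradSq) := by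
  induction l with
  | zero => simpa [neumannVec] using secMom_gradF_theta hB hc k z i
  | succ l ih =>
    have hpair : ∀ z : Pt X Y, Measurable fun d : Draws m n S N Zf Zg => (z, d) := fun z =>
      measurable_const.prodMk measurable_id
    have := SecMom.apply_fresh ((measurable_neumannVec hB c.lg1 k i l).comp (hpair z))
      (dependsOn_neumannVec B c.lg1 k z i l)
      ((measurable_sampleOp hB c.lg1 k i (l + 1)).comp (hpair z))
      (dependsOn_sampleOp B c.lg1 k z i (l + 1)) (by
        rw [Set.disjoint_left]
        rintro s (⟨l', hl', rfl | ⟨j, rfl⟩⟩ | ⟨j, rfl⟩) ⟨l'', rfl, h | ⟨_, h⟩⟩ <;> cases h <;>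
        simp at hl') c.rho_nonneg (secMom_sampleOp hB hc k z i (l + 1)) ih
    rw [pow_succ', pow_succ', mul_assoc]
    exact this

theorem secMom_hessG_omega (k : ℕ) (z : Pt X Y) (i : Fin n) (l : ℕ) (v : Y) :
    SecMom (drawsLaw n S N B)
      (fun d => opXY (B.hessG (d.client k l i) z (d (.omega k i (d.client k l i)))) v)
      (opXY (hessian B.gbar z) v) ((c.sg2 ^ 2 + c.lg1 ^ 2) * ‖v‖ ^ 2) := by
  have e : opXY (hessian B.gbar z) v = (1 / (m : ℝ)) • ∑ j, evalXY v (hessian (B.g j) z) := by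
    rw [← evalXY_apply, hB.hessian_gbar, map_smul, map_sum]
  rw [e]
  refine SecMom.select_client (F := fun j (d : Draws m n S N Zf Zg) =>
    evalXY v (B.hessG j z (d (.omega k i j)))) k l i (S' := omegas k i)
    (fun j d d' h => ?_) ?_ fun j => ?_
  · dsimp only; rw [h _ ⟨j, rfl⟩]
  · rintro ⟨j, hj⟩; cases hj
  · have := hB.prob_g j
    have h1 := ((hB.oracle_hessG j z).meanVar_clm (evalXY (X := X) v) (b := ‖v‖) fun H => by
      rw [evalXY_apply, mul_comm]; exact norm_opXY_apply_le H v)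
    have h2 : MeanVar (drawsLaw n S N B)
        (fun d => evalXY v (B.hessG j z (d (.omega k i j)))) _ _ :=
      MeanVar.eval_source (Source.omega k i j) h1
    refine h2.secMom.mono ?_
    have h3 := pow_le_pow_left₀ (norm_nonneg _)
      ((hB.lowerRegular j).norm_opXY_le hc.lg1_pos.le z v) 2
    rw [mul_pow] at h3
    rw [evalXY_apply]
    linarith

/-- By `j ≤ l` the client of the cross block, at level l + 1, is fresh relative to the product,
which uses levels up to j only. -/
theorem secMom_pheAt (k : ℕ) (z : Pt X Y) (i : Fin n) {j l : ℕ} (hjl : j ≤ l) :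
    SecMom (drawsLaw n S N B) (fun d => pheAt B c.lg1 d k z i j l)
      ((gradient B.fbar z).fst - opXY (hessian B.gbar z) (((N : ℝ) / c.lg1) •
        (neumannOp B.gbar c.lg1 z ^ j) (gradient B.fbar z).snd)) (c.pheSq N j) := by
  have hpair : Measurable fun d : Draws m n S N Zf Zg => (z, d) :=
    measurable_const.prodMk measurable_id
  refine (secMom_gradF_phi hB hc k z i).sub ?_
  refine SecMom.apply_fresh (S := levels k i (· ≤ j) ∪ thetas k i)
    (S' := {Source.client k (l + 1) i} ∪ omegas k i)
    (((measurable_neumannVec hB c.lg1 k i j).comp hpair).const_smul _) ?_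
    (continuous_opXY.measurable.comp ((measurable_hessG_omega hB k (l + 1) i).comp hpair))
    ?_ ?_ (by positivity) (secMom_hessG_omega hB hc k z i (l + 1))
    ((secMom_neumannVec hB hc k z i j).smul _)
  · intro (d : Draws m n S N Zf Zg) d' h
    have := dependsOn_neumannVec B c.lg1 k z i j h
    exact congrArg (((N : ℝ) / c.lg1) • ·) this
  · intro (d : Draws m n S N Zf Zg) (d' : Draws m n S N Zf Zg) h
    have h1 : d.client k (l + 1) i = d'.client k (l + 1) i :=
      dependsOn_client k (l + 1) i fun s hs => h s (.inl hs)
    have h2 : d (.omega k i (d.client k (l + 1) i)) = d' (.omega k i (d'.client k (l + 1) i)) := by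
      rw [h1]; exact h _ (.inr ⟨_, rfl⟩)
    simp only [Function.comp_apply, h2, h1]
  · rw [Set.disjoint_left]
    rintro s (⟨l', hl', rfl | ⟨_, rfl⟩⟩ | ⟨_, rfl⟩) (h | ⟨_, h⟩) <;> cases h
    omega

/-- The averaged hypergradient estimator: its mean is the truncated hypergradient, and its variance
is inversely proportional to the number of slots. -/
theorem meanVar_average_phe [NeZero N] [NeZero n] (k : ℕ) (z : Pt X Y) :
    MeanVar (drawsLaw n S N B) (fun d => (1 / (n : ℝ)) • ∑ i, phe B c.lg1 d k z i)
      (truncHyperGrad B.fbar B.gbar c.lg1 N z)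
      (4 * c.gradSq * (1 + (c.sg2 ^ 2 + c.lg1 ^ 2) / c.lg1 ^ 2) * c.neumannFactor N / n) := by
  have hn : (n : ℝ) ≠ 0 := by exact_mod_cast NeZero.ne n
  have hN : (N : ℝ) ≠ 0 := by exact_mod_cast NeZero.ne N
  set w := (gradient B.fbar z).snd
  -- `h j` is the conditional mean of a slot with truncation level j. Averaging over j < N cancels
  -- the factor N and gives the truncated Neumann series.
  set h : ℕ → X := fun j => (gradient B.fbar z).fst - opXY (hessian B.gbar z) (((N : ℝ) / c.lg1) •
        (neumannOp B.gbar c.lg1 z ^ j) w) with hh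
  set b := truncHyperGrad B.fbar B.gbar c.lg1 N z
  set s : ℝ := (1 / (N : ℝ)) * ∑ j : Fin N, c.pheSq N j with hs
  have hmean : (1 / (N : ℝ)) • ∑ j : Fin N, h j = b := by
    rw [Fin.sum_univ_eq_sum_range h N]
    simp only [hh, Finset.sum_sub_distrib, ← map_sum, ← Finset.smul_sum, smul_sub]
    rw [← map_smul, smul_smul, Finset.sum_const, Finset.card_range, ← Nat.cast_smul_eq_nsmul ℝ,
      smul_smul, one_div_mul_cancel hN, one_smul, one_div_mul_eq_div, div_div_cancel_left' hN,
      ← one_div]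
    rfl
  -- Jensen's inequality; any slot serves, and slot 0 exists.
  have hsq : ∀ j : ℕ, ‖h j‖ ^ 2 ≤ c.pheSq N j := fun j =>
    (secMom_pheAt (n := n) (S := S) (N := N) hB hc k z ⟨0, Nat.pos_of_neZero n⟩ le_rfl).norm_sq_le
  have hone : ∀ i : Fin n, MeanVar (drawsLaw n S N B)
      (fun d => h (d (.trunc k i)).down) b s := fun i => by
    have hmem : MemLp (fun d : Draws m n S N Zf Zg => h (d (.trunc k i)).down) 2
        (drawsLaw n S N B) :=
      memLp_select (X := fun (j : Fin N) _ => h j) (measurable_trunc k i) fun j => memLp_const _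
    refine .of_sq_norm_le hmem ?_ ?_
    · exact (integral_trunc k i (fun j : Fin N => h j)).trans hmean
    · rw [integral_trunc k i (fun j : Fin N => ‖h j‖ ^ 2), hs, smul_eq_mul]
      gcongr with j
      exact hsq j
  have hpheSq_int : ∀ i : Fin n, ∫ d, c.pheSq N (d (.trunc k i)).down ∂drawsLaw n S N B = s :=
    fun i => integral_trunc k i (fun j : Fin N => c.pheSq N j)
  have hav : MeanVar (drawsLaw n S N B)
      (fun d => (1 / (n : ℝ)) • ∑ i : Fin n, h (d (.trunc k i)).down) b (s / n) := by
    have := (MeanVar.sum (S := fun i => {Source.trunc k i}) (fun i d d' hd => by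
      rw [hd _ rfl]) (fun i j hij => by simpa using hij) hone).smul (1 / (n : ℝ))
    have e1 : (1 / (n : ℝ)) • ∑ _i : Fin n, b = b := by
      rw [Finset.sum_const, Finset.card_univ, Fintype.card_fin, ← Nat.cast_smul_eq_nsmul ℝ,
        smul_smul, one_div_mul_cancel hn, one_smul]
    have e2 : (1 / (n : ℝ)) ^ 2 * ∑ _i : Fin n, s = s / n := by
      rw [Finset.sum_const, Finset.card_univ, Fintype.card_fin, nsmul_eq_mul]; field_simp
    rwa [e1, e2] at this
  let W : Draws m n S N Zf Zg → (Fin n → Fin N) := fun d i => (d (.trunc k i)).down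
  have hW : Measurable W := measurable_pi_lambda _ fun i => measurable_trunc k i
  have hWS : DependsOn W (truncs k) := fun d d' hd => by
    funext i; dsimp only [W]; rw [hd _ ⟨i, rfl⟩]
  -- The maximum L couples the slots, so all truncation levels are fixed simultaneously; given them,
  -- the slots are independent.
  have hsel := MeanVar.select (S := truncs k) (S' := ⋃ i, slots k i) hW hWS
    (X := fun (τ : Fin n → Fin N) (d : Draws m n S N Zf Zg) => (1 / (n : ℝ)) • ∑ i,
      pheAt B c.lg1 d k z i (τ i) (Finset.univ.sup fun i => (τ i : ℕ)))
    (a := fun τ => (1 / (n : ℝ)) • ∑ i, h (τ i))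
    (v := fun τ => (1 / (n : ℝ)) ^ 2 * ∑ i, c.pheSq N (τ i)) (fun τ d d' hd => by
      dsimp only
      congr 1
      exact Finset.sum_congr rfl fun i _ => dependsOn_pheAt B c.lg1 k z i _ _ fun s hs =>
        hd s (Set.mem_iUnion.2 ⟨i, hs⟩)) (by
      rw [Set.disjoint_left]
      rintro s ⟨i, rfl⟩ hs
      obtain ⟨j, ((⟨_, _, h | ⟨_, h⟩⟩ | ⟨_, h⟩) | ⟨_, h⟩) | ⟨_, h⟩⟩ := Set.mem_iUnion.1 hs <;> cases h)
    (fun τ => (MeanVar.sum (S := fun i => slots k i) (fun i => dependsOn_pheAt B c.lg1 k z i _ _)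
      (fun i j hij => by
        refine Set.disjoint_left.2 ?_
        rintro s (((⟨_, _, rfl | ⟨_, rfl⟩⟩ | ⟨_, rfl⟩) | ⟨_, rfl⟩) | ⟨_, rfl⟩)
          (((⟨_, _, h | ⟨_, h⟩⟩ | ⟨_, h⟩) | ⟨_, h⟩) | ⟨_, h⟩) <;> cases h <;> exact hij rfl)
      fun i => (secMom_pheAt hB hc k z i
        (Finset.le_sup (f := fun i => (τ i : ℕ)) (Finset.mem_univ i))).meanVar).smul (1 / (n : ℝ)))
    hav
  have hfun : (fun d : Draws m n S N Zf Zg => (1 / (n : ℝ)) • ∑ i, phe B c.lg1 d k z i)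
      = fun d => (1 / (n : ℝ)) • ∑ i,
      pheAt B c.lg1 d k z i (W d i) (Finset.univ.sup fun i => (W d i : ℕ)) := by
    funext d
    simp only [phe_eq]
    rfl
  rw [hfun]
  refine hsel.mono ?_
  have hint : ∀ i : Fin n, Integrable (fun d : Draws m n S N Zf Zg => c.pheSq N (W d i))
      (drawsLaw n S N B) := fun i =>
    (memLp_select (X := fun (j : Fin N) _ => c.pheSq N j) (measurable_trunc k i)
      fun j => memLp_const _).integrable (q := 2) (by norm_num)
  rw [integral_const_mul, integral_finsetSum _ fun i _ => hint i]
  rw [Finset.sum_congr rfl fun i _ => hpheSq_int i, Finset.sum_const, Finset.card_univ,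
    Fintype.card_fin, nsmul_eq_mul]
  have hsum : ∑ j : Fin N, c.pheSq N j = N * (2 * c.gradSq) + 2 * ((c.sg2 ^ 2 + c.lg1 ^ 2) *
      (((N : ℝ) / c.lg1) ^ 2 * ((∑ j ∈ Finset.range N, c.rho ^ j) * c.gradSq))) := by
    rw [Fin.sum_univ_eq_sum_range (fun j => c.pheSq N j) N]
    simp only [Consts.pheSq, Finset.sum_add_distrib, ← Finset.mul_sum, Finset.sum_mul,
      Finset.sum_const, Finset.card_range, nsmul_eq_mul]
    ring
  have hg := c.gradSq_nonneg
  have hlg := hc.lg1_pos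
  have hR : 0 ≤ ∑ j ∈ Finset.range N, c.rho ^ j :=
    Finset.sum_nonneg fun j _ => pow_nonneg c.rho_nonneg j
  have hNf : c.neumannFactor N = 1 + N * ∑ j ∈ Finset.range N, c.rho ^ j := rfl
  -- Averaging N²ρ^j over j < N leaves one factor N: this is the N∑ρ^j of ν_N.
  have hs' : s = 2 * c.gradSq * (1 + (c.sg2 ^ 2 + c.lg1 ^ 2) / c.lg1 ^ 2 *
      (N * ∑ j ∈ Finset.range N, c.rho ^ j)) := by
    rw [hs, hsum]; field_simp
  have hle : 1 + (c.sg2 ^ 2 + c.lg1 ^ 2) / c.lg1 ^ 2 * (N * ∑ j ∈ Finset.range N, c.rho ^ j)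
      ≤ (1 + (c.sg2 ^ 2 + c.lg1 ^ 2) / c.lg1 ^ 2) * c.neumannFactor N := by
    rw [hNf]
    have h1 : 0 ≤ (c.sg2 ^ 2 + c.lg1 ^ 2) / c.lg1 ^ 2 := by positivity
    have h2 : 0 ≤ N * ∑ j ∈ Finset.range N, c.rho ^ j := by positivity
    nlinarith
  -- One s/n bounds the fluctuation given the levels, the other the fluctuation of the levels.
  calc (1 / (n : ℝ)) ^ 2 * (n * s) + s / n = 2 * s / n := by field_simp; ring
    _ ≤ _ := by
      rw [hs']
      refine div_le_div_of_nonneg_right ?_ (by positivity)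
      nlinarith [mul_le_mul_of_nonneg_left hle hg]

end HyperMoments

end FedMBO

namespace FedMBO

/-! ### Sampling without replacement -/

section WithoutReplacement

variable {κ : Type*} [Fintype κ] [DecidableEq κ] {E : Type*} [NormedAddCommGroup E]
  [InnerProductSpace ℝ E] {v : κ → E} (hv : ∑ a, v a = 0)

include hv

theorem sum_perm_apply_eq_zero (a : κ) : ∑ σ : Equiv.Perm κ, v (σ a) = 0 := by
  have h : ∀ b, ∑ σ : Equiv.Perm κ, v (σ b) = ∑ σ : Equiv.Perm κ, v (σ a) := fun b =>
    Fintype.sum_equiv (Equiv.mulRight (Equiv.swap a b)) _ _ fun σ => by simp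
  have h1 : ∑ b, ∑ σ : Equiv.Perm κ, v (σ b) = 0 := by
    rw [Finset.sum_comm]
    exact Finset.sum_eq_zero fun σ _ => by rw [Equiv.sum_comp σ v, hv]
  simp_rw [h] at h1
  rw [Finset.sum_const, Finset.card_univ, ← Nat.cast_smul_eq_nsmul ℝ] at h1
  have : Nonempty κ := ⟨a⟩
  exact (smul_eq_zero.1 h1).resolve_left (by exact_mod_cast Fintype.card_ne_zero)

/-- Summed over all positions b the expression vanishes, as ∑ v = 0. The term b = a is nonnegative
and the others are equal by symmetry, so each of them is nonpositive. -/
theorem sum_perm_inner_nonpos {a b : κ} (hab : a ≠ b) :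
    ∑ σ : Equiv.Perm κ, inner ℝ (v (σ a)) (v (σ b)) ≤ 0 := by
  have h : ∀ b' ∈ Finset.univ.erase a, ∑ σ : Equiv.Perm κ, inner ℝ (v (σ a)) (v (σ b'))
      = ∑ σ : Equiv.Perm κ, inner ℝ (v (σ a)) (v (σ b)) := fun b' hb' => by
    refine Fintype.sum_equiv (Equiv.mulRight (Equiv.swap b b')) _ _ fun σ => ?_
    simp [Equiv.swap_apply_of_ne_of_ne hab (Finset.ne_of_mem_erase hb').symm]
  have h1 : ∑ b', ∑ σ : Equiv.Perm κ, inner ℝ (v (σ a)) (v (σ b')) = 0 := by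
    rw [Finset.sum_comm]
    exact Finset.sum_eq_zero fun σ _ => by
      rw [← inner_sum, Equiv.sum_comp σ v, hv, inner_zero_right]
  rw [← Finset.add_sum_erase _ _ (Finset.mem_univ a), Finset.sum_congr rfl h, Finset.sum_const,
    nsmul_eq_mul] at h1
  have h2 : 0 ≤ ∑ σ : Equiv.Perm κ, inner ℝ (v (σ a)) (v (σ a)) :=
    Finset.sum_nonneg fun σ _ => real_inner_self_nonneg
  have h3 : (0 : ℝ) < (Finset.univ.erase a).card := by
    exact_mod_cast Finset.card_pos.2 ⟨b, Finset.mem_erase.2 ⟨hab.symm, Finset.mem_univ b⟩⟩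
  by_contra! hneg
  nlinarith [mul_pos h3 hneg]

variable {ι : Type*} [Fintype ι] [DecidableEq ι]

/-- Composition with a permutation of `κ` permutes the embeddings, so the sum may be averaged over
permutations, where `sum_perm_apply_eq_zero` applies for each embedding. -/
theorem sum_embedding_apply_eq_zero (i : ι) : ∑ e : ι ↪ κ, v (e i) = 0 := by
  have h : ∀ σ : Equiv.Perm κ, ∑ e : ι ↪ κ, v (σ (e i)) = ∑ e : ι ↪ κ, v (e i) := fun σ =>
    Fintype.sum_equiv (Equiv.embeddingCongr (Equiv.refl ι) σ) _ _ fun e => by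
      simp [Equiv.embeddingCongr]
  have h1 : ∑ σ : Equiv.Perm κ, ∑ e : ι ↪ κ, v (σ (e i)) = 0 := by
    rw [Finset.sum_comm]
    exact Finset.sum_eq_zero fun e _ => sum_perm_apply_eq_zero hv (e i)
  simp_rw [h] at h1
  rw [Finset.sum_const, Finset.card_univ, ← Nat.cast_smul_eq_nsmul ℝ] at h1
  exact (smul_eq_zero.1 h1).resolve_left (by exact_mod_cast Fintype.card_ne_zero)

theorem sum_embedding_inner_nonpos {i j : ι} (hij : i ≠ j) :
    ∑ e : ι ↪ κ, inner ℝ (v (e i)) (v (e j)) ≤ 0 := by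
  have h : ∀ σ : Equiv.Perm κ, ∑ e : ι ↪ κ, inner ℝ (v (σ (e i))) (v (σ (e j)))
      = ∑ e : ι ↪ κ, inner ℝ (v (e i)) (v (e j)) := fun σ =>
    Fintype.sum_equiv (Equiv.embeddingCongr (Equiv.refl ι) σ) _ _ fun e => by
      simp [Equiv.embeddingCongr]
  have h1 : ∑ σ : Equiv.Perm κ, ∑ e : ι ↪ κ, inner ℝ (v (σ (e i))) (v (σ (e j))) ≤ 0 := by
    rw [Finset.sum_comm]
    exact Finset.sum_nonpos fun e _ =>
      sum_perm_inner_nonpos hv fun h => hij (e.injective h)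
  simp_rw [h] at h1
  rw [Finset.sum_const, Finset.card_univ, nsmul_eq_mul] at h1
  have hc : (0 : ℝ) < Fintype.card (Equiv.Perm κ) := by exact_mod_cast Fintype.card_pos
  by_contra! hneg
  nlinarith [mul_pos hc hneg]

/-- Second moment of a sample sum drawn without replacement from a centered population. -/
theorem sum_embedding_norm_sq_le {s : ℝ} (hs : ∀ a, ‖v a‖ ^ 2 ≤ s) :
    ∑ e : ι ↪ κ, ‖∑ i, v (e i)‖ ^ 2 ≤ Fintype.card (ι ↪ κ) * (Fintype.card ι * s) := by
  have e1 : ∀ e : ι ↪ κ, ‖∑ i, v (e i)‖ ^ 2 = ∑ i, ∑ j, inner ℝ (v (e i)) (v (e j)) := fun e => by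
    rw [← real_inner_self_eq_norm_sq, sum_inner]
    simp_rw [inner_sum]
  simp_rw [e1]
  rw [Finset.sum_comm]
  have h : ∀ i : ι, ∑ e : ι ↪ κ, ∑ j, inner ℝ (v (e i)) (v (e j)) ≤ Fintype.card (ι ↪ κ) * s := by
    intro i
    rw [Finset.sum_comm, ← Finset.add_sum_erase _ _ (Finset.mem_univ i)]
    -- Dropping the nonpositive cross terms leaves the bound valid for independent draws.
    have h1 : ∑ j ∈ Finset.univ.erase i, ∑ e : ι ↪ κ, inner ℝ (v (e i)) (v (e j)) ≤ 0 :=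
      Finset.sum_nonpos fun j hj => sum_embedding_inner_nonpos hv (Finset.ne_of_mem_erase hj).symm
    have h2 : ∑ e : ι ↪ κ, inner ℝ (v (e i)) (v (e i)) ≤ ∑ _e : ι ↪ κ, s :=
      Finset.sum_le_sum fun e _ => by rw [real_inner_self_eq_norm_sq]; exact hs _
    rw [Finset.sum_const, Finset.card_univ, nsmul_eq_mul] at h2
    linarith
  refine (Finset.sum_le_sum fun i _ => h i).trans_eq ?_
  rw [Finset.sum_const, Finset.card_univ, nsmul_eq_mul]
  ring

end WithoutReplacement

/-! ### Mean and variance of the inner gradient -/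

section Inner

variable {m n S N : ℕ} {X Y : Type*} [NormedAddCommGroup X] [InnerProductSpace ℝ X]
  [FiniteDimensional ℝ X] [NormedAddCommGroup Y] [InnerProductSpace ℝ Y] [FiniteDimensional ℝ Y]
  [MeasurableSpace X] [BorelSpace X] [MeasurableSpace Y] [BorelSpace Y]
  {Zf Zg : Type u} [MeasurableSpace Zf] [MeasurableSpace Zg] {B : Problem m X Y Zf Zg} {c : Consts}

/-- The random choices of inner step `t` of round `k`. -/
def innerSources (k t : ℕ) : Set (Source m n S) :=
  {.innerClients k t} ∪ {s | ∃ i j c, s = .innerData k t i j c}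

theorem dependsOn_innerGrad (B : Problem m X Y Zf Zg) (k t : ℕ) (x : X) (y : Y) :
    DependsOn (fun d : Draws m n S N Zf Zg => innerGrad B d k t x y) (innerSources k t) :=
  fun (d d' : Draws m n S N Zf Zg) h => by
  have h1 : ∀ i, d.innerClient k t i = d'.innerClient k t i := fun i => by
    rw [Draws.innerClient, Draws.innerClient, h _ (.inl rfl)]
  have h2 : ∀ i j, d.xi k t i j = d'.xi k t i j := fun i j => by
    rw [Draws.xi, Draws.xi, h1]; exact h _ (.inr ⟨_, _, _, rfl⟩)
  simp only [innerGrad, h1, h2]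

theorem measurable_innerGrad (hB : B.Assumptions c) (k t : ℕ) :
    Measurable fun p : (X × Y) × Draws m n S N Zf Zg => innerGrad B p.2 k t p.1.1 p.1.2 := by
  unfold innerGrad
  refine Measurable.const_smul (Finset.measurable_fun_sum _ fun i _ => Measurable.const_smul
    (Finset.measurable_fun_sum _ fun j _ => ?_) _) _
  have hcl : Measurable fun p : (X × Y) × Draws m n S N Zf Zg => p.2.innerClient k t i :=
    (show Measurable[⊤] (fun v : ULift.{u} (Fin n ↪ Fin m) => v.down i) from
      fun _ _ => trivial).comp
    ((measurable_pi_apply (Source.innerClients k t : Source m n S)).comp measurable_snd)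
  exact (projY X Y).continuous.measurable.comp
    (measurable_select (F := fun a (p : (X × Y) × Draws m n S N Zf Zg) =>
      B.gradG a (pt p.1.1 p.1.2) (p.2 (.innerData k t i j a))) hcl fun a =>
      (hB.meas_gradG a).comp ((measurable_pt.comp measurable_fst).prodMk
      ((measurable_pi_apply (Source.innerData k t i j a : Source m n S)).comp measurable_snd)))

variable [NeZero m] [∀ s : Source m n S, IsProbabilityMeasure (s.law B N)]

/-- Given the clients, the batches are independent and contribute σ_{g,1}²/n (the gain 1/S is
discarded); the draw of the clients contributes σ_g²/n. -/
theorem meanVar_innerGrad [NeZero n] [NeZero S] [Nonempty (Fin n ↪ Fin m)] (hB : B.Assumptions c)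
    (k t : ℕ) (x : X) (y : Y) :
    MeanVar (drawsLaw n S N B) (fun d => innerGrad B d k t x y) (gradient B.gbar (pt x y)).snd
      ((c.sg1 ^ 2 + c.sg ^ 2) / n) := by
  have hn : (n : ℝ) ≠ 0 := by exact_mod_cast NeZero.ne n
  have hm : (m : ℝ) ≠ 0 := by exact_mod_cast NeZero.ne m
  have hS : (S : ℝ) ≠ 0 := by exact_mod_cast NeZero.ne S
  have hS1 : (1 : ℝ) ≤ S := by exact_mod_cast Nat.pos_of_neZero S
  set z := pt x y
  set b := (gradient B.gbar z).snd with hb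
  let u : Fin m → Y := fun a => (gradient (B.g a) z).snd - b
  have hu : ∑ a, u a = 0 := by
    have : b = (1 / (m : ℝ)) • ∑ j, (gradient (B.g j) z).snd := by
      rw [hb, hB.gradient_gbar, ← projY_apply, map_smul, map_sum]; rfl
    simp only [u, Finset.sum_sub_distrib, Finset.sum_const, Finset.card_univ, Fintype.card_fin]
    rw [this, ← Nat.cast_smul_eq_nsmul ℝ, smul_smul, mul_one_div_cancel hm, one_smul, sub_self]
  have hus : ∀ a, ‖u a‖ ^ 2 ≤ c.sg ^ 2 := fun a =>
    (pow_le_pow_left₀ (norm_nonneg _) (norm_snd_le (gradient (B.g a) z - gradient B.gbar z)) 2).trans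
      (hB.heterogeneity a z)
  let _ : MeasurableSpace (Fin n ↪ Fin m) := ⊤
  let W : Draws m n S N Zf Zg → (Fin n ↪ Fin m) := fun d => (d (.innerClients k t)).down
  have hW : Measurable W :=
    (show Measurable[⊤] (fun v : ULift.{u} (Fin n ↪ Fin m) => v.down) from
      fun _ _ => trivial).comp (measurable_pi_apply (Source.innerClients k t : Source m n S))
  have hWS : DependsOn W {Source.innerClients k t} := fun d d' h => by
    dsimp only [W]; rw [h _ rfl]
  let a : (Fin n ↪ Fin m) → Y := fun e => (1 / (n : ℝ)) • ∑ i, (gradient (B.g (e i)) z).snd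
  have hau : ∀ e, a e - b = (1 / (n : ℝ)) • ∑ i, u (e i) := fun e => by
    simp only [a, u, Finset.sum_sub_distrib, Finset.sum_const, Finset.card_univ, Fintype.card_fin]
    rw [smul_sub, ← Nat.cast_smul_eq_nsmul ℝ, smul_smul, one_div_mul_cancel hn, one_smul]
  have hcard : (Fintype.card (Fin n ↪ Fin m) : ℝ) ≠ 0 := by
    exact_mod_cast Fintype.card_ne_zero
  have ha : MeanVar (drawsLaw n S N B) (fun d => a (W d)) b (c.sg ^ 2 / n) := by
    refine ⟨memLp_select (X := fun e _ => a e) hW fun e => memLp_const _, ?_, ?_⟩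
    · refine (integral_innerClients k t a).trans ?_
      have : ∑ e, a e = ∑ e : Fin n ↪ Fin m, (b + (1 / (n : ℝ)) • ∑ i, u (e i)) :=
        Finset.sum_congr rfl fun e _ => by rw [← hau]; abel
      rw [this, Finset.sum_add_distrib, ← Finset.smul_sum, Finset.sum_comm,
        Finset.sum_eq_zero fun i _ => sum_embedding_apply_eq_zero hu i, smul_zero, add_zero,
        Finset.sum_const, Finset.card_univ, ← Nat.cast_smul_eq_nsmul ℝ, smul_smul,
        one_div_mul_cancel hcard, one_smul]
    · refine (integral_innerClients k t fun e => ‖a e - b‖ ^ 2).trans_le ?_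
      simp_rw [hau, norm_smul, mul_pow, ← Finset.mul_sum]
      have := sum_embedding_norm_sq_le (ι := Fin n) hu hus
      rw [Fintype.card_fin] at this
      rw [smul_eq_mul, Real.norm_eq_abs, sq_abs]
      calc _ ≤ 1 / (Fintype.card (Fin n ↪ Fin m) : ℝ) * ((1 / n) ^ 2 *
            (Fintype.card (Fin n ↪ Fin m) * (n * c.sg ^ 2))) := by gcongr
        _ = _ := by field_simp
  have hdata : ∀ (e : Fin n ↪ Fin m) (i : Fin n) (j : Fin S), MeanVar (drawsLaw n S N B)
      (fun d => (B.gradG (e i) z (d (.innerData k t i j (e i)))).snd)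
      (gradient (B.g (e i)) z).snd (c.sg1 ^ 2) := fun e i j => by
    have := hB.prob_g (e i)
    have h1 : MeanVar (B.Dg (e i)) (fun ζ => (B.gradG (e i) z ζ).snd)
        (gradient (B.g (e i)) z).snd (c.sg1 ^ 2) :=
      (hB.oracle_gradG (e i) z).meanVar.clm (projY X Y) norm_projY_le
    exact MeanVar.eval_source (Source.innerData k t i j (e i)) h1
  have hbatch : ∀ (e : Fin n ↪ Fin m) (i : Fin n), MeanVar (drawsLaw n S N B)
      (fun d => (1 / (S : ℝ)) • ∑ j : Fin S,
        (B.gradG (e i) z (d (.innerData k t i j (e i)))).snd)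
      (gradient (B.g (e i)) z).snd (c.sg1 ^ 2) := fun e i => by
    have := (MeanVar.sum (S := fun j => {Source.innerData k t i j (e i)}) (fun j d d' hd => by
      rw [hd _ rfl]) (fun j j' hj => by simpa using hj) (hdata e i)).smul (1 / (S : ℝ))
    rw [Finset.sum_const, Finset.card_univ, Fintype.card_fin, ← Nat.cast_smul_eq_nsmul ℝ,
        smul_smul, one_div_mul_cancel hS, one_smul] at this
    refine this.mono ?_
    rw [Finset.sum_const, Finset.card_univ, Fintype.card_fin, nsmul_eq_mul]
    calc (1 / (S : ℝ)) ^ 2 * (S * c.sg1 ^ 2) = c.sg1 ^ 2 / S := by field_simp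
      _ ≤ c.sg1 ^ 2 := div_le_self (sq_nonneg _) hS1
  have hX : ∀ e : Fin n ↪ Fin m, MeanVar (drawsLaw n S N B)
      (fun d => (1 / (n : ℝ)) • ∑ i, (1 / (S : ℝ)) • ∑ j : Fin S,
        (B.gradG (e i) z (d (.innerData k t i j (e i)))).snd) (a e) (c.sg1 ^ 2 / n) := fun e => by
    have := (MeanVar.sum (S := fun i => {s | ∃ j, s = Source.innerData k t i j (e i)})
      (fun i d d' hd => by
        have : ∀ j, d (.innerData k t i j (e i)) = d' (.innerData k t i j (e i)) := fun j =>
          hd _ ⟨j, rfl⟩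
        simp only [this]) (fun i i' hi => by
        refine Set.disjoint_left.2 ?_
        rintro s ⟨_, rfl⟩ ⟨_, h⟩
        cases h; exact hi rfl) (hbatch e)).smul (1 / (n : ℝ))
    refine this.mono (le_of_eq ?_)
    rw [Finset.sum_const, Finset.card_univ, Fintype.card_fin, nsmul_eq_mul]
    field_simp
  have hsel := MeanVar.select (S' := {s | ∃ i j c, s = Source.innerData k t i j c}) hW hWS
    (fun e d d' hd => by
      have : ∀ i j, d (.innerData k t i j (e i)) = d' (.innerData k t i j (e i)) := fun i j =>
        hd _ ⟨i, j, _, rfl⟩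
      simp only [this]) (by
      rw [Set.disjoint_singleton_left]
      rintro ⟨_, _, _, h⟩
      cases h) hX ha
  refine MeanVar.mono (v := _) hsel ?_
  simp [add_div]

end Inner

end FedMBO

namespace FedMBO

/-! ### Descent of the Lyapunov function in one outer step -/

section Descent

variable {X Y : Type*} [NormedAddCommGroup X] [InnerProductSpace ℝ X] [FiniteDimensional ℝ X]
  [NormedAddCommGroup Y] [InnerProductSpace ℝ Y] [FiniteDimensional ℝ Y]

/-- Expansion of the squared distance to a moving target whose motion is approximately linear. -/
theorem norm_sub_target_sq_le {ys : X → Y} {Ly CJ α : ℝ} (hα : 0 ≤ α)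
    (hLip : ∀ x x', ‖ys x' - ys x‖ ≤ Ly * ‖x' - x‖) (x : X) (h : X) {J : X →L[ℝ] Y}
    (hJ : ∀ x', ‖ys x' - ys (x - α • h) - J (x' - (x - α • h))‖
      ≤ CJ * ‖x' - (x - α • h)‖ ^ 2) (y : Y) (H : X) :
    ‖y - ys (x - α • H)‖ ^ 2 ≤ ‖y - ys x‖ ^ 2 + 2 * Ly * α * ‖y - ys x‖ * ‖h‖
      + 2 * α * inner ℝ (y - ys x) (J (H - h)) + 2 * CJ * α ^ 2 * ‖y - ys x‖ * ‖H - h‖ ^ 2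
      + Ly ^ 2 * α ^ 2 * ‖H‖ ^ 2 := by
  set x' := x - α • h with hx'
  set x'' := x - α • H with hx''
  set u := y - ys x with hu
  have e1 : x'' - x' = -(α • (H - h)) := by rw [hx', hx'']; module
  -- The expansion point is the mean step x - αh, not x: the linear term becomes -αJ(H - h),
  -- centered when `h` is the mean of `H`, and the remainder is quadratic in H - h.
  set R := ys x'' - ys x' - J (x'' - x') with hR
  have hRn : ‖R‖ ≤ CJ * (α ^ 2 * ‖H - h‖ ^ 2) := by
    refine (hJ x'').trans_eq ?_
    rw [e1, norm_neg, norm_smul, mul_pow, Real.norm_eq_abs, sq_abs]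
  have e2 : y - ys x'' = u - (ys x'' - ys x) := by rw [hu]; abel
  have e3 : ys x'' - ys x = (ys x' - ys x) - α • J (H - h) + R := by
    rw [hR, e1, map_neg, map_smul]; abel
  have n1 : ‖ys x'' - ys x‖ ^ 2 ≤ Ly ^ 2 * α ^ 2 * ‖H‖ ^ 2 := by
    have := hLip x x''
    rw [hx'', sub_sub_cancel_left, norm_neg, norm_smul, Real.norm_of_nonneg hα, ← hx''] at this
    calc _ ≤ (Ly * (α * ‖H‖)) ^ 2 := pow_le_pow_left₀ (norm_nonneg _) this 2
      _ = _ := by ring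
  have n2 : ‖ys x' - ys x‖ ≤ Ly * (α * ‖h‖) := by
    have := hLip x x'
    rwa [hx', sub_sub_cancel_left, norm_neg, norm_smul, Real.norm_of_nonneg hα, ← hx'] at this
  have i1 : -(‖u‖ * (Ly * (α * ‖h‖))) ≤ inner ℝ u (ys x' - ys x) := by
    have := (abs_le.1 (abs_real_inner_le_norm u (ys x' - ys x))).1
    have := mul_le_mul_of_nonneg_left n2 (norm_nonneg u)
    linarith
  have i2 : -(‖u‖ * (CJ * (α ^ 2 * ‖H - h‖ ^ 2))) ≤ inner ℝ u R := by
    have := (abs_le.1 (abs_real_inner_le_norm u R)).1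
    have := mul_le_mul_of_nonneg_left hRn (norm_nonneg u)
    linarith
  have i3 : inner ℝ u (ys x'' - ys x)
      = inner ℝ u (ys x' - ys x) - α * inner ℝ u (J (H - h)) + inner ℝ u R := by
    rw [e3, inner_add_right, inner_sub_right, real_inner_smul_right]
  rw [e2, norm_sub_sq_real, i3]
  nlinarith

/-- Here u = ‖y - y*(x)‖, gh = ⟪G, h⟫, e = ‖G - h‖, I = E‖H‖², I' = E‖H - h‖²; G and h are norms.
Writing 2gh = G² + h² - e² frees -αh²/2: one half pays Young's inequality for the drift of y*, the
other the terms of order α²h² through `hstep`. The coefficient of αu² is Mf² (bias) + 4Mf² (drift) +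
5Mf² (curvature) = 10Mf², which is A·10 Mf Ly. -/
theorem descent_scalar_le {Mf Ly L CJ α A s I I' gh G h e u b : ℝ} (hα : 0 < α) (hMf : 0 < Mf)
    (hLy : 0 < Ly) (hL : 0 ≤ L) (hCJ : 0 ≤ CJ) (hA : A = Mf / Ly)
    (hstep : α * (2 * L + 4 * Mf * Ly) ≤ 1) (hs : CJ * (α * s) ≤ 5 * Mf * Ly)
    (hs0 : 0 ≤ s) (hu : 0 ≤ u)
    (hI : I ≤ s + h ^ 2) (hI' : I' ≤ s) (he : e ^ 2 = G ^ 2 - 2 * gh + h ^ 2)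
    (heb : e ^ 2 ≤ 2 * Mf ^ 2 * u ^ 2 + 2 * b ^ 2) :
    - α * gh + L / 2 * α ^ 2 * I + A * (u ^ 2 + 2 * Ly * α * u * h
      + 2 * CJ * α ^ 2 * u * I' + Ly ^ 2 * α ^ 2 * I) + α / 2 * G ^ 2
      ≤ A * (1 + 10 * Mf * Ly * α) * u ^ 2 + (α * b ^ 2
        + α ^ 2 * s * (L / 2 + A * Ly ^ 2 + A * CJ)) := by
  have hA0 : 0 < A := by rw [hA]; positivity
  have hALy : A * Ly = Mf := by rw [hA]; field_simp
  have t1 : L / 2 * α ^ 2 * I ≤ L / 2 * α ^ 2 * (s + h ^ 2) :=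
    mul_le_mul_of_nonneg_left hI (by positivity)
  have t2 : A * (Ly ^ 2 * α ^ 2 * I) ≤ A * (Ly ^ 2 * α ^ 2 * (s + h ^ 2)) := by gcongr
  -- 2u ≤ 1 + u² splits the curvature term into pure noise of order α²s and a part absorbed by means
  -- of `hs`.
  have t3 : A * (2 * CJ * α ^ 2 * u * I') ≤ A * (CJ * α ^ 2 * s * (1 + u ^ 2)) := by
    refine mul_le_mul_of_nonneg_left ?_ hA0.le
    have : 2 * CJ * α ^ 2 * u * I' ≤ 2 * CJ * α ^ 2 * u * s :=
      mul_le_mul_of_nonneg_left hI' (by positivity)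
    have h2 : 0 ≤ CJ * α ^ 2 * s * (1 - u) ^ 2 := by positivity
    nlinarith
  have t4 : A * (2 * Ly * α * u * h) ≤ α * (4 * Mf ^ 2 * u ^ 2 + h ^ 2 / 4) := by
    have : A * (2 * Ly * α * u * h) = α * (2 * Mf * u * h) := by rw [← hALy]; ring
    rw [this]
    refine mul_le_mul_of_nonneg_left ?_ hα.le
    nlinarith [sq_nonneg (2 * Mf * u - h / 2)]
  have t5 : - α * gh + α / 2 * G ^ 2 ≤ α * (Mf ^ 2 * u ^ 2 + b ^ 2) - α / 2 * h ^ 2 := by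
    nlinarith [mul_le_mul_of_nonneg_left heb hα.le]
  have t6 : (L / 2 * α ^ 2 + A * (Ly ^ 2 * α ^ 2)) * h ^ 2 ≤ α / 4 * h ^ 2 := by
    refine mul_le_mul_of_nonneg_right ?_ (sq_nonneg h)
    have : A * (Ly ^ 2 * α ^ 2) = Mf * Ly * α ^ 2 := by rw [← hALy]; ring
    rw [this]
    nlinarith [mul_le_mul_of_nonneg_left hstep hα.le]
  have t7 : A * (CJ * α ^ 2 * s * u ^ 2) ≤ A * (5 * Mf * Ly * α) * u ^ 2 := by
    have : CJ * α ^ 2 * s * u ^ 2 ≤ 5 * Mf * Ly * α * u ^ 2 := by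
      calc _ = α * (CJ * (α * s)) * u ^ 2 := by ring
        _ ≤ α * (5 * Mf * Ly) * u ^ 2 := by gcongr
        _ = _ := by ring
    exact (mul_le_mul_of_nonneg_left this hA0.le).trans_eq (by ring)
  have t8 : A * (5 * Mf * Ly * α) * u ^ 2 = 5 * Mf ^ 2 * α * u ^ 2 := by rw [← hALy]; ring
  have t9 : A * (10 * Mf * Ly * α) * u ^ 2 = 10 * Mf ^ 2 * α * u ^ 2 := by rw [← hALy]; ring
  have e1 : A * (u ^ 2 + 2 * Ly * α * u * h + 2 * CJ * α ^ 2 * u * I' + Ly ^ 2 * α ^ 2 * I)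
      = A * u ^ 2 + A * (2 * Ly * α * u * h) + A * (2 * CJ * α ^ 2 * u * I')
        + A * (Ly ^ 2 * α ^ 2 * I) := by ring
  have e2 : A * (CJ * α ^ 2 * s * (1 + u ^ 2))
      = α ^ 2 * s * (A * CJ) + A * (CJ * α ^ 2 * s * u ^ 2) := by ring
  have e3 : L / 2 * α ^ 2 * (s + h ^ 2) + A * (Ly ^ 2 * α ^ 2 * (s + h ^ 2))
      = α ^ 2 * s * (L / 2 + A * Ly ^ 2) + (L / 2 * α ^ 2 + A * (Ly ^ 2 * α ^ 2)) * h ^ 2 := by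
    ring
  have e4 : A * (1 + 10 * Mf * Ly * α) * u ^ 2
      = A * u ^ 2 + A * (10 * Mf * Ly * α) * u ^ 2 := by ring
  have e5 : α ^ 2 * s * (L / 2 + A * Ly ^ 2 + A * CJ)
      = α ^ 2 * s * (L / 2 + A * Ly ^ 2) + α ^ 2 * s * (A * CJ) := by ring
  rw [e1, e4, e5]
  linarith

variable {Ω : Type*} [MeasurableSpace Ω] {μ : Measure Ω} [IsProbabilityMeasure μ]

/-- Expected decrease of the Lyapunov function in one outer step with fixed inner iterate. -/
theorem lintegral_descent_le {Φ : X → ℝ} {ys : X → Y} {H : Ω → X} {x h G Gy : X} {y : Y}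
    {Mf Ly L CJ α A s b Φlow : ℝ} (hα : 0 < α) (hMf : 0 < Mf)
    (hLy : 0 < Ly) (hL : 0 ≤ L) (hCJ : 0 ≤ CJ) (hA : A = Mf / Ly)
    (hstep : α * (2 * L + 4 * Mf * Ly) ≤ 1) (hs : CJ * (α * s) ≤ 5 * Mf * Ly)
    (hΦ : ∀ x', Φ x' ≤ Φ x + inner ℝ G (x' - x) + L / 2 * ‖x' - x‖ ^ 2)
    (hlow : ∀ x', Φlow ≤ Φ x') (hLip : ∀ x x', ‖ys x' - ys x‖ ≤ Ly * ‖x' - x‖)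
    (hTay : ∀ x', ∃ J : X →L[ℝ] Y, ∀ x'', ‖ys x'' - ys x' - J (x'' - x')‖ ≤ CJ * ‖x'' - x'‖ ^ 2)
    (hH : MeanVar μ H h s) (hG : ‖G - Gy‖ ≤ Mf * ‖y - ys x‖) (hb : ‖Gy - h‖ ≤ b) :
    ∫⁻ ω, ENNReal.ofReal (Φ (x - α • H ω) - Φlow + A * ‖y - ys (x - α • H ω)‖ ^ 2) ∂μ
      + ENNReal.ofReal (α / 2 * ‖G‖ ^ 2)
      ≤ ENNReal.ofReal (Φ x - Φlow) + ENNReal.ofReal (A * (1 + 10 * Mf * Ly * α)) *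
        ENNReal.ofReal (‖y - ys x‖ ^ 2)
        + ENNReal.ofReal (α * b ^ 2 + α ^ 2 * s * (L / 2 + A * Ly ^ 2 + A * CJ)) := by
  -- `J` belongs to the mean step and is deterministic, which is why ⟪u, J(H - h)⟫ integrates to
  -- zero.
  obtain ⟨J, hJ⟩ := hTay (x - α • h)
  have hA0 : 0 < A := by rw [hA]; positivity
  set u := y - ys x with hu
  have iH2 : Integrable (fun ω => ‖H ω‖ ^ 2) μ := hH.memLp.integrable_norm_pow (by norm_num)
  have iD2 : Integrable (fun ω => ‖H ω - h‖ ^ 2) μ := hH.memLp.integrable_sq_norm_sub h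
  have iG : Integrable (fun ω => inner ℝ G (H ω)) μ := hH.integrable.const_inner G
  have iD : Integrable (fun ω => H ω - h) μ := hH.integrable.sub (integrable_const h)
  have iJ : Integrable (fun ω => inner ℝ u (J (H ω - h))) μ := (J.integrable_comp iD).const_inner u
  have hs0 : 0 ≤ s := (integral_nonneg fun _ => by positivity).trans hH.var
  have mJ : ∫ ω, inner ℝ u (J (H ω - h)) ∂μ = 0 := by
    rw [integral_inner (J.integrable_comp iD), J.integral_comp_comm iD,
      integral_sub hH.integrable (integrable_const h), hH.mean]
    simp
  have mG : ∫ ω, inner ℝ G (H ω) ∂μ = inner ℝ G h := by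
    rw [integral_inner hH.integrable, hH.mean]
  -- An integrable majorant of the new Lyapunov value. That value is nonnegative, hence so is `U`,
  -- and the integral in [0,∞] becomes a real one.
  let U : Ω → ℝ := fun ω => (Φ x - Φlow + A * (‖u‖ ^ 2 + 2 * Ly * α * ‖u‖ * ‖h‖))
    + (-α) * inner ℝ G (H ω) + (L / 2 * α ^ 2 + A * (Ly ^ 2 * α ^ 2)) * ‖H ω‖ ^ 2
    + A * (2 * α) * inner ℝ u (J (H ω - h)) + A * (2 * CJ * α ^ 2 * ‖u‖) * ‖H ω - h‖ ^ 2
  have j1 : Integrable (fun ω => (Φ x - Φlow + A * (‖u‖ ^ 2 + 2 * Ly * α * ‖u‖ * ‖h‖))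
    + (-α) * inner ℝ G (H ω)) μ := (integrable_const _).add (iG.const_mul (-α))
  have j2 : Integrable (fun ω => (Φ x - Φlow + A * (‖u‖ ^ 2 + 2 * Ly * α * ‖u‖ * ‖h‖))
    + (-α) * inner ℝ G (H ω) + (L / 2 * α ^ 2 + A * (Ly ^ 2 * α ^ 2)) * ‖H ω‖ ^ 2) μ :=
    j1.add (iH2.const_mul _)
  have j3 : Integrable (fun ω => (Φ x - Φlow + A * (‖u‖ ^ 2 + 2 * Ly * α * ‖u‖ * ‖h‖))
    + (-α) * inner ℝ G (H ω) + (L / 2 * α ^ 2 + A * (Ly ^ 2 * α ^ 2)) * ‖H ω‖ ^ 2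
    + A * (2 * α) * inner ℝ u (J (H ω - h))) μ := j2.add (iJ.const_mul _)
  have iU : Integrable U μ := j3.add (iD2.const_mul (A * (2 * CJ * α ^ 2 * ‖u‖)))
  have mU : ∫ ω, U ω ∂μ = (Φ x - Φlow + A * (‖u‖ ^ 2 + 2 * Ly * α * ‖u‖ * ‖h‖))
    + (-α) * inner ℝ G h + (L / 2 * α ^ 2 + A * (Ly ^ 2 * α ^ 2)) * ∫ ω, ‖H ω‖ ^ 2 ∂μ
    + A * (2 * CJ * α ^ 2 * ‖u‖) * ∫ ω, ‖H ω - h‖ ^ 2 ∂μ := by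
    refine (integral_add j3 (iD2.const_mul _)).trans ?_
    rw [integral_add j2 (iJ.const_mul _)]
    rw [integral_add j1 (iH2.const_mul _)]
    rw [integral_add (integrable_const _) (iG.const_mul (-α))]
    simp only [integral_const_mul, mJ, mG, integral_const, probReal_univ, one_smul, mul_zero,
      add_zero]
  have hpt : ∀ ω, Φ (x - α • H ω) - Φlow + A * ‖y - ys (x - α • H ω)‖ ^ 2 ≤ U ω := fun ω => by
    have h1 := hΦ (x - α • H ω)
    rw [sub_sub_cancel_left, inner_neg_right, real_inner_smul_right, norm_neg, norm_smul, mul_pow,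
      Real.norm_eq_abs, sq_abs] at h1
    have h2 := mul_le_mul_of_nonneg_left
      (norm_sub_target_sq_le hα.le hLip x h hJ y (H ω)) hA0.le
    dsimp only [U]
    rw [← hu] at h2
    nlinarith
  have hU0 : ∀ ω, 0 ≤ U ω := fun ω => by
    refine le_trans ?_ (hpt ω)
    have := hlow (x - α • H ω)
    have : 0 ≤ A * ‖y - ys (x - α • H ω)‖ ^ 2 := by positivity
    linarith
  have hGh : ‖G - h‖ ^ 2 ≤ 2 * Mf ^ 2 * ‖u‖ ^ 2 + 2 * b ^ 2 := by
    have h1 : ‖G - h‖ ≤ Mf * ‖u‖ + b := by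
      rw [← sub_add_sub_cancel G Gy h]
      exact (norm_add_le _ _).trans (add_le_add hG hb)
    calc ‖G - h‖ ^ 2 ≤ (Mf * ‖u‖ + b) ^ 2 := pow_le_pow_left₀ (norm_nonneg _) h1 2
      _ ≤ _ := by nlinarith [sq_nonneg (Mf * ‖u‖ - b)]
  have hsc := descent_scalar_le hα hMf hLy hL hCJ hA hstep hs hs0 (norm_nonneg u)
    hH.integral_sq_norm_le hH.var (norm_sub_sq_real G h) hGh
  have hΦ0 : 0 ≤ Φ x - Φlow := sub_nonneg.2 (hlow x)
  have hAk : 0 ≤ A * (1 + 10 * Mf * Ly * α) := by positivity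
  rw [← ENNReal.ofReal_mul hAk, ← ENNReal.ofReal_add hΦ0 (by positivity),
    ← ENNReal.ofReal_add (by positivity) (by positivity)]
  calc _ ≤ ∫⁻ ω, ENNReal.ofReal (U ω) ∂μ + ENNReal.ofReal (α / 2 * ‖G‖ ^ 2) := by
        gcongr with ω
        exact hpt ω
    _ = ENNReal.ofReal (∫ ω, U ω ∂μ + α / 2 * ‖G‖ ^ 2) := by
        rw [← ofReal_integral_eq_lintegral_ofReal iU (.of_forall hU0),
          ENNReal.ofReal_add (integral_nonneg hU0) (by positivity)]
    _ ≤ _ := by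
        refine ENNReal.ofReal_le_ofReal ?_
        rw [mU]
        linarith

end Descent

/-! ### Which choices the iterates depend on -/

section History

variable {m n S N : ℕ} {X Y : Type*} [NormedAddCommGroup X] [InnerProductSpace ℝ X]
  [FiniteDimensional ℝ X] [NormedAddCommGroup Y] [InnerProductSpace ℝ Y] [FiniteDimensional ℝ Y]
  {Zf Zg : Type u} [MeasurableSpace Zf] [MeasurableSpace Zg]

/-- The random choices made before inner step `t` of round `k`. -/
def past (k t : ℕ) : Set (Source m n S) :=
  {s | match s with
    | .innerClients k' t' => k' < k ∨ k' = k ∧ t' < t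
    | .innerData k' t' _ _ _ => k' < k ∨ k' = k ∧ t' < t
    | .trunc k' _ => k' < k
    | .client k' _ _ => k' < k
    | .theta k' _ _ => k' < k
    | .phi k' _ _ => k' < k
    | .zeta k' _ _ _ => k' < k
    | .omega k' _ _ => k' < k}

/-- The random choices of the hypergradient estimator in round `k`. -/
def hyperSources (k : ℕ) : Set (Source m n S) := (⋃ i, slots k i) ∪ truncs k

theorem past_mono_inner (k t : ℕ) : (past k t : Set (Source m n S)) ⊆ past k (t + 1) := by
  intro s hs
  cases s <;> simp only [past, Set.mem_ofPred_eq] at hs ⊢ <;> omega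

theorem innerSources_subset (k t : ℕ) :
    (innerSources k t : Set (Source m n S)) ⊆ past k (t + 1) := by
  rintro s (rfl | ⟨_, _, _, rfl⟩) <;> simp [past]

theorem past_subset_succ (k t : ℕ) : (past k t : Set (Source m n S)) ⊆ past (k + 1) 0 := by
  intro s hs
  cases s <;> simp only [past, Set.mem_ofPred_eq] at hs ⊢ <;> omega

theorem hyperSources_subset (k : ℕ) :
    (hyperSources k : Set (Source m n S)) ⊆ past (k + 1) 0 := by
  rintro s (hs | ⟨_, rfl⟩)
  · obtain ⟨j, ((⟨_, _, rfl | ⟨_, rfl⟩⟩ | ⟨_, rfl⟩) | ⟨_, rfl⟩) | ⟨_, rfl⟩⟩ :=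
      Set.mem_iUnion.1 hs <;> simp [past]
  · simp [past]

theorem disjoint_past_innerSources (k t : ℕ) :
    Disjoint (past k t : Set (Source m n S)) (innerSources k t) := by
  rw [Set.disjoint_right]
  rintro s (rfl | ⟨_, _, _, rfl⟩) <;> simp [past]

theorem disjoint_past_hyperSources (k t : ℕ) :
    Disjoint (past k t : Set (Source m n S)) (hyperSources k) := by
  rw [Set.disjoint_right]
  rintro s (hs | ⟨_, rfl⟩)
  · obtain ⟨j, ((⟨_, _, rfl | ⟨_, rfl⟩⟩ | ⟨_, rfl⟩) | ⟨_, rfl⟩) | ⟨_, rfl⟩⟩ :=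
      Set.mem_iUnion.1 hs <;> simp [past]
  · simp [past]

variable (B : Problem m X Y Zf Zg) (lg1 : ℝ)

theorem dependsOn_average_phe (k : ℕ) (z : Pt X Y) :
    DependsOn (fun d : Draws m n S N Zf Zg => (1 / (n : ℝ)) • ∑ i, phe B lg1 d k z i)
      (hyperSources k) := fun (d d' : Draws m n S N Zf Zg) h => by
  have h1 : ∀ i, d.trunc k i = d'.trunc k i := fun i => by
    rw [Draws.trunc, Draws.trunc, h _ (.inr ⟨i, rfl⟩)]
  have h2 : d.maxTrunc k = d'.maxTrunc k := by
    rw [Draws.maxTrunc, Draws.maxTrunc, funext h1]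
  have h3 : ∀ i j l, pheAt B lg1 d k z i j l = pheAt B lg1 d' k z i j l := fun i j l =>
    dependsOn_pheAt B lg1 k z i j l fun s hs => h s (.inl (Set.mem_iUnion.2 ⟨i, hs⟩))
  simp only [phe_eq, h1, h2, h3]

variable (T : ℕ) (α β : ℝ) (x₀ : X) (y₀ : Y)

/-- The pair of the outer iterate and the inner iterate before inner step `t` of round `k`. -/
noncomputable def innerState (d : Draws m n S N Zf Zg) (k t : ℕ) : X × Y :=
  ((iter B lg1 d T (fun _ => α) (fun _ _ => β) x₀ y₀ k).1,
    innerIter B d (fun _ => β) k (iter B lg1 d T (fun _ => α) (fun _ _ => β) x₀ y₀ k).1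
      (iter B lg1 d T (fun _ => α) (fun _ _ => β) x₀ y₀ k).2 t)

variable {T α β x₀ y₀} {lg1}

theorem innerState_succ (d : Draws m n S N Zf Zg) (k t : ℕ) :
    innerState B lg1 T α β x₀ y₀ d k (t + 1)
      = ((innerState B lg1 T α β x₀ y₀ d k t).1, (innerState B lg1 T α β x₀ y₀ d k t).2 -
        β • innerGrad B d k t (innerState B lg1 T α β x₀ y₀ d k t).1
          (innerState B lg1 T α β x₀ y₀ d k t).2) := rfl

/-- The estimator is evaluated at (x^k, y^{k,T}), so round k ends in the state t = T and round k + 1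
starts at t = 0 with the updated x. -/
theorem innerState_next (d : Draws m n S N Zf Zg) (k : ℕ) :
    innerState B lg1 T α β x₀ y₀ d (k + 1) 0
      = ((innerState B lg1 T α β x₀ y₀ d k T).1 - α • ((1 / (n : ℝ)) • ∑ i, phe B lg1 d k
          (pt (innerState B lg1 T α β x₀ y₀ d k T).1 (innerState B lg1 T α β x₀ y₀ d k T).2) i),
        (innerState B lg1 T α β x₀ y₀ d k T).2) := rfl

variable [MeasurableSpace X] [BorelSpace X] [MeasurableSpace Y] [BorelSpace Y]

theorem dependsOn_innerState (k t : ℕ) :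
    DependsOn (fun d : Draws m n S N Zf Zg => innerState B lg1 T α β x₀ y₀ d k t)
      (past k t) := by
  induction k generalizing t with
  | zero =>
    induction t with
    | zero => exact fun d d' _ => rfl
    | succ t ih =>
      intro (d : Draws m n S N Zf Zg) (d' : Draws m n S N Zf Zg) h
      have h1 := ih fun s hs => h s (past_mono_inner _ _ hs)
      have h2 := fun x y =>
        dependsOn_innerGrad B 0 t x y fun s hs => h s (innerSources_subset _ _ hs)
      dsimp only at h1 h2
      simp only [innerState_succ, h1, h2]
  | succ k ihk =>
    induction t with
    | zero =>
      intro (d : Draws m n S N Zf Zg) (d' : Draws m n S N Zf Zg) h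
      have h1 := ihk T fun s hs => h s (past_subset_succ _ _ hs)
      have h2 := fun z =>
        dependsOn_average_phe B lg1 k z fun s hs => h s (hyperSources_subset _ hs)
      dsimp only at h1 h2
      simp only [innerState_next, h1, h2]
    | succ t ih =>
      intro (d : Draws m n S N Zf Zg) (d' : Draws m n S N Zf Zg) h
      have h1 := ih fun s hs => h s (past_mono_inner _ _ hs)
      have h2 := fun x y =>
        dependsOn_innerGrad B (k + 1) t x y fun s hs => h s (innerSources_subset _ _ hs)
      dsimp only at h1 h2
      simp only [innerState_succ, h1, h2]

variable {B} {c : Consts}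

theorem measurable_average_phe (hB : B.Assumptions c) (k : ℕ) :
    Measurable fun p : (X × Y) × Draws m n S N Zf Zg =>
      (1 / (n : ℝ)) • ∑ i, phe B lg1 p.2 k (pt p.1.1 p.1.2) i := by
  refine Measurable.const_smul (Finset.measurable_fun_sum _ fun i _ => ?_) _
  exact (measurable_phe hB lg1 k i).comp
    ((measurable_pt.comp measurable_fst).prodMk measurable_snd)

theorem measurable_innerState (hB : B.Assumptions c) (k t : ℕ) :
    Measurable fun d : Draws m n S N Zf Zg => innerState B lg1 T α β x₀ y₀ d k t := by
  have hstep : ∀ k t, (Measurable fun d : Draws m n S N Zf Zg =>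
      innerState B lg1 T α β x₀ y₀ d k t) → Measurable fun d : Draws m n S N Zf Zg =>
      innerState B lg1 T α β x₀ y₀ d k (t + 1) := fun k t ih => by
    simp only [innerState_succ]
    exact (measurable_fst.comp ih).prodMk ((measurable_snd.comp ih).sub
      (((measurable_innerGrad hB k t).comp (ih.prodMk measurable_id)).const_smul β))
  induction k generalizing t with
  | zero =>
    induction t with
    | zero => exact (measurable_const : Measurable fun _ : Draws m n S N Zf Zg => (x₀, y₀))
    | succ t ih => exact hstep 0 t ih
  | succ k ihk =>
    induction t with
    | zero =>
      simp only [innerState_next]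
      exact ((measurable_fst.comp (ihk T)).sub (((measurable_average_phe hB k).comp
        ((ihk T).prodMk measurable_id)).const_smul α)).prodMk (measurable_snd.comp (ihk T))
    | succ t ih => exact hstep (k + 1) t ih

end History

end FedMBO

namespace FedMBO

namespace Consts

variable (c : Consts)

/-- Curvature constant of the lower-level solution map. -/
noncomputable def curv : ℝ := c.lg2 * (1 + c.lg1 / c.mu) ^ 2 / c.mu

/-- Variance of the hypergradient estimator, up to the factor `ν_N / n`. -/
noncomputable def hyperVar : ℝ := 4 * c.gradSq * (1 + (c.sg2 ^ 2 + c.lg1 ^ 2) / c.lg1 ^ 2)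

/-- Weight of the inner error in the Lyapunov function. -/
noncomputable def weight : ℝ := c.Mf / c.Ly

/-- Bound for the bias of the truncated hypergradient. -/
noncomputable def truncBias (N : ℕ) : ℝ :=
  c.lg1 * (max 0 (1 - c.mu / c.lg1) ^ N * c.lf0 / c.mu)

variable {c} (hc : c.Valid)
include hc

theorem Valid.Mf_pos : 0 < c.Mf := by
  obtain ⟨h0, h1, h2, h3, h4⟩ := hc
  unfold Mf; positivity

theorem Valid.Ly_pos : 0 < c.Ly := div_pos hc.lg1_pos hc.mu_pos

theorem Valid.Lf_eq : c.Lf = c.Mf * (1 + c.lg1 / c.mu) := by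
  have := hc.mu_pos.ne'
  unfold Lf
  rw [show c.lf1 + c.lg1 * (c.lf1 + c.Mf) / c.mu + c.lf0 / c.mu * (c.lg2 + c.lg1 * c.lg2 / c.mu)
    = (c.lf1 + c.lg1 * c.lf1 / c.mu + c.lf0 / c.mu * (c.lg2 + c.lg1 * c.lg2 / c.mu))
      + c.lg1 / c.mu * c.Mf by ring]
  rw [← Mf]; ring

theorem Valid.Lf_pos : 0 < c.Lf := by
  have := hc.Mf_pos
  have := hc.lg1_pos
  have := hc.mu_pos
  rw [hc.Lf_eq]; positivity

theorem Valid.weight_pos : 0 < c.weight := div_pos hc.Mf_pos hc.Ly_pos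

theorem Valid.curv_nonneg : 0 ≤ c.curv := by
  obtain ⟨h0, h1, h2, h3, h4⟩ := hc
  unfold curv; positivity

end Consts

theorem MeanVar.lintegral_sq_norm_sub_le {Ω : Type*} [MeasurableSpace Ω] {E : Type*}
    [NormedAddCommGroup E] [InnerProductSpace ℝ E] [CompleteSpace E] {μ : Measure Ω}
    [IsProbabilityMeasure μ] {X : Ω → E} {a : E} {v : ℝ} (h : MeanVar μ X a v) (b : E) :
    ∫⁻ ω, ENNReal.ofReal (‖X ω - b‖ ^ 2) ∂μ ≤ ENNReal.ofReal (‖a - b‖ ^ 2) + ENNReal.ofReal v := by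
  have hv : 0 ≤ v := (integral_nonneg fun _ => by positivity).trans h.var
  rw [← ofReal_integral_eq_lintegral_ofReal (h.memLp.integrable_sq_norm_sub b)
    (.of_forall fun _ => by positivity), ← ENNReal.ofReal_add (by positivity) hv, add_comm]
  exact ENNReal.ofReal_le_ofReal (h.integral_sq_norm_sub_le b)

/-! ### Properties of Φ and recursion of the inner error -/

section Recursion

variable {m n S N : ℕ} {X Y : Type*} [NormedAddCommGroup X] [InnerProductSpace ℝ X]
  [FiniteDimensional ℝ X] [NormedAddCommGroup Y] [InnerProductSpace ℝ Y] [FiniteDimensional ℝ Y]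
  [MeasurableSpace X] [BorelSpace X] [MeasurableSpace Y] [BorelSpace Y]
  {Zf Zg : Type u} [MeasurableSpace Zf] [MeasurableSpace Zg] {B : Problem m X Y Zf Zg} {c : Consts}
  [NeZero m] [∀ s : Source m n S, IsProbabilityMeasure (s.law B N)]
  (hB : B.Assumptions c) (hc : c.Valid) {ystar : X → Y} (hy : B.IsLowerSolution ystar)
  {T : ℕ} {α β : ℝ} {x₀ : X} {y₀ : Y}
include hB hc hy

theorem hasGradientAt_Phi (x : X) :
    HasGradientAt (B.Phi ystar) (hyperGrad B.fbar B.gbar (pt x (ystar x))) x :=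
  (hB.lowerRegular_gbar).hasGradientAt_bilevel hy (hB.upperRegular_fbar hc) hc.lg2_nonneg
    hc.mu_pos x

theorem gradient_Phi (x : X) :
    gradient (B.Phi ystar) x = hyperGrad B.fbar B.gbar (pt x (ystar x)) :=
  (hasGradientAt_Phi hB hc hy x).gradient

theorem norm_gradient_Phi_le (x : X) :
    ‖gradient (B.Phi ystar) x‖ ≤ c.lf0 + c.lg1 * (c.lf0 / c.mu) := by
  rw [gradient_Phi hB hc hy]
  exact hB.lowerRegular_gbar.norm_hyperGrad_le (hB.upperRegular_fbar hc) hc.lg1_pos.le hc.mu_pos _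

theorem lipConst_gradient_Phi : LipConst c.Lf (gradient (B.Phi ystar)) := fun x' x => by
  rw [gradient_Phi hB hc hy, gradient_Phi hB hc hy, hc.Lf_eq, Consts.Mf]
  exact hB.lowerRegular_gbar.norm_hyperGrad_lowerSolution_sub_le hy (hB.upperRegular_fbar hc)
    hc.lg1_pos.le hc.lg2_nonneg hc.mu_pos x x'

theorem continuous_gradient_Phi : Continuous (gradient (B.Phi ystar)) :=
  (LipschitzWith.of_dist_le_mul (K := c.Lf.toNNReal) fun x x' => by
    rw [dist_eq_norm, dist_eq_norm, Real.coe_toNNReal _ hc.Lf_pos.le]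
    exact lipConst_gradient_Phi hB hc hy x x').continuous

theorem continuous_Phi : Continuous (B.Phi ystar) :=
  continuous_iff_continuousAt.2 fun x =>
    (hasGradientAt_Phi hB hc hy x).hasFDerivAt.continuousAt

theorem measurable_ystar : Measurable ystar :=
  (hB.lowerRegular_gbar.continuous_lowerSolution hy hc.lg1_pos.le hc.mu_pos).measurable

/-- With the state frozen, the squared error splits into bias and variance. The mean step is an
exact gradient step on the averaged g: it contracts and fixes y*(x). -/
theorem lintegral_innerState_succ_le [NeZero n] [NeZero S] [Nonempty (Fin n ↪ Fin m)]
    (hβ : 0 ≤ β) (hβL : β * c.lg1 ≤ 1) (k t : ℕ) :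
    ∫⁻ d, ENNReal.ofReal (‖(innerState B c.lg1 T α β x₀ y₀ d k (t + 1)).2
        - ystar (innerState B c.lg1 T α β x₀ y₀ d k (t + 1)).1‖ ^ 2) ∂drawsLaw n S N B
      ≤ ENNReal.ofReal (max 0 (1 - β * c.mu) ^ 2) *
        ∫⁻ d, ENNReal.ofReal (‖(innerState B c.lg1 T α β x₀ y₀ d k t).2
          - ystar (innerState B c.lg1 T α β x₀ y₀ d k t).1‖ ^ 2) ∂drawsLaw n S N B
      + ENNReal.ofReal (β ^ 2 * ((c.sg1 ^ 2 + c.sg ^ 2) / n)) := by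
  have hms := measurable_ystar hB hc hy
  have hW : Measurable fun d : Draws m n S N Zf Zg => innerState B c.lg1 T α β x₀ y₀ d k t :=
    measurable_innerState hB k t
  let Ψ : X × Y → Draws m n S N Zf Zg → ENNReal := fun w d =>
    ENNReal.ofReal (‖w.2 - β • innerGrad B d k t w.1 w.2 - ystar w.1‖ ^ 2)
  have hΨ : Measurable (Function.uncurry Ψ) := by
    have h1 := measurable_innerGrad (n := n) (S := S) (N := N) hB k t
    have h2 : Measurable fun p : (X × Y) × Draws m n S N Zf Zg =>
        p.1.2 - β • innerGrad B p.2 k t p.1.1 p.1.2 - ystar p.1.1 :=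
      ((measurable_snd.comp measurable_fst).sub (h1.const_smul β)).sub
        (hms.comp (measurable_fst.comp measurable_fst))
    exact (h2.norm.pow_const 2).ennreal_ofReal
  have hΨS : ∀ w, DependsOn (Ψ w) (innerSources k t) := fun w d d' h => by
    have := dependsOn_innerGrad B k t w.1 w.2 h
    dsimp only at this
    simp only [Ψ, this]
  have hstep : ∀ w : X × Y, ∫⁻ d, Ψ w d ∂drawsLaw n S N B
      ≤ ENNReal.ofReal (max 0 (1 - β * c.mu) ^ 2) * ENNReal.ofReal (‖w.2 - ystar w.1‖ ^ 2)
        + ENNReal.ofReal (β ^ 2 * ((c.sg1 ^ 2 + c.sg ^ 2) / n)) := fun w => by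
    refine ((((meanVar_innerGrad hB k t w.1 w.2).smul β).const_sub w.2).lintegral_sq_norm_sub_le
      (ystar w.1)).trans ?_
    gcongr
    rw [← ENNReal.ofReal_mul (by positivity), ← mul_pow]
    refine ENNReal.ofReal_le_ofReal (pow_le_pow_left₀ (norm_nonneg _) ?_ 2)
    have := hB.lowerRegular_gbar.norm_gradient_step_sub_le hc.lg1_pos hβ hβL w.1 w.2 (ystar w.1)
    rwa [hB.lowerRegular_gbar.gradient_snd_lowerSolution hy, smul_zero, sub_zero] at this
  have hm : Measurable fun d : Draws m n S N Zf Zg =>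
      ENNReal.ofReal (‖(innerState B c.lg1 T α β x₀ y₀ d k t).2
          - ystar (innerState B c.lg1 T α β x₀ y₀ d k t).1‖ ^ 2) :=
    (((measurable_snd.comp hW).sub (hms.comp (measurable_fst.comp hW))).norm.pow_const
      2).ennreal_ofReal
  calc _ = ∫⁻ d, Ψ (innerState B c.lg1 T α β x₀ y₀ d k t) d ∂drawsLaw n S N B := by
        simp only [innerState_succ, Ψ]
    _ = ∫⁻ d, ∫⁻ d', Ψ (innerState B c.lg1 T α β x₀ y₀ d k t) d' ∂drawsLaw n S N B
          ∂drawsLaw n S N B :=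
        lintegral_fresh hW (dependsOn_innerState B k t) hΨ hΨS (disjoint_past_innerSources k t)
    _ ≤ _ := (lintegral_mono fun d => hstep _).trans_eq (by
        rw [lintegral_add_right _ measurable_const, lintegral_const_mul _ hm, lintegral_const,
          measure_univ, mul_one])

/-- The contraction factor is at most 1, so t steps accumulate at most t times the noise of one; its
powers are kept only on the initial error. -/
theorem lintegral_innerState_le [NeZero n] [NeZero S] [Nonempty (Fin n ↪ Fin m)]
    (hβ : 0 ≤ β) (hβL : β * c.lg1 ≤ 1) (k t : ℕ) :
    ∫⁻ d, ENNReal.ofReal (‖(innerState B c.lg1 T α β x₀ y₀ d k t).2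
        - ystar (innerState B c.lg1 T α β x₀ y₀ d k t).1‖ ^ 2) ∂drawsLaw n S N B
      ≤ ENNReal.ofReal ((max 0 (1 - β * c.mu) ^ 2) ^ t) *
        ∫⁻ d, ENNReal.ofReal (‖(innerState B c.lg1 T α β x₀ y₀ d k 0).2
          - ystar (innerState B c.lg1 T α β x₀ y₀ d k 0).1‖ ^ 2) ∂drawsLaw n S N B
      + ENNReal.ofReal (t * (β ^ 2 * ((c.sg1 ^ 2 + c.sg ^ 2) / n))) := by
  have hθ : max 0 (1 - β * c.mu) ^ 2 ≤ 1 := by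
    refine pow_le_one₀ (le_max_left _ _) (max_le zero_le_one ?_)
    have := mul_nonneg hβ hc.mu_pos.le
    linarith
  set q := max 0 (1 - β * c.mu) ^ 2 with hq
  have hq0 : 0 ≤ q := by positivity
  induction t with
  | zero => simp
  | succ t ih =>
    refine (lintegral_innerState_succ_le hB hc hy hβ hβL k t).trans ?_
    rw [← hq]
    set e := β ^ 2 * ((c.sg1 ^ 2 + c.sg ^ 2) / n) with he
    have he0 : 0 ≤ e := by positivity
    refine (add_le_add_left (mul_le_mul_right ih _) _).trans ?_
    rw [mul_add, ← mul_assoc, ← ENNReal.ofReal_mul hq0, ← pow_succ', add_assoc,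
      ← ENNReal.ofReal_mul hq0, ← ENNReal.ofReal_add (by positivity) he0]
    gcongr
    push_cast
    have := mul_le_mul_of_nonneg_right hθ (show 0 ≤ t * e by positivity)
    linarith

end Recursion

end FedMBO

namespace FedMBO

/-! ### Lyapunov recursion and telescoping -/

section Lyapunov

variable {m n S N : ℕ} {X Y : Type*} [NormedAddCommGroup X] [InnerProductSpace ℝ X]
  [FiniteDimensional ℝ X] [NormedAddCommGroup Y] [InnerProductSpace ℝ Y] [FiniteDimensional ℝ Y]
  [MeasurableSpace X] [BorelSpace X] [MeasurableSpace Y] [BorelSpace Y]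
  {Zf Zg : Type u} [MeasurableSpace Zf] [MeasurableSpace Zg] {B : Problem m X Y Zf Zg} {c : Consts}

/-- The Lyapunov function: optimality gap plus weighted squared inner error. -/
noncomputable def lyapunov (B : Problem m X Y Zf Zg) (c : Consts) (ystar : X → Y) (Φlow : ℝ)
    (w : X × Y) : ENNReal :=
  ENNReal.ofReal (B.Phi ystar w.1 - Φlow + c.weight * ‖w.2 - ystar w.1‖ ^ 2)

/-- The error terms of one outer step with step size `α`. -/
noncomputable def Consts.stepError (c : Consts) (N n T : ℕ) (α β : ℝ) : ℝ :=
  α * c.truncBias N ^ 2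
    + α ^ 2 * (c.hyperVar * c.neumannFactor N / n) *
      (c.Lf / 2 + c.weight * c.Ly ^ 2 + c.weight * c.curv)
    + c.weight * (1 + 10 * c.Mf * c.Ly * α) * (T * (β ^ 2 * ((c.sg1 ^ 2 + c.sg ^ 2) / n)))

variable [NeZero m] [∀ s : Source m n S, IsProbabilityMeasure (s.law B N)]
  [NeZero n] [NeZero N]
  (hB : B.Assumptions c) (hc : c.Valid) {ystar : X → Y} (hy : B.IsLowerSolution ystar)
  {T : ℕ} {α β Φlow : ℝ} {x₀ : X} {y₀ : Y}
include hB hc hy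

theorem lintegral_outer_step_le (hα : 0 < α)
    (hstep : α * (2 * c.Lf + 4 * c.Mf * c.Ly) ≤ 1)
    (hs : c.curv * (α * (c.hyperVar * c.neumannFactor N / n)) ≤ 5 * c.Mf * c.Ly)
    (hlow : ∀ x, Φlow ≤ B.Phi ystar x) (k : ℕ) (x : X) (y : Y) :
    ∫⁻ d : Draws m n S N Zf Zg, lyapunov B c ystar Φlow
        (x - α • ((1 / (n : ℝ)) • ∑ i, phe B c.lg1 d k (pt x y) i), y) ∂drawsLaw n S N B
      + ENNReal.ofReal (α / 2 * ‖gradient (B.Phi ystar) x‖ ^ 2)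
      ≤ ENNReal.ofReal (B.Phi ystar x - Φlow)
        + ENNReal.ofReal (c.weight * (1 + 10 * c.Mf * c.Ly * α)) *
          ENNReal.ofReal (‖y - ystar x‖ ^ 2)
        + ENNReal.ofReal (α * c.truncBias N ^ 2
          + α ^ 2 * (c.hyperVar * c.neumannFactor N / n) *
            (c.Lf / 2 + c.weight * c.Ly ^ 2 + c.weight * c.curv)) := by
  have hg := hB.lowerRegular_gbar
  have hf := hB.upperRegular_fbar hc
  refine lintegral_descent_le (Gy := hyperGrad B.fbar B.gbar (pt x y)) hα hc.Mf_pos hc.Ly_pos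
    hc.Lf_pos.le hc.curv_nonneg rfl hstep hs
    (fun x' => le_quadratic_of_lipConst_gradient
      (fun x => (hasGradientAt_Phi hB hc hy x).differentiableAt.hasGradientAt)
      (lipConst_gradient_Phi hB hc hy) x x')
    hlow (hg.norm_lowerSolution_sub_le hy hc.mu_pos)
    (fun x' => ⟨-(invYY B.gbar (pt x' (ystar x'))).comp
      (opYX (hessian B.gbar (pt x' (ystar x')))), fun x'' => ?_⟩)
    (meanVar_average_phe hB hc k (pt x y)) ?_
    (hg.norm_truncHyperGrad_sub_le hf hc.lg1_pos hc.mu_pos N (pt x y))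
  · have := hg.norm_lowerSolution_sub_taylor_le hy hc.lg2_nonneg hc.mu_pos x' x''
    rwa [neg_apply, sub_neg_eq_add, ContinuousLinearMap.comp_apply]
  · rw [gradient_Phi hB hc hy, norm_sub_rev (y)]
    refine (hg.norm_hyperGrad_sub_le hf hc.lg1_pos.le hc.lg2_nonneg hc.mu_pos _ _).trans_eq ?_
    rw [pt_sub, sub_self, norm_pt_zero_left]
    rfl

/-- `hcon` states that the contraction over T inner steps outweighs the factor 1 + 10 Mf Ly α which
the outer step puts on the inner error. -/
theorem lintegral_lyapunov_succ_le [NeZero S] [Nonempty (Fin n ↪ Fin m)] (hα : 0 < α)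
    (hβ : 0 ≤ β) (hβL : β * c.lg1 ≤ 1)
    (hstep : α * (2 * c.Lf + 4 * c.Mf * c.Ly) ≤ 1)
    (hs : c.curv * (α * (c.hyperVar * c.neumannFactor N / n)) ≤ 5 * c.Mf * c.Ly)
    (hcon : (1 + 10 * c.Mf * c.Ly * α) * (max 0 (1 - β * c.mu) ^ 2) ^ T ≤ 1)
    (hlow : ∀ x, Φlow ≤ B.Phi ystar x) (k : ℕ) :
    ∫⁻ d, lyapunov B c ystar Φlow (innerState B c.lg1 T α β x₀ y₀ d (k + 1) 0) ∂drawsLaw n S N B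
      + ∫⁻ d, ENNReal.ofReal (α / 2 *
        ‖gradient (B.Phi ystar) (innerState B c.lg1 T α β x₀ y₀ d k 0).1‖ ^ 2) ∂drawsLaw n S N B
      ≤ ∫⁻ d, lyapunov B c ystar Φlow (innerState B c.lg1 T α β x₀ y₀ d k 0) ∂drawsLaw n S N B
        + ENNReal.ofReal (c.stepError N n T α β) := by
  have hms := measurable_ystar hB hc hy
  have hmΦ := (continuous_Phi hB hc hy).measurable
  have hmG := (continuous_gradient_Phi hB hc hy).measurable
  have hMf := hc.Mf_pos
  have hLy := hc.Ly_pos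
  have hA := hc.weight_pos
  have hLf := hc.Lf_pos
  have hcv := hc.curv_nonneg
  have hW : ∀ t, Measurable fun d : Draws m n S N Zf Zg => innerState B c.lg1 T α β x₀ y₀ d k t :=
    fun t => measurable_innerState hB k t
  have hml : Measurable (lyapunov B c ystar Φlow) :=
    (((hmΦ.comp measurable_fst).sub_const _).add ((((measurable_snd.sub
      (hms.comp measurable_fst)).norm.pow_const 2)).const_mul _)).ennreal_ofReal
  let Ψ : X × Y → Draws m n S N Zf Zg → ENNReal := fun w d =>
    lyapunov B c ystar Φlow
      (w.1 - α • ((1 / (n : ℝ)) • ∑ i, phe B c.lg1 d k (pt w.1 w.2) i), w.2)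
  have hΨ : Measurable (Function.uncurry Ψ) := by
    have h1 := measurable_average_phe (n := n) (S := S) (N := N) (lg1 := c.lg1) hB k
    exact hml.comp (((measurable_fst.comp measurable_fst).sub (h1.const_smul α)).prodMk
      (measurable_snd.comp measurable_fst))
  have hΨS : ∀ w, DependsOn (Ψ w) (hyperSources k) := fun w d d' h => by
    have := dependsOn_average_phe B c.lg1 k (pt w.1 w.2) h
    dsimp only at this
    simp only [Ψ, this]
  have hfresh : ∫⁻ d, lyapunov B c ystar Φlow (innerState B c.lg1 T α β x₀ y₀ d (k + 1) 0)
      ∂drawsLaw n S N B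
      = ∫⁻ d, ∫⁻ d', Ψ (innerState B c.lg1 T α β x₀ y₀ d k T) d' ∂drawsLaw n S N B
          ∂drawsLaw n S N B :=
    lintegral_fresh (hW T) (dependsOn_innerState B k T) hΨ hΨS (disjoint_past_hyperSources k T)
  have hmg : Measurable fun d : Draws m n S N Zf Zg => ENNReal.ofReal (α / 2 *
      ‖gradient (B.Phi ystar) (innerState B c.lg1 T α β x₀ y₀ d k 0).1‖ ^ 2) :=
    (((hmG.comp (measurable_fst.comp (hW 0))).norm.pow_const 2).const_mul _).ennreal_ofReal
  have hmd : ∀ t, Measurable fun d : Draws m n S N Zf Zg =>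
      ENNReal.ofReal (‖(innerState B c.lg1 T α β x₀ y₀ d k t).2
          - ystar (innerState B c.lg1 T α β x₀ y₀ d k t).1‖ ^ 2) := fun t =>
    (((measurable_snd.comp (hW t)).sub (hms.comp (measurable_fst.comp (hW t)))).norm.pow_const
      2).ennreal_ofReal
  have hmp : Measurable fun d : Draws m n S N Zf Zg =>
      ENNReal.ofReal (B.Phi ystar (innerState B c.lg1 T α β x₀ y₀ d k 0).1 - Φlow) :=
    ((hmΦ.comp (measurable_fst.comp (hW 0))).sub_const _).ennreal_ofReal
  set D := fun t => ∫⁻ d, ENNReal.ofReal (‖(innerState B c.lg1 T α β x₀ y₀ d k t).2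
    - ystar (innerState B c.lg1 T α β x₀ y₀ d k t).1‖ ^ 2) ∂drawsLaw n S N B with hD
  set F := ∫⁻ d, ENNReal.ofReal (B.Phi ystar (innerState B c.lg1 T α β x₀ y₀ d k 0).1 - Φlow)
    ∂drawsLaw n S N B with hF
  have hν : 0 ≤ c.neumannFactor N := by unfold Consts.neumannFactor; positivity
  have hH : 0 ≤ c.hyperVar := by
    have := c.gradSq_nonneg
    unfold Consts.hyperVar; positivity
  set R := α * c.truncBias N ^ 2 + α ^ 2 * (c.hyperVar * c.neumannFactor N / n) *
            (c.Lf / 2 + c.weight * c.Ly ^ 2 + c.weight * c.curv) with hR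
  have hR0 : 0 ≤ R := by positivity
  have hV : ∫⁻ d, lyapunov B c ystar Φlow (innerState B c.lg1 T α β x₀ y₀ d k 0) ∂drawsLaw n S N B
      = F + ENNReal.ofReal c.weight * D 0 := by
    rw [hF, hD]
    dsimp only
    rw [← lintegral_const_mul _ (hmd 0), ← lintegral_add_left hmp]
    refine lintegral_congr fun d => ?_
    rw [← ENNReal.ofReal_mul hA.le, ← ENNReal.ofReal_add (sub_nonneg.2 (hlow _)) (by positivity)]
    rfl
  rw [hfresh, hV, ← lintegral_add_right _ hmg]
  have hDT := lintegral_innerState_le (n := n) (S := S) (N := N) (T := T) (α := α) (x₀ := x₀) (y₀ := y₀) hB hc hy hβ hβL k T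
  calc _ ≤ ∫⁻ d, (ENNReal.ofReal (B.Phi ystar (innerState B c.lg1 T α β x₀ y₀ d k 0).1 - Φlow)
          + ENNReal.ofReal (c.weight * (1 + 10 * c.Mf * c.Ly * α)) *
            ENNReal.ofReal (‖(innerState B c.lg1 T α β x₀ y₀ d k T).2
              - ystar (innerState B c.lg1 T α β x₀ y₀ d k T).1‖ ^ 2)
          + ENNReal.ofReal R) ∂drawsLaw n S N B :=
        lintegral_mono fun d => lintegral_outer_step_le hB hc hy hα hstep hs hlow k _ _
    _ = F + ENNReal.ofReal (c.weight * (1 + 10 * c.Mf * c.Ly * α)) * D T + ENNReal.ofReal R := by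
        rw [lintegral_add_right _ measurable_const, lintegral_add_left hmp,
          lintegral_const_mul _ (hmd T), lintegral_const, measure_univ, mul_one]
    _ ≤ F + ENNReal.ofReal (c.weight * (1 + 10 * c.Mf * c.Ly * α)) *
          (ENNReal.ofReal ((max 0 (1 - β * c.mu) ^ 2) ^ T) * D 0
            + ENNReal.ofReal (T * (β ^ 2 * ((c.sg1 ^ 2 + c.sg ^ 2) / n)))) + ENNReal.ofReal R := by
        gcongr
    _ = F + ENNReal.ofReal (c.weight * ((1 + 10 * c.Mf * c.Ly * α) *
          (max 0 (1 - β * c.mu) ^ 2) ^ T)) * D 0 + ENNReal.ofReal (c.stepError N n T α β) := by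
        rw [mul_add, ← mul_assoc, ← ENNReal.ofReal_mul (by positivity),
          ← ENNReal.ofReal_mul (by positivity), ← add_assoc, add_assoc _ _ (ENNReal.ofReal R),
          ← ENNReal.ofReal_add (by positivity) hR0, add_comm _ R, mul_assoc c.weight]
        rfl
    _ ≤ _ := by
        gcongr
        exact mul_le_of_le_one_right hA.le hcon

/-- Telescoping in [0,∞] without subtraction: the final Lyapunov value stays on the left during the
induction and is dropped afterwards. -/
theorem sum_lintegral_gradient_le [NeZero S] [Nonempty (Fin n ↪ Fin m)] (hα : 0 < α)
    (hβ : 0 ≤ β) (hβL : β * c.lg1 ≤ 1)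
    (hstep : α * (2 * c.Lf + 4 * c.Mf * c.Ly) ≤ 1)
    (hs : c.curv * (α * (c.hyperVar * c.neumannFactor N / n)) ≤ 5 * c.Mf * c.Ly)
    (hcon : (1 + 10 * c.Mf * c.Ly * α) * (max 0 (1 - β * c.mu) ^ 2) ^ T ≤ 1)
    (hlow : ∀ x, Φlow ≤ B.Phi ystar x) (K : ℕ) :
    ∑ k ∈ Finset.range K, ∫⁻ d, ENNReal.ofReal (α / 2 *
        ‖gradient (B.Phi ystar) (innerState B c.lg1 T α β x₀ y₀ d k 0).1‖ ^ 2) ∂drawsLaw n S N B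
      ≤ ENNReal.ofReal (B.Phi ystar x₀ - Φlow + c.weight * ‖y₀ - ystar x₀‖ ^ 2)
        + K * ENNReal.ofReal (c.stepError N n T α β) := by
  have key : ∫⁻ d, lyapunov B c ystar Φlow (innerState B c.lg1 T α β x₀ y₀ d K 0) ∂drawsLaw n S N B
      + ∑ k ∈ Finset.range K, ∫⁻ d, ENNReal.ofReal (α / 2 *
        ‖gradient (B.Phi ystar) (innerState B c.lg1 T α β x₀ y₀ d k 0).1‖ ^ 2) ∂drawsLaw n S N B
      ≤ ENNReal.ofReal (B.Phi ystar x₀ - Φlow + c.weight * ‖y₀ - ystar x₀‖ ^ 2)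
        + K * ENNReal.ofReal (c.stepError N n T α β) := by
    induction K with
    | zero =>
      have : ∀ d : Draws m n S N Zf Zg, lyapunov B c ystar Φlow
          (innerState B c.lg1 T α β x₀ y₀ d 0 0)
          = ENNReal.ofReal (B.Phi ystar x₀ - Φlow + c.weight * ‖y₀ - ystar x₀‖ ^ 2) :=
        fun _ => rfl
      simp [this]
    | succ K ih =>
      have h1 := lintegral_lyapunov_succ_le (n := n) (S := S) (N := N) (T := T) (x₀ := x₀)
        (y₀ := y₀) hB hc hy hα hβ hβL hstep hs hcon hlow K
      rw [Finset.sum_range_succ, add_comm (Finset.sum _ _), ← add_assoc]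
      refine (add_le_add_left h1 _).trans ?_
      rw [add_right_comm]
      refine (add_le_add_left ih _).trans_eq ?_
      rw [Nat.cast_succ, add_mul, one_mul, add_assoc]
  exact le_add_self.trans key

end Lyapunov

end FedMBO

namespace FedMBO

/-! ### Constants and step sizes -/

namespace Consts

variable {c : Consts} (hc : c.Valid)

/-- Uniform bound for the gradient of the bilevel objective. -/
noncomputable def gradBound (c : Consts) : ℝ := c.lf0 + c.lg1 * (c.lf0 / c.mu)

/-- Coefficient of the noise terms of order `α ν_N / n`. -/
noncomputable def noiseConst (c : Consts) (η : ℝ) : ℝ :=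
  c.hyperVar * (c.Lf / 2 + c.weight * c.Ly ^ 2 + c.weight * c.curv)
    + c.weight * (7 / 2) * (c.betaBar η 1 ^ 2 * (c.sg1 ^ 2 + c.sg ^ 2))

/-- The constant of the convergence rate. -/
noncomputable def rateConst (c : Consts) (η ΔΦ Δy : ℝ) : ℝ :=
  1 + 2 * (|ΔΦ| + c.weight * |Δy|) + 2 * (c.lf0 / c.lf1) ^ 2 + 2 * c.noiseConst η
    + c.gradBound ^ 2 * (c.curv * c.hyperVar / (5 * c.Mf * c.Ly))

theorem hyperVar_nonneg : 0 ≤ c.hyperVar := by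
  have := c.gradSq_nonneg
  unfold hyperVar; positivity

theorem one_le_neumannFactor (N : ℕ) : 1 ≤ c.neumannFactor N := by
  unfold neumannFactor
  exact le_add_of_nonneg_right (by positivity)

theorem DTildeSq_nonneg : 0 ≤ c.DTildeSq := by
  unfold DTildeSq sigmaTildeSq; positivity

include hc

theorem Valid.Lyx_nonneg : 0 ≤ c.Lyx := by
  have := hc.Ly_pos
  obtain ⟨h0, h1, h2, h3, h4⟩ := hc
  unfold Lyx; positivity

theorem Valid.alphaHat1_pos {η : ℝ} (hη : 0 < η) : 0 < c.alphaHat1 η := by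
  have := hc.Ly_pos
  have := hc.Mf_pos
  have := hc.Lf_pos
  have := hc.Lyx_nonneg
  unfold alphaHat1; positivity

/-- The descent uses nothing else about the size of α̂₁; the summand with L_yx and η only makes it
smaller. -/
theorem Valid.alphaHat1_mul_le {η : ℝ} (hη : 0 < η) :
    c.alphaHat1 η * (2 * c.Lf + 4 * c.Mf * c.Ly) ≤ 1 := by
  have := hc.Ly_pos
  have := hc.Mf_pos
  have := hc.Lf_pos
  have := hc.Lyx_nonneg
  unfold alphaHat1
  rw [one_div_mul_eq_div]
  exact div_le_one_of_le₀ (le_add_of_nonneg_right (by positivity)) (by positivity)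

theorem Valid.le_betaBar {η r : ℝ} (hη : 0 < η) (hr : 1 ≤ r) :
    5 * c.Mf * c.Ly / c.mu ≤ c.betaBar η r := by
  have := hc.alphaHat1_pos hη
  have := hc.Lyx_nonneg
  have := c.DTildeSq_nonneg
  have := hc.mu_pos
  exact le_add_of_nonneg_right (by positivity)

theorem Valid.betaBar_pos {η r : ℝ} (hη : 0 < η) (hr : 1 ≤ r) : 0 < c.betaBar η r := by
  have := hc.Mf_pos
  have := hc.Ly_pos
  have := hc.mu_pos
  exact (show 0 < 5 * c.Mf * c.Ly / c.mu by positivity).trans_le (hc.le_betaBar hη hr)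

/-- Makes the bounds uniform in r, so that the noise constant does not depend on n. -/
theorem Valid.betaBar_le {η r : ℝ} (hη : 0 < η) (hr : 1 ≤ r) :
    c.betaBar η r ≤ c.betaBar η 1 := by
  have := hc.alphaHat1_pos hη
  have := hc.Lyx_nonneg
  have := c.DTildeSq_nonneg
  have := hc.mu_pos
  unfold betaBar
  gcongr

theorem Valid.alphaHat2_pos {η : ℝ} (hη : 0 < η) {T : ℕ} (hT : 1 ≤ T) : 0 < c.alphaHat2 η T := by
  have := hc.lg1_pos
  have := hc.betaBar_pos hη le_rfl
  have : (0 : ℝ) < T := by exact_mod_cast hT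
  unfold alphaHat2; positivity

/-- `truncBias` carries ℓ_{f,0} where b carries ℓ_{f,1}. Squares are compared because (κ_g - 1)/κ_g
is not known to be nonnegative. -/
theorem Valid.truncBias_sq_le (N : ℕ) :
    c.truncBias N ^ 2 ≤ (c.lf0 / c.lf1) ^ 2 * c.bias N ^ 2 := by
  obtain ⟨h0, h1, h2, h3, h4⟩ := hc
  have e : (c.kappa - 1) / c.kappa = 1 - c.mu / c.lg1 := by
    unfold kappa; field_simp
  have hm : max 0 (1 - c.mu / c.lg1) ^ 2 ≤ (1 - c.mu / c.lg1) ^ 2 := by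
    rcases le_total 0 (1 - c.mu / c.lg1) with h | h
    · rw [max_eq_right h]
    · rw [max_eq_left h, zero_pow two_ne_zero]; positivity
  have e1 : c.truncBias N ^ 2
      = (c.lg1 * c.lf0 / c.mu) ^ 2 * (max 0 (1 - c.mu / c.lg1) ^ 2) ^ N := by
    unfold truncBias; rw [← pow_mul, mul_comm 2 N, pow_mul]; ring
  have e2 : (c.lf0 / c.lf1) ^ 2 * c.bias N ^ 2
      = (c.lg1 * c.lf0 / c.mu) ^ 2 * ((1 - c.mu / c.lg1) ^ 2) ^ N := by
    unfold bias; rw [e, ← pow_mul, mul_comm 2 N, pow_mul, kappa]; field_simp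
  rw [e1, e2]
  gcongr

theorem Valid.gradBound_nonneg : 0 ≤ c.gradBound := by
  obtain ⟨h0, h1, h2, h3, h4⟩ := hc
  unfold gradBound; positivity

theorem Valid.noiseConst_nonneg {η : ℝ} : 0 ≤ c.noiseConst η := by
  have := c.hyperVar_nonneg
  have := hc.weight_pos
  have := hc.curv_nonneg
  have := hc.Lf_pos
  unfold noiseConst; positivity

theorem Valid.rateConst_pos (η ΔΦ Δy : ℝ) : 0 < c.rateConst η ΔΦ Δy := by
  have := c.hyperVar_nonneg
  have := hc.weight_pos
  have := hc.curv_nonneg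
  have := hc.noiseConst_nonneg (η := η)
  have := hc.Mf_pos
  have := hc.Ly_pos
  unfold rateConst; positivity

section StepSizes

variable {η r α β : ℝ} {T : ℕ} (hη : 0 < η) (hr : 1 ≤ r) (hT : 1 ≤ T) (hα : 0 < α)
  (hβ : β = c.betaBar η r * (α / T))
include hη hr hT hα hβ

theorem Valid.step_mul_le (hα2 : α ≤ c.alphaHat2 η T) : β * c.lg1 ≤ 1 := by
  have hb := hc.betaBar_pos hη le_rfl
  have hl := hc.lg1_pos
  have hT' : (0 : ℝ) < T := by exact_mod_cast hT
  calc β * c.lg1 ≤ c.betaBar η 1 * (c.alphaHat2 η T / T) * c.lg1 := by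
        rw [hβ]
        have := hc.betaBar_le hη hr
        gcongr
    _ = 1 / 2 := by unfold alphaHat2; field_simp
    _ ≤ 1 := by norm_num

/-- By 1 + t ≤ exp t, used twice, the product is at most exp(10 Mf Ly α - 2Tβμ), and Tβ = β̄_r α ≥ 5
Mf Ly α/μ. -/
theorem Valid.contraction_le :
    (1 + 10 * c.Mf * c.Ly * α) * (max 0 (1 - β * c.mu) ^ 2) ^ T ≤ 1 := by
  have hm := hc.mu_pos
  have hM := hc.Mf_pos
  have hL := hc.Ly_pos
  have hT' : (0 : ℝ) < T := by exact_mod_cast hT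
  have h1 : max 0 (1 - β * c.mu) ≤ Real.exp (-(β * c.mu)) :=
    max_le (Real.exp_pos _).le (by linarith [Real.add_one_le_exp (-(β * c.mu))])
  have h2 : (max 0 (1 - β * c.mu) ^ 2) ^ T ≤ Real.exp (-(10 * c.Mf * c.Ly * α)) := by
    rw [← pow_mul]
    refine (pow_le_pow_left₀ (le_max_left _ _) h1 _).trans ?_
    rw [← Real.exp_nat_mul]
    refine Real.exp_le_exp.2 ?_
    have h3 := hc.le_betaBar hη hr
    rw [div_le_iff₀ hm] at h3
    have h4 : ((2 * T : ℕ) : ℝ) * -(β * c.mu) = -(2 * α * (c.betaBar η r * c.mu)) := by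
      rw [hβ]; push_cast; field_simp
    rw [h4]
    nlinarith
  calc _ ≤ Real.exp (10 * c.Mf * c.Ly * α) * Real.exp (-(10 * c.Mf * c.Ly * α)) := by
        gcongr
        linarith [Real.add_one_le_exp (10 * c.Mf * c.Ly * α)]
    _ = 1 := by rw [← Real.exp_add, add_neg_cancel, Real.exp_zero]

theorem Valid.stepError_le {n : ℕ} (hn : 1 ≤ n) (N : ℕ)
    (hstep : α * (2 * c.Lf + 4 * c.Mf * c.Ly) ≤ 1) :
    c.stepError N n T α β ≤ α * ((c.lf0 / c.lf1) ^ 2 * c.bias N ^ 2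
      + c.noiseConst η * (α * c.neumannFactor N / n)) := by
  have hn' : (0 : ℝ) < n := by exact_mod_cast hn
  have hT' : (1 : ℝ) ≤ T := by exact_mod_cast hT
  have hw := hc.weight_pos
  have hM := hc.Mf_pos
  have hL := hc.Ly_pos
  have hLf := hc.Lf_pos
  have hν := c.one_le_neumannFactor N
  -- `hstep` gives 4 Mf Ly α ≤ 1, hence 10 Mf Ly α ≤ 5/2.
  have h1 : 1 + 10 * c.Mf * c.Ly * α ≤ 7 / 2 := by nlinarith
  have h2 : (T : ℝ) * (β ^ 2 * ((c.sg1 ^ 2 + c.sg ^ 2) / n))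
      ≤ α ^ 2 * (c.betaBar η 1 ^ 2 * (c.sg1 ^ 2 + c.sg ^ 2)) * c.neumannFactor N / n := by
    have e : (T : ℝ) * (β ^ 2 * ((c.sg1 ^ 2 + c.sg ^ 2) / n))
      = α ^ 2 * (c.betaBar η r ^ 2 * (c.sg1 ^ 2 + c.sg ^ 2)) / n / T := by
      rw [hβ]; field_simp
    have hb := hc.betaBar_le hη hr
    have hb0 := hc.betaBar_pos hη hr
    rw [e]
    calc _ ≤ α ^ 2 * (c.betaBar η r ^ 2 * (c.sg1 ^ 2 + c.sg ^ 2)) / n :=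
          div_le_self (by positivity) hT'
      _ ≤ α ^ 2 * (c.betaBar η 1 ^ 2 * (c.sg1 ^ 2 + c.sg ^ 2)) / n := by gcongr
      _ ≤ _ := div_le_div_of_nonneg_right (le_mul_of_one_le_right (by positivity) hν) hn'.le
  have h3 := hc.truncBias_sq_le N
  unfold stepError
  calc _ ≤ α * ((c.lf0 / c.lf1) ^ 2 * c.bias N ^ 2)
        + α ^ 2 * (c.hyperVar * c.neumannFactor N / n) *
          (c.Lf / 2 + c.weight * c.Ly ^ 2 + c.weight * c.curv)
        + c.weight * (7 / 2) *
          (α ^ 2 * (c.betaBar η 1 ^ 2 * (c.sg1 ^ 2 + c.sg ^ 2)) * c.neumannFactor N / n) := by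
        gcongr
    _ = _ := by unfold noiseConst; ring

end StepSizes

omit hc in
/-- The two regimes of the step size, in the form in which they enter the rate. -/
theorem step_size_rate {α a α₃ ν : ℝ} {n K : ℕ} (hn : 1 ≤ n) (hK : 1 ≤ K) (ha : 0 < a)
    (hα₃ : 0 < α₃) (hν : 1 ≤ ν) (hα : α = min a (√((n : ℝ) / K) * α₃)) :
    0 < α ∧ α * ν / n ≤ (ν * α₃ + α₃⁻¹) / √((n : ℝ) * K) ∧
      1 / (α * K) ≤ (ν * α₃ + α₃⁻¹) / √((n : ℝ) * K) + 1 / (a * K) := by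
  have hn' : (0 : ℝ) < n := by exact_mod_cast hn
  have hK' : (0 : ℝ) < K := by exact_mod_cast hK
  have hs : 0 < √((n : ℝ) * K) := by positivity
  have hss : √((n : ℝ) * K) ^ 2 = n * K := Real.sq_sqrt (by positivity)
  have e : √((n : ℝ) / K) = √((n : ℝ) * K) / K := by
    rw [show (n : ℝ) / K = n * K / K ^ 2 by field_simp, Real.sqrt_div (by positivity),
      Real.sqrt_sq hK'.le]
  rw [e] at hα
  set s := √((n : ℝ) * K)
  have hα0 : 0 < α := by rw [hα]; exact lt_min ha (by positivity)
  refine ⟨hα0, ?_, ?_⟩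
  · have h1 : α ≤ s / K * α₃ := hα ▸ min_le_right _ _
    calc α * ν / n ≤ s / K * α₃ * ν / n := by gcongr
      _ = ν * α₃ / s := by
          field_simp
          linarith
      _ ≤ _ := by
          gcongr
          exact le_add_of_nonneg_right (by positivity)
  -- The minimum is attained by one of its arguments, so 1/(αK) equals 1/(aK) or α₃⁻¹/√(nK).
  · rcases min_choice a (s / K * α₃) with h | h <;> rw [h] at hα <;> rw [hα]
    · exact le_add_of_nonneg_left (by positivity)
    · refine le_add_of_le_of_nonneg ?_ (by positivity)
      calc 1 / (s / K * α₃ * K) = α₃⁻¹ / s := by field_simp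
        _ ≤ _ := by
          gcongr
          exact le_add_of_nonneg_left (by positivity)

end Consts

/-! ### The convergence rate -/

section Rate

variable {m n S N : ℕ} {X Y : Type*} [NormedAddCommGroup X] [InnerProductSpace ℝ X]
  [FiniteDimensional ℝ X] [NormedAddCommGroup Y] [InnerProductSpace ℝ Y] [FiniteDimensional ℝ Y]
  [MeasurableSpace X] [BorelSpace X] [MeasurableSpace Y] [BorelSpace Y]
  {Zf Zg : Type u} [MeasurableSpace Zf] [MeasurableSpace Zg] {B : Problem m X Y Zf Zg} {c : Consts}
  [NeZero m] [∀ s : Source m n S, IsProbabilityMeasure (s.law B N)]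
  (hB : B.Assumptions c) (hc : c.Valid) {ystar : X → Y} (hy : B.IsLowerSolution ystar)
  {T : ℕ} {α β : ℝ} {x₀ : X} {y₀ : Y}
include hB hc hy

theorem measurable_sq_norm_gradient_iter (k : ℕ) : Measurable fun d : Draws m n S N Zf Zg =>
    ‖gradient (B.Phi ystar) (iter B c.lg1 d T (fun _ => α) (fun _ _ => β) x₀ y₀ k).1‖ ^ 2 :=
  ((continuous_gradient_Phi hB hc hy).measurable.comp
    (measurable_fst.comp (measurable_innerState hB k 0))).norm.pow_const 2

theorem sq_norm_gradient_Phi_le (x : X) :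
    ‖gradient (B.Phi ystar) x‖ ^ 2 ≤ c.gradBound ^ 2 :=
  pow_le_pow_left₀ (norm_nonneg _) (norm_gradient_Phi_le hB hc hy x) 2

theorem integrable_sq_norm_gradient_iter (k : ℕ) : Integrable (fun d : Draws m n S N Zf Zg =>
    ‖gradient (B.Phi ystar) (iter B c.lg1 d T (fun _ => α) (fun _ _ => β) x₀ y₀ k).1‖ ^ 2)
    (drawsLaw n S N B) :=
  .of_bound (measurable_sq_norm_gradient_iter hB hc hy k).aestronglyMeasurable (c.gradBound ^ 2)
    (.of_forall fun d => by
      rw [Real.norm_of_nonneg (by positivity)]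
      exact sq_norm_gradient_Phi_le hB hc hy _)

theorem average_gradient_le [NeZero n] [NeZero N] [NeZero S] [Nonempty (Fin n ↪ Fin m)]
    {η r α₃ ΔΦ Δy : ℝ} {K : ℕ} (hη : 0 < η) (hr : 1 ≤ r) (hT : 1 ≤ T) (hK : 1 ≤ K)
    (hα₃ : 0 < α₃) (hα : α = min (min (c.alphaHat1 η) (c.alphaHat2 η T)) (√((n : ℝ) / K) * α₃))
    (hβ : β = c.betaBar η r * (α / T)) (hΦ : ∀ x, B.Phi ystar x₀ - B.Phi ystar x ≤ ΔΦ)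
    (hΔ : ‖y₀ - ystar x₀‖ ^ 2 ≤ Δy) :
    (1 / (K : ℝ)) * ∑ k ∈ Finset.range K, ∫ d, ‖gradient (B.Phi ystar)
        (iter B c.lg1 d T (fun _ => α) (fun _ _ => β) x₀ y₀ k).1‖ ^ 2 ∂drawsLaw n S N B
      ≤ c.rateConst η ΔΦ Δy * ((c.neumannFactor N * α₃ + α₃⁻¹) / √((n : ℝ) * K)
          + 1 / (min (c.alphaHat1 η) (c.alphaHat2 η T) * K) + c.bias N ^ 2) := by
  have hn : 1 ≤ n := NeZero.one_le
  have hn' : (0 : ℝ) < n := by exact_mod_cast hn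
  have hK' : (0 : ℝ) < K := by exact_mod_cast hK
  have ha : 0 < min (c.alphaHat1 η) (c.alphaHat2 η T) :=
    lt_min (hc.alphaHat1_pos hη) (hc.alphaHat2_pos hη hT)
  have hν := c.one_le_neumannFactor N
  obtain ⟨hα0, hrate1, hrate2⟩ := Consts.step_size_rate hn hK ha hα₃ hν hα
  have hα1 : α ≤ c.alphaHat1 η := hα ▸ (min_le_left _ _).trans (min_le_left _ _)
  have hα2 : α ≤ c.alphaHat2 η T := hα ▸ (min_le_left _ _).trans (min_le_right _ _)
  set a := min (c.alphaHat1 η) (c.alphaHat2 η T)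
  set u := (c.neumannFactor N * α₃ + α₃⁻¹) / √((n : ℝ) * K)
  have hu : 0 ≤ u := by positivity
  set v := 1 / (a * K)
  have hv : 0 ≤ v := by positivity
  set w := c.bias N ^ 2
  have hw : 0 ≤ w := by positivity
  have hM := hc.Mf_pos
  have hL := hc.Ly_pos
  have hLf := hc.Lf_pos
  have hwt := hc.weight_pos
  have hcv := hc.curv_nonneg
  have hhv := c.hyperVar_nonneg
  have hno := hc.noiseConst_nonneg (η := η)
  have hgb := hc.gradBound_nonneg
  set E : ℕ → ℝ := fun k => ∫ d, ‖gradient (B.Phi ystar)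
    (iter B c.lg1 d T (fun _ => α) (fun _ _ => β) x₀ y₀ k).1‖ ^ 2 ∂drawsLaw n S N B with hE
  have hE0 : ∀ k, 0 ≤ E k := fun k => integral_nonneg fun _ => by positivity
  -- The step size ignores ν_N, so the condition that absorbs the curvature of y* may fail for large
  -- N.
  by_cases hs : c.curv * (α * (c.hyperVar * c.neumannFactor N / n)) ≤ 5 * c.Mf * c.Ly
  · have hstep : α * (2 * c.Lf + 4 * c.Mf * c.Ly) ≤ 1 :=
      (mul_le_mul_of_nonneg_right hα1 (by positivity)).trans (hc.alphaHat1_mul_le hη)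
    have hβ0 : 0 ≤ β := by
      have := hc.betaBar_pos hη hr
      rw [hβ]; positivity
    have hsum := sum_lintegral_gradient_le (n := n) (S := S) (N := N) (T := T) (x₀ := x₀)
      (y₀ := y₀) (Φlow := B.Phi ystar x₀ - ΔΦ) hB hc hy hα0 hβ0
      (hc.step_mul_le hη hr hT hα0 hβ hα2) hstep hs (hc.contraction_le hη hr hT hα0 hβ)
      (fun x => by linarith [hΦ x]) K
    have herr := hc.stepError_le hη hr hT hα0 hβ hn N hstep
    have hV0 : B.Phi ystar x₀ - (B.Phi ystar x₀ - ΔΦ) + c.weight * ‖y₀ - ystar x₀‖ ^ 2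
        ≤ |ΔΦ| + c.weight * |Δy| := by
      have h1 := le_abs_self ΔΦ
      have h2 := mul_le_mul_of_nonneg_left (hΔ.trans (le_abs_self Δy)) hwt.le
      linarith
    set e := α * ((c.lf0 / c.lf1) ^ 2 * w + c.noiseConst η * (α * c.neumannFactor N / n)) with he
    have he0 : 0 ≤ e := by positivity
    have hlin : ∀ k, ∫⁻ d, ENNReal.ofReal (α / 2 * ‖gradient (B.Phi ystar)
        (innerState B c.lg1 T α β x₀ y₀ d k 0).1‖ ^ 2) ∂drawsLaw n S N B
        = ENNReal.ofReal (α / 2 * E k) := fun k => by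
      rw [hE]
      dsimp only
      rw [← integral_const_mul, ofReal_integral_eq_lintegral_ofReal
        ((integrable_sq_norm_gradient_iter hB hc hy k).const_mul _)
        (.of_forall fun _ => by positivity)]
      rfl
    have hreal : ∑ k ∈ Finset.range K, α / 2 * E k ≤ (|ΔΦ| + c.weight * |Δy|) + K * e := by
      simp only [hlin] at hsum
      rw [← ENNReal.ofReal_sum_of_nonneg fun k _ => mul_nonneg (by positivity) (hE0 k)] at hsum
      refine (ENNReal.ofReal_le_ofReal_iff (by positivity)).1 (hsum.trans ?_)
      rw [ENNReal.ofReal_add (p := |ΔΦ| + c.weight * |Δy|) (by positivity)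
        (mul_nonneg K.cast_nonneg he0), ENNReal.ofReal_mul K.cast_nonneg, ENNReal.ofReal_natCast]
      gcongr
    have h1 : (1 / (K : ℝ)) * ∑ k ∈ Finset.range K, E k
        ≤ 2 * (|ΔΦ| + c.weight * |Δy|) * (1 / (α * K)) + 2 * ((c.lf0 / c.lf1) ^ 2 * w
          + c.noiseConst η * (α * c.neumannFactor N / n)) := by
      rw [← Finset.mul_sum] at hreal
      calc _ = 2 / (α * K) * (α / 2 * ∑ k ∈ Finset.range K, E k) := by field_simp
        _ ≤ 2 / (α * K) * ((|ΔΦ| + c.weight * |Δy|) + K * e) := by gcongr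
        _ = _ := by rw [he]; field_simp
    have hV : 0 ≤ |ΔΦ| + c.weight * |Δy| := by positivity
    have hq : 0 ≤ c.gradBound ^ 2 * (c.curv * c.hyperVar / (5 * c.Mf * c.Ly)) := by positivity
    calc _ ≤ 2 * (|ΔΦ| + c.weight * |Δy|) * (u + v) + 2 * ((c.lf0 / c.lf1) ^ 2 * w
          + c.noiseConst η * u) := h1.trans (by gcongr)
      _ ≤ 2 * (|ΔΦ| + c.weight * |Δy|) * (u + v + w) + 2 * ((c.lf0 / c.lf1) ^ 2 * (u + v + w)
          + c.noiseConst η * (u + v + w)) := by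
          have g1 := mul_le_mul_of_nonneg_left (show u + v ≤ u + v + w by linarith) hV
          have g2 := mul_le_mul_of_nonneg_left (show w ≤ u + v + w by linarith)
            (sq_nonneg (c.lf0 / c.lf1))
          have g3 := mul_le_mul_of_nonneg_left (show u ≤ u + v + w by linarith) hno
          linarith
      _ = (2 * (|ΔΦ| + c.weight * |Δy|) + 2 * (c.lf0 / c.lf1) ^ 2 + 2 * c.noiseConst η)
          * (u + v + w) := by ring
      _ ≤ _ := by
          unfold Consts.rateConst
          exact mul_le_mul_of_nonneg_right (by linarith) (by positivity)
  -- When `hs` fails, αν_N/n, and with it `u`, exceeds a positive constant; the uniform gradient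
  -- bound is then at most a constant times `u`.
  · have hEle : ∀ k, E k ≤ c.gradBound ^ 2 := fun k => by
      refine (integral_mono (integrable_sq_norm_gradient_iter hB hc hy k)
        (integrable_const (c.gradBound ^ 2)) fun d => sq_norm_gradient_Phi_le hB hc hy _).trans_eq ?_
      rw [integral_const, probReal_univ, one_smul]
    have h1 : (1 / (K : ℝ)) * ∑ k ∈ Finset.range K, E k ≤ c.gradBound ^ 2 := by
      refine (mul_le_mul_of_nonneg_left (Finset.sum_le_sum fun k _ => hEle k)
        (by positivity)).trans_eq ?_
      rw [Finset.sum_const, Finset.card_range, nsmul_eq_mul]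
      field_simp
    have h2 : 1 ≤ c.curv * c.hyperVar / (5 * c.Mf * c.Ly) * u := by
      calc (1 : ℝ) ≤ c.curv * (α * (c.hyperVar * c.neumannFactor N / n)) / (5 * c.Mf * c.Ly) :=
            (one_le_div (by positivity)).2 (not_le.1 hs).le
        _ = c.curv * c.hyperVar / (5 * c.Mf * c.Ly) * (α * c.neumannFactor N / n) := by ring
        _ ≤ _ := by gcongr
    calc _ ≤ c.gradBound ^ 2 * 1 := by rw [mul_one]; exact h1
      _ ≤ c.gradBound ^ 2 * (c.curv * c.hyperVar / (5 * c.Mf * c.Ly) * u) := by gcongr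
      _ = c.gradBound ^ 2 * (c.curv * c.hyperVar / (5 * c.Mf * c.Ly)) * u := by ring
      _ ≤ _ := by
          unfold Consts.rateConst
          refine mul_le_mul (le_add_of_nonneg_left (by positivity)) (by linarith) hu
            (by positivity)

end Rate

/-- Independence and the marginal laws determine the joint law, so expectations over Ω may be
computed under the product measure. -/
theorem IsSampling.measurePreserving {m n S N : ℕ} {X Y : Type*} [NormedAddCommGroup X]
    [InnerProductSpace ℝ X] [FiniteDimensional ℝ X] [NormedAddCommGroup Y] [InnerProductSpace ℝ Y]
    [FiniteDimensional ℝ Y] {Zf Zg : Type u} [MeasurableSpace Zf] [MeasurableSpace Zg]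
    {B : Problem m X Y Zf Zg} [∀ s : Source m n S, IsProbabilityMeasure (s.law B N)]
    {Ω : Type v} [MeasurableSpace Ω] {P : Measure Ω} [IsProbabilityMeasure P]
    {d : Ω → Draws m n S N Zf Zg} (h : IsSampling B N P d) :
    MeasurePreserving d P (drawsLaw n S N B) := by
  refine ⟨measurable_pi_iff.2 h.measurable, ?_⟩
  refine ((iIndepFun_iff_map_fun_eq_infinitePi_map h.measurable).1 h.indep).trans ?_
  simp only [h.law_eq]

end FedMBO

theorem theorem1 (c : FedMBO.Consts) (hc : c.Valid) (η : ℝ) (hη : 0 < η) (ΔΦ Δy : ℝ) :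
    ∃ C : ℝ, 0 < C ∧
      ∀ (m p q n S T N K : ℕ), 1 ≤ n → n ≤ m → 1 ≤ S → 1 ≤ T → 1 ≤ N → 1 ≤ K →
      ∀ (Zf Zg : Type u) [MeasurableSpace Zf] [MeasurableSpace Zg]
        (B : FedMBO.Problem m (EuclideanSpace ℝ (Fin p)) (EuclideanSpace ℝ (Fin q)) Zf Zg), B.Assumptions c →
      ∀ (ystar : EuclideanSpace ℝ (Fin p) → EuclideanSpace ℝ (Fin q)), B.IsLowerSolution ystar →
      ∀ (x₀ : EuclideanSpace ℝ (Fin p)) (y₀ : EuclideanSpace ℝ (Fin q)),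
        (∀ x, B.Phi ystar x₀ - B.Phi ystar x ≤ ΔΦ) → ‖y₀ - ystar x₀‖ ^ 2 ≤ Δy →
      ∀ (Ω : Type v) [MeasurableSpace Ω] (P : Measure Ω) [IsProbabilityMeasure P]
        (d : Ω → FedMBO.Draws m n S N Zf Zg), FedMBO.IsSampling B N P d →
      ∀ (α₃ r α β : ℝ), 0 < α₃ → (r = n ∨ r = 1) →
        α = min (min (c.alphaHat1 η) (c.alphaHat2 η T)) (√((n : ℝ) / K) * α₃) →
        β = c.betaBar η r * (α / T) →
      Differentiable ℝ (B.Phi ystar) ∧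
      (∀ k, k < K → Integrable (fun ω => ‖gradient (B.Phi ystar)
        (FedMBO.iter B c.lg1 (d ω) T (fun _ => α) (fun _ _ => β) x₀ y₀ k).1‖ ^ 2) P) ∧
      (1 / (K : ℝ)) * ∑ k ∈ Finset.range K, ∫ ω, ‖gradient (B.Phi ystar)
        (FedMBO.iter B c.lg1 (d ω) T (fun _ => α) (fun _ _ => β) x₀ y₀ k).1‖ ^ 2 ∂P
      ≤ C * ((c.neumannFactor N * α₃ + α₃⁻¹) / √((n : ℝ) * K)
          + 1 / (min (c.alphaHat1 η) (c.alphaHat2 η T) * K) + c.bias N ^ 2) := by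
  -- The constant is fixed before any problem is given, so signs of ΔΦ and Δy are unknown: it
  -- contains their absolute values, and a summand 1 to be positive.
  refine ⟨c.rateConst η ΔΦ Δy, hc.rateConst_pos η ΔΦ Δy, ?_⟩
  intro m p q n S T N K hn hnm hS hT hN hK Zf Zg _ _ B hB ystar hy x₀ y₀ hΦ hΔ Ω _ P _ d hd α₃ r α β
    hα₃ hr hα hβ
  have : NeZero m := ⟨by omega⟩
  have : NeZero n := ⟨by omega⟩
  have : NeZero S := ⟨by omega⟩
  have : NeZero N := ⟨by omega⟩
  have : Nonempty (Fin n ↪ Fin m) := ⟨Fin.castLEEmb hnm⟩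
  have : ∀ s : FedMBO.Source m n S, IsProbabilityMeasure (s.law B N) :=
    FedMBO.isProbabilityMeasure_law hB hn hnm hN
  have hr1 : 1 ≤ r := by
    rcases hr with rfl | rfl
    · exact_mod_cast hn
    · exact le_rfl
  have hmp := hd.measurePreserving
  refine ⟨fun x => (FedMBO.hasGradientAt_Phi hB hc hy x).differentiableAt, fun k _ =>
    hmp.integrable_comp_of_integrable (FedMBO.integrable_sq_norm_gradient_iter hB hc hy k), ?_⟩
  refine le_trans (le_of_eq ?_)
    (FedMBO.average_gradient_le (n := n) (S := S) (N := N) (T := T) hB hc hy hη hr1 hT hK hα₃ hα hβ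
      hΦ hΔ)
  congr 1
  refine Finset.sum_congr rfl fun k _ => ?_
  rw [← hmp.map_eq, integral_map hmp.measurable.aemeasurable
    (FedMBO.measurable_sq_norm_gradient_iter hB hc hy k).aestronglyMeasurable]
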